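/- Let $d\ge 1$ be an integer, $r\in[1,2)$ and $\mu\in\mathbb R$. Put $$\nu=\begin{cases}\tfrac12\sqrt{1-4\mu}, & \mu\le 1/4,\\ \tfrac i2\sqrt{4\mu-1}, & \mu>1/4,\end{cases}\qquad \alpha=\frac12+\operatorname{Re}\nu-\frac{d(2-r)}{2r},\qquad \delta=\begin{cases}1,&\mu=1/4,\\0,&\mu\ne 1/4,\end{cases}$$ and assume $\alpha<1$. Let $\Sigma^r=(H^1(\mathbb R^d)\cap L^r(\mathbb R^d))\times(L^2(\mathbb R^d)\cap L^r(\mathbb R^d))$ with norm $\|(v_0,v_1)\|_{\Sigma^r}=\|v_0\|_{H^1}+\|v_0\|_{L^r}+\|v_1\|_{L^2}+\|v_1\|_{L^r}$ (functions are complex-valued). For $t\ge0$ let $$\mathcal W(t)=\begin{pmatrix}\cos(t|\nabla|) & |\nabla|^{-1}\sin(t|\nabla|)\\ -|\nabla|\sin(t|\nabla|) & \cos(t|\nabla|)\end{pmatrix}$$ be the solution map of the free wave equation. Let $\dot H^1(\mathbb R^d)$ be the space of tempered distributions with distributional gradient in $L^2$, with $\|f\|_{\dot H^1}=\|\nabla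 f\|_{L^2}$ (so constants have norm zero), and let $\|(f,g)\|_{\dot H^1\times L^2}=(\|\nabla f\|_{L^2}^2+\|g\|_{L^2}^2)^{1/2}$. Then there is a constant $C>0$, depending only on $d$, $r$ and $\mu$, such that the following holds. Let $(v_0,v_1)\in\Sigma^r$ and let $v\in C([0,\infty);H^1(\mathbb R^d))\cap C^1([0,\infty);L^2(\mathbb R^d))$ be the (distributional) solution of $$\partial_t^2v-\Delta v+\frac{\mu}{(1+t)^2}v=0\ \text{ in }(0,\infty)\times\mathbb R^d,\qquad (v(0),\partial_tv(0))=(v_0,v_1).$$ Then there exists $\vec v_+\in\dot H^1(\mathbb R^d)\times L^2(\mathbb R^d)$ such that for all $t\ge0$ $$\bigl\|(v(t),\partial_tv(t))-\mathcal W(t)\vec v_+\bigr\|_{\dot H^1\times L^2}\le C\,|\mu|\,\|(v_0,v_1)\|_{\Sigma^r}\times \begin{cases} (1+t)^{-1}\{1+\log(1+t)\}^{\delta}, & \alpha<0,\ \text{or } \alpha=0 \text{ and } r>1,\\ (1+t)^{-1}\{1+\log(1+t)\}^{\frac12+\delta}, & \alpha=0 \text{ and } r=1,\\ (1+t)^{\alpha-1}\{1+\log(1+t)\}^{\delta},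 & \alpha\in(0,1). \end{cases}$$ -/

import Mathlib

namespace ScaleInvariantKG

open MeasureTheory
open scoped ENNReal SchwartzMap LineDeriv Laplacian ContDiff Nat

noncomputable section

/-! Function spaces on `ℝ^d` -/

/-- The Euclidean space `ℝ^d`. -/
abbrev Space (d : ℕ) := EuclideanSpace ℝ (Fin d)

/-- Complex-valued `L²(ℝ^d)`. -/
abbrev L2 (d : ℕ) := Lp ℂ 2 (volume : Measure (Space d))

/-- Complex-valued tempered distributions on `ℝ^d`. -/
abbrev Distr (d : ℕ) := 𝓢'(Space d, ℂ)

/-- An `L²` function regarded as a tempered distribution, `u ↦ ∫ u f`. -/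
abbrev toDistr {d : ℕ} (f : L2 d) : Distr d := Lp.toTemperedDistribution f

/-- The distributional partial derivative in the `j`-th coordinate direction. -/
def pderiv {d : ℕ} (j : Fin d) (T : Distr d) : Distr d :=
  ∂_{(EuclideanSpace.single j (1 : ℝ) : Space d)} T

/-- The `L²` norm of a tempered distribution; it is `⊤` if the distribution is not given by
an `L²` function. -/
def l2Norm {d : ℕ} (T : Distr d) : ℝ≥0∞ := ⨅ (f : L2 d) (_ : toDistr f = T), ‖f‖ₑ

/-- The `Ḣ¹` norm `‖∇T‖_{L²}` of a tempered distribution; it is `⊤` if the distributional gradient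
is not in `L²`. -/
def hDotOneNorm {d : ℕ} (T : Distr d) : ℝ≥0∞ := (∑ j, l2Norm (pderiv j T) ^ 2) ^ (1 / 2 : ℝ)

/-- The `H¹` norm of a tempered distribution; it is `⊤` outside of `H¹`. -/
def hOneNorm {d : ℕ} (T : Distr d) : ℝ≥0∞ :=
  (l2Norm T ^ 2 + hDotOneNorm T ^ 2) ^ (1 / 2 : ℝ)

/-- The norm of `Ḣ¹ × L²`. A pair of tempered distributions is in `Ḣ¹ × L²` iff this is finite. -/
def energyNorm {d : ℕ} (p : Distr d × Distr d) : ℝ≥0∞ :=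
  (hDotOneNorm p.1 ^ 2 + l2Norm p.2 ^ 2) ^ (1 / 2 : ℝ)

/-- The norm of `Σ^r = (H¹ ∩ L^r) × (L² ∩ L^r)`. A pair of `L²` functions is in `Σ^r` iff this is
finite. -/
def sigmaNorm {d : ℕ} (r : ℝ) (v₀ v₁ : L2 d) : ℝ≥0∞ :=
  hOneNorm (toDistr v₀) + eLpNorm v₀ (ENNReal.ofReal r) volume
    + (‖v₁‖ₑ + eLpNorm v₁ (ENNReal.ofReal r) volume)

/-! The Klein-Gordon equation with scale-invariant mass -/

/-- `v` (with time derivative `vt`) is the solution in `C([0,∞); H¹) ∩ C¹([0,∞); L²)` of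
`∂_t² v - Δ v + μ (1+t)⁻² v = 0` with `(v, ∂_t v) = (v₀, v₁)` at `t = 0`; the equation holds in the
sense of distributions. -/
structure IsSolution {d : ℕ} (μ : ℝ) (v₀ v₁ : L2 d) (v vt : ℝ → L2 d) : Prop where
  initial_fst : v 0 = v₀
  initial_snd : vt 0 = v₁
  hasDeriv : ∀ t, 0 ≤ t → HasDerivWithinAt v (vt t) (Set.Ici 0) t
  continuous_vt : ContinuousOn vt (Set.Ici 0)
  continuous_grad : ∀ j : Fin d, ∃ G : ℝ → L2 d, ContinuousOn G (Set.Ici 0) ∧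
    ∀ t, 0 ≤ t → pderiv j (toDistr (v t)) = toDistr (G t)
  equation : ∀ u : 𝓢(Space d, ℂ), ∀ t, 0 < t →
    HasDerivAt (fun s => toDistr (vt s) u)
      ((Δ (toDistr (v t))) u - ((μ / (1 + t) ^ 2 : ℝ) : ℂ) * toDistr (v t) u) t

/-! The free wave propagator. With the Fourier transform `∫ e^{-2πi⟨x,ξ⟩} f(x) dx`, the operator
`|∇|` has the symbol `2π|ξ|`. -/

/-- The symbol of `cos (t|∇|)`. -/
def cosSymbol (d : ℕ) (t : ℝ) (ξ : Space d) : ℂ := (Real.cos (t * (2 * Real.pi * ‖ξ‖)) : ℝ)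

/-- The symbol of `|∇|⁻¹ sin (t|∇|)`, with its limit value `t` at `ξ = 0`. -/
def sinDivSymbol (d : ℕ) (t : ℝ) (ξ : Space d) : ℂ :=
  (t * Real.sinc (t * (2 * Real.pi * ‖ξ‖)) : ℝ)

/-- The symbol of `|∇| sin (t|∇|)`. -/
def mulSinSymbol (d : ℕ) (t : ℝ) (ξ : Space d) : ℂ :=
  (2 * Real.pi * ‖ξ‖ * Real.sin (t * (2 * Real.pi * ‖ξ‖)) : ℝ)

/-- The free wave propagator `𝒲(t)`: with `w(t) = cos (t|∇|) f + |∇|⁻¹ sin (t|∇|) g`,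
it maps `(f, g)` to `(w(t), ∂_t w(t))`. -/
def freeWave {d : ℕ} (t : ℝ) (p : Distr d × Distr d) : Distr d × Distr d :=
  (TemperedDistribution.fourierMultiplierCLM ℂ (cosSymbol d t) p.1
      + TemperedDistribution.fourierMultiplierCLM ℂ (sinDivSymbol d t) p.2,
    -TemperedDistribution.fourierMultiplierCLM ℂ (mulSinSymbol d t) p.1
      + TemperedDistribution.fourierMultiplierCLM ℂ (cosSymbol d t) p.2)

/-! The exponents -/

/-- `ν = ½ √(1-4μ)` if `μ ≤ 1/4` and `ν = (i/2) √(4μ-1)` if `μ > 1/4`. -/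
def nu (μ : ℝ) : ℂ :=
  if μ ≤ 1 / 4 then (1 / 2 : ℂ) * (√(1 - 4 * μ) : ℝ) else (Complex.I / 2) * (√(4 * μ - 1) : ℝ)

/-- `α = 1/2 + Re ν - d(2-r)/(2r)`. -/
def alpha (d : ℕ) (r μ : ℝ) : ℝ := 1 / 2 + (nu μ).re - d * (2 - r) / (2 * r)

/-- `δ = 1` if `μ = 1/4` and `δ = 0` otherwise. -/
def delta (μ : ℝ) : ℝ := if μ = 1 / 4 then 1 else 0

/-- The asymptotic order; the last branch is the case `0 < α < 1` when `1 ≤ r < 2` and `α < 1`. -/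
def rate (d : ℕ) (r μ t : ℝ) : ℝ :=
  if alpha d r μ < 0 ∨ (alpha d r μ = 0 ∧ 1 < r) then
    (1 + t) ^ (-1 : ℝ) * (1 + Real.log (1 + t)) ^ delta μ
  else if alpha d r μ = 0 ∧ r = 1 then
    (1 + t) ^ (-1 : ℝ) * (1 + Real.log (1 + t)) ^ (1 / 2 + delta μ)
  else
    (1 + t) ^ (alpha d r μ - 1) * (1 + Real.log (1 + t)) ^ delta μ

/-! The three symbols of the free wave propagator are smooth with polynomially bounded derivatives,
so the Fourier multipliers above are the genuine ones. -/

/-- The entire function `x ↦ ∑ (-x)^n / (2n)!`, equal to `cos √x` for `x ≥ 0`. -/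
def cosSqrt (x : ℝ) : ℝ :=
  FormalMultilinearSeries.ofScalarsSum (fun n : ℕ => (-1 : ℝ) ^ n / ((2 * n)! : ℝ)) x

theorem cosSqrt_sq (s : ℝ) : cosSqrt (s ^ 2) = Real.cos s := by
  rw [cosSqrt, FormalMultilinearSeries.ofScalarsSum_eq_tsum, ← (Real.hasSum_cos s).tsum_eq]
  refine tsum_congr fun n => ?_
  rw [smul_eq_mul, pow_mul]
  ring

theorem cosSqrt_contDiff : ContDiff ℝ ∞ cosSqrt := by
  set c : ℕ → ℝ := fun n : ℕ => (-1 : ℝ) ^ n / ((2 * n)! : ℝ) with hc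
  have hr : (FormalMultilinearSeries.ofScalars ℝ c).radius = ⊤ := by
    apply FormalMultilinearSeries.ofScalars_radius_eq_top_of_tendsto
    · exact Filter.Eventually.of_forall fun n => by simp [hc, Nat.factorial_ne_zero]
    · have : ∀ n : ℕ, ‖c n.succ‖ / ‖c n‖ ≤ 1 / ((n : ℝ) + 1) := by
        intro n
        have e : (2 * n.succ)! = (2 * n + 2) * ((2 * n + 1) * (2 * n)!) := by
          rw [show 2 * n.succ = (2 * n + 1) + 1 by omega, Nat.factorial_succ, Nat.factorial_succ]
        have hp : (0 : ℝ) < ((2 * n)! : ℝ) := by positivity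
        simp only [hc, norm_div, norm_pow, norm_neg, norm_one, one_pow, e]
        push_cast
        simp only [norm_mul, Real.norm_natCast, Real.norm_of_nonneg (show (0:ℝ) ≤ 2 * n + 2 by positivity),
          Real.norm_of_nonneg (show (0:ℝ) ≤ 2 * n + 1 by positivity)]
        rw [div_div_eq_mul_div, div_one, one_div_mul_eq_div, div_le_div_iff₀ (by positivity) (by positivity)]
        nlinarith [mul_nonneg hp.le (Nat.cast_nonneg (α := ℝ) n), mul_nonneg hp.le (sq_nonneg (n:ℝ))]
      exact squeeze_zero (fun n => by positivity) this tendsto_one_div_add_atTop_nhds_zero_nat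
  have h := (FormalMultilinearSeries.ofScalars ℝ c).hasFPowerSeriesOnBall (by rw [hr]; simp)
  rw [hr] at h
  have h2 : AnalyticOnNhd ℝ (FormalMultilinearSeries.ofScalars ℝ c).sum Set.univ := by
    intro x _
    exact h.analyticAt_of_mem (by simp)
  have : cosSqrt = (FormalMultilinearSeries.ofScalars ℝ c).sum := rfl
  rw [this]
  exact contDiffOn_univ.1 (h2.contDiffOn uniqueDiffOn_univ)

theorem cosSqrt_hasDerivAt (k : ℕ) (x : ℝ) :
    HasDerivAt (iteratedDeriv k cosSqrt) (iteratedDeriv (k + 1) cosSqrt x) x := by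
  rw [iteratedDeriv_succ]
  exact ((cosSqrt_contDiff.differentiable_iteratedDeriv k (by exact_mod_cast WithTop.coe_lt_top _)) x).hasDerivAt

theorem cosSqrt_deriv_sq (s : ℝ) : 2 * s * iteratedDeriv 1 cosSqrt (s ^ 2) = -Real.sin s := by
  have h1 : HasDerivAt (fun s : ℝ => cosSqrt (s ^ 2)) (iteratedDeriv 1 cosSqrt (s ^ 2) * (2 * s)) s := by
    have := (cosSqrt_hasDerivAt 0 (s ^ 2)).comp s (hasDerivAt_pow 2 s)
    simpa [Function.comp_def] using this
  have h2 : (fun s : ℝ => cosSqrt (s ^ 2)) = Real.cos := funext cosSqrt_sq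
  rw [h2] at h1
  have := h1.unique (Real.hasDerivAt_cos s)
  linarith

theorem cosSqrt_ode (k : ℕ) : ∀ x : ℝ, 0 < x → 4 * x * iteratedDeriv (k + 2) cosSqrt x
    + (4 * k + 2) * iteratedDeriv (k + 1) cosSqrt x + iteratedDeriv k cosSqrt x = 0 := by
  induction k with
  | zero =>
    intro x hx
    obtain ⟨s, hs, rfl⟩ : ∃ s : ℝ, 0 < s ∧ s ^ 2 = x := ⟨√x, Real.sqrt_pos.2 hx, Real.sq_sqrt hx.le⟩
    have h1 : HasDerivAt (fun s : ℝ => 2 * s * iteratedDeriv 1 cosSqrt (s ^ 2))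
        (2 * iteratedDeriv 1 cosSqrt (s ^ 2) + 2 * s * (iteratedDeriv 2 cosSqrt (s ^ 2) * (2 * s))) s := by
      have a := (cosSqrt_hasDerivAt 1 (s ^ 2)).comp s (hasDerivAt_pow 2 s)
      have b := ((hasDerivAt_id s).const_mul 2).mul a
      simpa [Function.comp_def, Pi.mul_def] using b
    rw [funext cosSqrt_deriv_sq] at h1
    have h2 := h1.unique (Real.hasDerivAt_sin s).neg
    have h3 := cosSqrt_sq s
    simp only [Nat.cast_zero, iteratedDeriv_zero, zero_add]
    rw [h3]
    linarith
  | succ k ih =>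
    intro x hx
    have h1 : HasDerivAt (fun x => 4 * x * iteratedDeriv (k + 2) cosSqrt x
      + (4 * k + 2) * iteratedDeriv (k + 1) cosSqrt x + iteratedDeriv k cosSqrt x)
      (4 * iteratedDeriv (k + 2) cosSqrt x + 4 * x * iteratedDeriv (k + 3) cosSqrt x
      + (4 * k + 2) * iteratedDeriv (k + 2) cosSqrt x + iteratedDeriv (k + 1) cosSqrt x) x := by
      have b := ((((hasDerivAt_id x).const_mul 4).mul (cosSqrt_hasDerivAt (k + 2) x)).add
        ((cosSqrt_hasDerivAt (k + 1) x).const_mul (4 * k + 2 : ℝ))).add (cosSqrt_hasDerivAt k x)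
      simpa [Pi.mul_def, Pi.add_def] using b
    have h2 : (fun x => 4 * x * iteratedDeriv (k + 2) cosSqrt x
      + (4 * k + 2) * iteratedDeriv (k + 1) cosSqrt x + iteratedDeriv k cosSqrt x) =ᶠ[nhds x] fun _ => 0 := by
      filter_upwards [lt_mem_nhds hx] with y hy using ih y hy
    have h3 := h1.unique ((hasDerivAt_const x (0 : ℝ)).congr_of_eventuallyEq h2)
    push_cast
    rw [show k + 1 + 2 = k + 3 by ring, show k + 1 + 1 = k + 2 by ring]
    linarith

theorem cosSqrt_bound (k : ℕ) (x : ℝ) (hx : 0 ≤ x) :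
    |iteratedDeriv k cosSqrt x| ≤ |iteratedDeriv k cosSqrt 0| := by
  have hd : ∀ x, HasDerivAt (fun x => 4 * x * (iteratedDeriv (k + 1) cosSqrt x) ^ 2
      + (iteratedDeriv k cosSqrt x) ^ 2)
      (4 * (iteratedDeriv (k + 1) cosSqrt x) ^ 2
        + 4 * x * (2 * iteratedDeriv (k + 1) cosSqrt x * iteratedDeriv (k + 2) cosSqrt x)
        + 2 * iteratedDeriv k cosSqrt x * iteratedDeriv (k + 1) cosSqrt x) x := by
    intro x
    have b := (((hasDerivAt_id x).const_mul 4).mul ((cosSqrt_hasDerivAt (k + 1) x).pow 2)).add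
        ((cosSqrt_hasDerivAt k x).pow 2)
    simpa [Pi.mul_def, Pi.add_def, Pi.pow_def] using b
  have hanti : AntitoneOn (fun x => 4 * x * (iteratedDeriv (k + 1) cosSqrt x) ^ 2
      + (iteratedDeriv k cosSqrt x) ^ 2) (Set.Ici 0) := by
    apply antitoneOn_of_deriv_nonpos (convex_Ici 0)
    · exact fun y _ => (hd y).continuousAt.continuousWithinAt
    · exact fun y _ => (hd y).differentiableAt.differentiableWithinAt
    · intro y hy
      rw [interior_Ici] at hy
      rw [(hd y).deriv]
      have := cosSqrt_ode k y hy
      have e : 4 * y * iteratedDeriv (k + 2) cosSqrt y =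
        -(4 * k + 2) * iteratedDeriv (k + 1) cosSqrt y - iteratedDeriv k cosSqrt y := by linarith
      have : 4 * (iteratedDeriv (k + 1) cosSqrt y) ^ 2
        + 4 * y * (2 * iteratedDeriv (k + 1) cosSqrt y * iteratedDeriv (k + 2) cosSqrt y)
        + 2 * iteratedDeriv k cosSqrt y * iteratedDeriv (k + 1) cosSqrt y
        = -(8 * k) * (iteratedDeriv (k + 1) cosSqrt y) ^ 2 := by
        linear_combination (2 * iteratedDeriv (k + 1) cosSqrt y) * e
      rw [this]
      have : (0 : ℝ) ≤ 8 * k := by positivity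
      nlinarith [sq_nonneg (iteratedDeriv (k + 1) cosSqrt y)]
  have := hanti Set.self_mem_Ici hx hx
  apply sq_le_sq.1
  simp only [mul_zero, zero_mul, zero_add] at this
  nlinarith [sq_nonneg (iteratedDeriv (k + 1) cosSqrt x), mul_nonneg hx (sq_nonneg (iteratedDeriv (k + 1) cosSqrt x))]

theorem hasTemperateGrowth_iteratedDeriv_cosSqrt {H : Type*} [NormedAddCommGroup H] [InnerProductSpace ℝ H] (j : ℕ) (c : ℝ) :
    (fun ξ : H => iteratedDeriv j cosSqrt (c ^ 2 * ‖ξ‖ ^ 2)).HasTemperateGrowth := by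
  have hu : UniqueDiffOn ℝ (Set.Ici (0 : ℝ)) := uniqueDiffOn_Ici 0
  have hs : ContDiff ℝ ∞ (iteratedDeriv j cosSqrt) :=
    iteratedDeriv_eq_iterate (f := cosSqrt) ▸ ContDiff.iterate_deriv j cosSqrt_contDiff
  refine Function.HasTemperateGrowth.comp' (g := iteratedDeriv j cosSqrt)
    (f := fun ξ : H => c ^ 2 * ‖ξ‖ ^ 2) (t := Set.Ici 0) ?_ hu hs.contDiffOn ?_ (by fun_prop)
  · rintro _ ⟨ξ, rfl⟩
    exact Set.mem_Ici.2 (by positivity)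
  · intro N
    refine ⟨0, ∑ n ∈ Finset.range (N + 1), |iteratedDeriv (n + j) cosSqrt 0|, by positivity, ?_⟩
    intro n hn x hx
    rw [norm_iteratedFDerivWithin_eq_norm_iteratedDerivWithin,
      iteratedDerivWithin_eq_iteratedDeriv hu (hs.contDiffAt.of_le (by exact_mod_cast le_top)) hx, pow_zero, mul_one]
    have : iteratedDeriv n (iteratedDeriv j cosSqrt) x = iteratedDeriv (n + j) cosSqrt x := by
      simp only [iteratedDeriv_eq_iterate, ← Function.iterate_add_apply]
    rw [this, Real.norm_eq_abs]
    exact (cosSqrt_bound _ x hx).trans (Finset.single_le_sum (f := fun n => |iteratedDeriv (n + j) cosSqrt 0|)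
      (fun _ _ => abs_nonneg _) (Finset.mem_range.2 (by omega)))

theorem hasTemperateGrowth_cos {H : Type*} [NormedAddCommGroup H] [InnerProductSpace ℝ H] (c : ℝ) :
    (fun ξ : H => Real.cos (c * ‖ξ‖)).HasTemperateGrowth := by
  have : (fun ξ : H => Real.cos (c * ‖ξ‖)) = fun ξ => iteratedDeriv 0 cosSqrt (c ^ 2 * ‖ξ‖ ^ 2) := by
    ext ξ
    rw [iteratedDeriv_zero, ← mul_pow, cosSqrt_sq]
  rw [this]
  exact hasTemperateGrowth_iteratedDeriv_cosSqrt 0 c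

theorem hasTemperateGrowth_sinc {H : Type*} [NormedAddCommGroup H] [InnerProductSpace ℝ H] (c : ℝ) :
    (fun ξ : H => Real.sinc (c * ‖ξ‖)).HasTemperateGrowth := by
  have key : Real.sinc = fun s => -2 * iteratedDeriv 1 cosSqrt (s ^ 2) := by
    refine Continuous.ext_on (dense_compl_singleton (0 : ℝ)) Real.continuous_sinc ?_ ?_
    · have : Continuous (iteratedDeriv 1 cosSqrt) :=
        cosSqrt_contDiff.continuous_iteratedDeriv 1 (by exact_mod_cast le_top)
      fun_prop
    · intro s hs
      have := cosSqrt_deriv_sq s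
      have hs : s ≠ 0 := hs
      rw [Real.sinc_of_ne_zero hs]
      field_simp
      linarith
  have : (fun ξ : H => Real.sinc (c * ‖ξ‖)) = fun ξ => (-2) * iteratedDeriv 1 cosSqrt (c ^ 2 * ‖ξ‖ ^ 2) := by
    ext ξ
    rw [key]; simp only []
    rw [mul_pow]
  rw [this]
  exact (Function.HasTemperateGrowth.const (-2)).mul (hasTemperateGrowth_iteratedDeriv_cosSqrt 1 c)

theorem hasTemperateGrowth_cosSymbol (d : ℕ) (t : ℝ) : (cosSymbol d t).HasTemperateGrowth := by
  have e : cosSymbol d t = Complex.ofReal ∘ fun ξ => Real.cos (t * (2 * Real.pi) * ‖ξ‖) := by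
    funext ξ
    simp only [cosSymbol, Function.comp_apply, mul_assoc]
  rw [e]
  exact Function.Complex.hasTemperateGrowth_ofReal.comp
    (hasTemperateGrowth_cos (H := Space d) (t * (2 * Real.pi)))

theorem hasTemperateGrowth_sinDivSymbol (d : ℕ) (t : ℝ) :
    (sinDivSymbol d t).HasTemperateGrowth := by
  have e : sinDivSymbol d t =
      Complex.ofReal ∘ fun ξ => t * Real.sinc (t * (2 * Real.pi) * ‖ξ‖) := by
    funext ξ
    simp only [sinDivSymbol, Function.comp_apply, mul_assoc]
  rw [e]
  exact Function.Complex.hasTemperateGrowth_ofReal.comp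
    ((Function.HasTemperateGrowth.const t).mul
      (hasTemperateGrowth_sinc (H := Space d) (t * (2 * Real.pi))))

theorem hasTemperateGrowth_mulSinSymbol (d : ℕ) (t : ℝ) :
    (mulSinSymbol d t).HasTemperateGrowth := by
  have e : mulSinSymbol d t = Complex.ofReal ∘ fun ξ => t * (2 * Real.pi) ^ 2 * ‖ξ‖ ^ 2 *
      Real.sinc (t * (2 * Real.pi) * ‖ξ‖) := by
    funext ξ
    simp only [mulSinSymbol, Function.comp_apply, ← mul_assoc]
    congr 1
    by_cases hz : t * 2 * Real.pi * ‖ξ‖ = 0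
    · rw [hz, Real.sin_zero, Real.sinc_zero]
      linear_combination (-(2 * Real.pi * ‖ξ‖)) * hz
    · rw [Real.sinc_of_ne_zero hz]
      have h : t ≠ 0 ∧ ‖ξ‖ ≠ 0 := by
        constructor <;> (rintro h; apply hz; simp [h])
      obtain ⟨h1, h2⟩ := h
      field_simp
  rw [e]
  have h : (fun ξ : Space d => t * (2 * Real.pi) ^ 2 * ‖ξ‖ ^ 2).HasTemperateGrowth := by fun_prop
  exact Function.Complex.hasTemperateGrowth_ofReal.comp
    (h.mul (hasTemperateGrowth_sinc (H := Space d) (t * (2 * Real.pi))))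

end

end ScaleInvariantKG

namespace ScaleInvariantKG

open MeasureTheory
open scoped ENNReal SchwartzMap LineDeriv Laplacian ContDiff Nat

noncomputable section

/-! Energy estimates for a second order equation in a Hilbert space -/

/-! After a Fourier transform, each frequency ω = 2π|ξ| carries the oscillator V'' + ω²V + μ(1+t)⁻²V
= 0. While ω(1+t) ≤ 1, the term ω²V is a perturbation of Euler's equation, whose solutions are
(1+t)^{1/2±ν}, with a logarithm when μ = 1/4. Once ω(1+t) ≥ 1, the potential is the perturbation,
and the energy |V'|² + ω²|V|² grows by at most a bounded factor. Hence for ω ≤ 1 the quantity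
|V(t)|² is bounded by a constant times min(1+t, 1/ω)^{1+2Re ν} (1+log(1+t))^{2δ} (|V(0)|² +
|V'(0)|²); this is `exists_mode_bound`. Since v(t) is only an L² class, no differential equation is
solved pointwise in ξ. The argument runs in the Hilbert space L², with the equation cut off to a
dyadic shell, where multiplication by ω² is bounded and ω is comparable to a constant.

The bounds are then summed over the shells ω ~ 2^{-j}. For r = 1 the Fourier transform of the data f
is bounded, so the shell carries mass at most c 2^{-jd}‖f‖²_{L¹}. For r > 1 the masses are summable
against the weights 2^{jd(2-r)/r}, which is the Hardy-Littlewood-Sobolev inequality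
`exists_tsum_mass_le`. As 2α = 1 + 2Re ν - d(2-r)/r, the sum is of size (1+t)^{2max(α,0)}, up to
logarithms. When α = 0 and r = 1, about log(1+t) shells contribute equally, which costs half a power
of the logarithm in the norm. Frequencies ω > 1 are handled by the energy from time 0 on; this is
where the H¹ norm of the data is used. The outcome is `exists_growth`: ‖v(t)‖_{L²} is bounded by
(1+t) times the claimed rate.

Finally, the free flow rotates (|∇|v, ∂_t v) by the angle tω. Undoing this rotation leaves profiles
whose time derivative has norm at most |μ|(1+t)⁻²‖v(t)‖, which is integrable because α < 1. The
profiles therefore converge, and the tail of the integral is |μ| times the rate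
(`IsFourierSolution.exists_profile_limit`). Their limits are the |∇|- and ∂_t-components of the
asymptotic state. Recovering the state requires a division by |ξ|, which `freqDiv` performs as a
regularized distribution. -/

theorem le_exp_mul_of_deriv_le {F F' K K' : ℝ → ℝ} {a b : ℝ} (hab : a ≤ b)
    (hF : ContinuousOn F (Set.Icc a b)) (hK : ContinuousOn K (Set.Icc a b))
    (hF' : ∀ t ∈ Set.Ioo a b, HasDerivAt F (F' t) t)
    (hK' : ∀ t ∈ Set.Ioo a b, HasDerivAt K (K' t) t)
    (hle : ∀ t ∈ Set.Ioo a b, F' t ≤ K' t * F t) :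
    F b ≤ Real.exp (K b - K a) * F a := by
  have hanti : AntitoneOn (fun t => F t * Real.exp (-K t)) (Set.Icc a b) := by
    have hd : ∀ t ∈ Set.Ioo a b, HasDerivAt (fun t => F t * Real.exp (-K t))
        (F' t * Real.exp (-K t) + F t * (Real.exp (-K t) * (-K' t))) t := fun t ht =>
      (hF' t ht).mul (hK' t ht).neg.exp
    apply antitoneOn_of_deriv_nonpos (convex_Icc a b)
    · exact hF.mul (Real.continuous_exp.comp_continuousOn hK.neg)
    · rw [interior_Icc]
      exact fun t ht => (hd t ht).differentiableAt.differentiableWithinAt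
    · rw [interior_Icc]
      intro t ht
      rw [(hd t ht).deriv]
      nlinarith [hle t ht, Real.exp_pos (-K t)]
  have h := hanti (Set.left_mem_Icc.2 hab) (Set.right_mem_Icc.2 hab) hab
  simp only at h
  have h2 : F b = F b * Real.exp (-K b) * Real.exp (K b) := by
    rw [mul_assoc, ← Real.exp_add, neg_add_cancel, Real.exp_zero, mul_one]
  rw [h2, show Real.exp (K b - K a) * F a = F a * Real.exp (-K a) * Real.exp (K b) by
    rw [mul_assoc, ← Real.exp_add, mul_comm]; ring_nf]
  exact mul_le_mul_of_nonneg_right h (Real.exp_pos _).le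

section Mode

open scoped InnerProductSpace

variable {H : Type*} [NormedAddCommGroup H] [InnerProductSpace ℝ H]

/-- `w` (with derivative `w₁`) solves `w'' + M w + μ (1+t)⁻² w = 0` on `[0,∞)`. -/
structure IsModeSolution (μ : ℝ) (M : H →L[ℝ] H) (w w₁ : ℝ → H) : Prop where
  symm : ∀ x y, ⟪M x, y⟫_ℝ = ⟪x, M y⟫_ℝ
  cont : ContinuousOn w (Set.Ici 0)
  cont₁ : ContinuousOn w₁ (Set.Ici 0)
  deriv : ∀ t, 0 < t → HasDerivAt w (w₁ t) t
  deriv₁ : ∀ t, 0 < t → HasDerivAt w₁ (-M (w t) - (μ / (1 + t) ^ 2) • w t) t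

variable {μ : ℝ} {M : H →L[ℝ] H} {w w₁ : ℝ → H}

/-- The M-terms cancel in the derivative of the energy, leaving -2μ(1+t)⁻²⟨w₁, w⟩. Since 2a‖w₁‖‖w‖
is at most the energy, the logarithmic growth rate is at most |μ|/(a(1+t)²), whose integral from s
to infinity is the exponent. -/
theorem IsModeSolution.energy_le (h : IsModeSolution μ M w w₁) {a : ℝ} (ha : 0 < a)
    (hlow : ∀ t, 0 ≤ t → a ^ 2 * ‖w t‖ ^ 2 ≤ ⟪M (w t), w t⟫_ℝ) {s t : ℝ} (hs : 0 ≤ s)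
    (hst : s ≤ t) :
    ‖w₁ t‖ ^ 2 + ⟪M (w t), w t⟫_ℝ ≤
      Real.exp (|μ| / (a * (1 + s))) * (‖w₁ s‖ ^ 2 + ⟪M (w s), w s⟫_ℝ) := by
  have hsub : Set.Icc s t ⊆ Set.Ici 0 := fun x hx => hs.trans hx.1
  have key := le_exp_mul_of_deriv_le (F := fun t => ‖w₁ t‖ ^ 2 + ⟪M (w t), w t⟫_ℝ)
    (F' := fun t => 2 * ⟪w₁ t, -M (w t) - (μ / (1 + t) ^ 2) • w t⟫_ℝ
      + (⟪M (w t), w₁ t⟫_ℝ + ⟪M (w₁ t), w t⟫_ℝ))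
    (K := fun t => -(|μ| / a) * (1 + t)⁻¹) (K' := fun t => -(|μ| / a) * (-1 / (1 + t) ^ 2)) hst
    ?_ ?_ ?_ ?_ ?_
  · refine key.trans (mul_le_mul_of_nonneg_right (Real.exp_le_exp.2 ?_) ?_)
    · have h1 : 0 ≤ (|μ| / a) * (1 + t)⁻¹ := by
        have : 0 ≤ 1 + t := by linarith
        positivity
      have h2 : |μ| / (a * (1 + s)) = |μ| / a * (1 + s)⁻¹ := by
        rw [div_mul_eq_div_div, div_eq_mul_inv (|μ| / a)]
      rw [h2]
      linarith
    · exact add_nonneg (sq_nonneg _) (le_trans (by positivity) (hlow s hs))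
  · exact ((h.cont₁.mono hsub).norm.pow 2).add
      ((M.continuous.comp_continuousOn (h.cont.mono hsub)).inner (𝕜 := ℝ) (h.cont.mono hsub))
  · refine continuousOn_const.mul (ContinuousOn.inv₀ (by fun_prop) fun x hx => ?_)
    have := hsub hx
    simp only [Set.mem_Ici] at this
    positivity
  · intro x hx
    have hx0 : 0 < x := lt_of_le_of_lt hs hx.1
    have hM : HasDerivAt (fun t => M (w t)) (M (w₁ x)) x := M.hasFDerivAt.comp_hasDerivAt x (h.deriv x hx0)
    exact (h.deriv₁ x hx0).norm_sq.add (hM.inner ℝ (h.deriv x hx0))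
  · intro x hx
    have hx0 : 0 < x := lt_of_le_of_lt hs hx.1
    exact (((hasDerivAt_id x).const_add 1).inv (by simp; positivity)).const_mul _
  · intro x hx
    have hx0 : 0 < x := lt_of_le_of_lt hs hx.1
    have e1 : ⟪M (w₁ x), w x⟫_ℝ = ⟪w₁ x, M (w x)⟫_ℝ := h.symm _ _
    have e2 : ⟪M (w x), w₁ x⟫_ℝ = ⟪w₁ x, M (w x)⟫_ℝ := real_inner_comm _ _
    simp only [inner_sub_right, inner_neg_right, inner_smul_right, e1, e2]
    have h3 := abs_real_inner_le_norm (w₁ x) (w x)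
    have h4 : -(μ * ⟪w₁ x, w x⟫_ℝ) ≤ |μ| * (‖w₁ x‖ * ‖w x‖) := by
      rw [← neg_mul]
      calc -μ * ⟪w₁ x, w x⟫_ℝ ≤ |-μ * ⟪w₁ x, w x⟫_ℝ| := le_abs_self _
        _ = |μ| * |⟪w₁ x, w x⟫_ℝ| := by rw [abs_mul, abs_neg]
        _ ≤ _ := by gcongr
    have h5 : 2 * a * (‖w₁ x‖ * ‖w x‖) ≤ ‖w₁ x‖ ^ 2 + ⟪M (w x), w x⟫_ℝ := by
      nlinarith [sq_nonneg (‖w₁ x‖ - a * ‖w x‖), hlow x hx0.le]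
    have hp : 0 < (1 + x) ^ 2 := by positivity
    have : 2 * (-(μ * ⟪w₁ x, w x⟫_ℝ)) ≤ |μ| / a * (‖w₁ x‖ ^ 2 + ⟪M (w x), w x⟫_ℝ) := by
      calc 2 * (-(μ * ⟪w₁ x, w x⟫_ℝ)) ≤ 2 * (|μ| * (‖w₁ x‖ * ‖w x‖)) := by linarith
        _ = |μ| / a * (2 * a * (‖w₁ x‖ * ‖w x‖)) := by field_simp
        _ ≤ _ := by gcongr
    have e3 : 2 * (-⟪w₁ x, M (w x)⟫_ℝ - μ / (1 + x) ^ 2 * ⟪w₁ x, w x⟫_ℝ) +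
        (⟪w₁ x, M (w x)⟫_ℝ + ⟪w₁ x, M (w x)⟫_ℝ) = 2 * (-(μ * ⟪w₁ x, w x⟫_ℝ)) / (1 + x) ^ 2 := by
      field_simp; ring
    rw [e3, div_le_iff₀ hp]
    refine this.trans (le_of_eq ?_)
    field_simp

/-- The quantity `(1+t) w' - w/2`, which is `(1+t)^{1/2}` times the derivative of `(1+t)^{-1/2} w`
with respect to `log (1+t)`. -/
def logVelocity (w w₁ : ℝ → H) (t : ℝ) : H := (1 + t) • w₁ t - (1 / 2 : ℝ) • w t

theorem IsModeSolution.continuousOn_logVelocity (h : IsModeSolution μ M w w₁) :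
    ContinuousOn (logVelocity w w₁) (Set.Ici 0) :=
  ((by fun_prop : ContinuousOn (fun t : ℝ => 1 + t) _).smul h.cont₁).sub (h.cont.const_smul _)

theorem IsModeSolution.deriv_eq (w w₁ : ℝ → H) {t : ℝ} (ht : 0 < t) :
    w₁ t = (1 + t)⁻¹ • ((1 / 2 : ℝ) • w t + logVelocity w w₁ t) := by
  have : (1 + t) ≠ 0 := by positivity
  rw [logVelocity, add_sub_cancel, smul_smul, inv_mul_cancel₀ this, one_smul]

/-- In the time variable log(1+t), and with p the log-velocity, the equation becomes the system w˙ =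
w/2 + p, p˙ = p/2 + (1/4-μ)w - (1+t)²Mw. Apart from the M-term it has constant coefficients, with
exponents 1/2 ± ν. -/
theorem IsModeSolution.hasDerivAt_logVelocity (h : IsModeSolution μ M w w₁) {t : ℝ} (ht : 0 < t) :
    HasDerivAt (logVelocity w w₁) ((1 + t)⁻¹ • ((1 / 2 : ℝ) • logVelocity w w₁ t
      + (1 / 4 - μ) • w t - (1 + t) ^ 2 • M (w t))) t := by
  have h1 := (((hasDerivAt_id t).const_add 1).smul (h.deriv₁ t ht)).sub
    ((h.deriv t ht).const_smul (1 / 2 : ℝ))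
  refine h1.congr_deriv ?_
  have hne : (1 + t) ≠ 0 := by positivity
  simp only [logVelocity, id]
  match_scalars <;> field_simp <;> ring

theorem norm_sq_le_of_logVelocity (w w₁ : ℝ → H) {t : ℝ} (ht : 0 ≤ t) :
    (1 + t) ^ 2 * ‖w₁ t‖ ^ 2 ≤ 2 * (‖w t‖ ^ 2 + ‖logVelocity w w₁ t‖ ^ 2) := by
  have e : (1 + t) • w₁ t = (1 / 2 : ℝ) • w t + logVelocity w w₁ t := by
    rw [logVelocity, add_sub_cancel]
  have h1 : (1 + t) * ‖w₁ t‖ ≤ 1 / 2 * ‖w t‖ + ‖logVelocity w w₁ t‖ := by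
    have := norm_add_le ((1 / 2 : ℝ) • w t) (logVelocity w w₁ t)
    rw [← e, norm_smul, norm_smul, Real.norm_of_nonneg (by positivity),
      Real.norm_of_nonneg (by positivity)] at this
    exact this
  have h2 : 0 ≤ (1 + t) * ‖w₁ t‖ := by positivity
  nlinarith [sq_nonneg (‖w t‖ - ‖logVelocity w w₁ t‖), norm_nonneg (w t),
    norm_nonneg (logVelocity w w₁ t), sq_nonneg (‖w t‖)]

theorem logVelocity_zero_le (w w₁ : ℝ → H) :
    ‖logVelocity w w₁ 0‖ ^ 2 ≤ 2 * (‖w 0‖ ^ 2 + ‖w₁ 0‖ ^ 2) := by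
  have h := norm_sub_le (w₁ 0) ((1 / 2 : ℝ) • w 0)
  rw [norm_smul, Real.norm_of_nonneg (by positivity)] at h
  have e : logVelocity w w₁ 0 = w₁ 0 - (1 / 2 : ℝ) • w 0 := by simp [logVelocity]
  rw [e]
  nlinarith [sq_nonneg (‖w 0‖ - ‖w₁ 0‖), norm_nonneg (w 0), norm_nonneg (w₁ 0),
    norm_nonneg (w₁ 0 - (1 / 2 : ℝ) • w 0)]

/-- In logarithmic time, the quadratic form ‖p‖² + κ²‖w‖² without the M-term grows at rate exactly 1
in the oscillating case μ > 1/4, and at rate at most 1 + 2κ when μ < 1/4. The M-term adds at most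
b²(1+t)²/κ to the rate. -/
theorem IsModeSolution.low_le_of_ne (h : IsModeSolution μ M w w₁) {κ g : ℝ} (hκ : 0 < κ)
    (hg : (1 / 4 - μ = -κ ^ 2 ∧ g = 0) ∨ (1 / 4 - μ = κ ^ 2 ∧ g = 2 * κ))
    {b : ℝ} (hb : 0 ≤ b) (hM : ∀ x, ‖M x‖ ≤ b ^ 2 * ‖x‖) {T : ℝ} (hT : 0 ≤ T)
    (hTb : b * (1 + T) ≤ 1) :
    ‖logVelocity w w₁ T‖ ^ 2 + κ ^ 2 * ‖w T‖ ^ 2 ≤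
      Real.exp (1 / (2 * κ)) * (1 + T) ^ (1 + g) *
        (‖logVelocity w w₁ 0‖ ^ 2 + κ ^ 2 * ‖w 0‖ ^ 2) := by
  have hsub : Set.Icc 0 T ⊆ Set.Ici 0 := fun x hx => hx.1
  have key := le_exp_mul_of_deriv_le
    (F := fun t => ‖logVelocity w w₁ t‖ ^ 2 + κ ^ 2 * ‖w t‖ ^ 2)
    (F' := fun t => 2 * ⟪logVelocity w w₁ t, (1 + t)⁻¹ • ((1 / 2 : ℝ) • logVelocity w w₁ t
      + (1 / 4 - μ) • w t - (1 + t) ^ 2 • M (w t))⟫_ℝ + κ ^ 2 * (2 * ⟪w t, w₁ t⟫_ℝ))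
    (K := fun t => (1 + g) * Real.log (1 + t) + b ^ 2 / (2 * κ) * (1 + t) ^ 2)
    (K' := fun t => (1 + g) * (1 / (1 + t)) + b ^ 2 / (2 * κ) * (2 * (1 + t))) hT
    ?_ ?_ ?_ ?_ ?_
  · refine key.trans (mul_le_mul_of_nonneg_right ?_ (by positivity))
    have hp : 0 < 1 + T := by positivity
    rw [mul_comm (Real.exp _), Real.rpow_def_of_pos hp, ← Real.exp_add]
    apply Real.exp_le_exp.2
    -- The accumulated effect of M stays bounded because the time interval ends before b(1+T)
    -- exceeds 1.
    have h1 : b ^ 2 / (2 * κ) * (1 + T) ^ 2 ≤ 1 / (2 * κ) := by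
      rw [div_mul_eq_mul_div, ← mul_pow]
      gcongr
      exact pow_le_one₀ (by positivity) hTb
    have h2 : 0 ≤ b ^ 2 / (2 * κ) := by positivity
    simp only [add_zero, Real.log_one]
    nlinarith
  · exact ((h.continuousOn_logVelocity.mono hsub).norm.pow 2).add
      (continuousOn_const.mul ((h.cont.mono hsub).norm.pow 2))
  · refine (continuousOn_const.mul (ContinuousOn.log (by fun_prop) fun x hx => ?_)).add (by fun_prop)
    have := hx.1
    positivity
  · intro x hx
    exact (h.hasDerivAt_logVelocity hx.1).norm_sq.add ((h.deriv x hx.1).norm_sq.const_mul _)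
  · intro x hx
    have h1 : HasDerivAt (fun t : ℝ => 1 + t) 1 x := (hasDerivAt_id x).const_add 1
    have hne : 1 + x ≠ 0 := by have := hx.1; positivity
    have := ((h1.log hne).const_mul (1 + g)).add ((h1.pow 2).const_mul (b ^ 2 / (2 * κ)))
    refine this.congr_deriv ?_
    simp
  · intro x hx
    have hx0 := hx.1
    have hτ : 0 < 1 + x := by positivity
    rw [IsModeSolution.deriv_eq w w₁ hx0]
    set p := logVelocity w w₁ x
    simp only [inner_smul_right, inner_add_right, inner_sub_right, real_inner_self_eq_norm_sq,
      real_inner_comm (w x) p]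
    have h1 : -⟪p, M (w x)⟫_ℝ ≤ b ^ 2 * (‖p‖ * ‖w x‖) := by
      calc -⟪p, M (w x)⟫_ℝ ≤ ‖p‖ * ‖M (w x)‖ := by
            rw [← inner_neg_right, ← norm_neg (M (w x))]; exact real_inner_le_norm _ _
        _ ≤ ‖p‖ * (b ^ 2 * ‖w x‖) := by gcongr; exact hM _
        _ = _ := by ring
    have h2 : 2 * κ * (‖p‖ * ‖w x‖) ≤ ‖p‖ ^ 2 + κ ^ 2 * ‖w x‖ ^ 2 := by
      nlinarith [sq_nonneg (‖p‖ - κ * ‖w x‖)]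
    -- This is the cross term of the constant-coefficient system: it cancels when 1/4 - μ = -κ², and
    -- equals 4κ²⟨w, p⟩ when 1/4 - μ = κ².
    have h4 : 2 * ((1 / 4 - μ) + κ ^ 2) * ⟪w x, p⟫_ℝ ≤ g * (‖p‖ ^ 2 + κ ^ 2 * ‖w x‖ ^ 2) := by
      rcases hg with ⟨h5, h6⟩ | ⟨h5, h6⟩
      · rw [h5, h6]; simp
      · rw [h5, h6]
        have h7 := real_inner_le_norm (w x) p
        have : κ ^ 2 * ⟪w x, p⟫_ℝ ≤ κ ^ 2 * (‖w x‖ * ‖p‖) := by gcongr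
        nlinarith
    have h3 : 2 * (1 + x) ^ 2 * (-⟪p, M (w x)⟫_ℝ) ≤
        b ^ 2 / κ * (1 + x) ^ 2 * (‖p‖ ^ 2 + κ ^ 2 * ‖w x‖ ^ 2) := by
      calc 2 * (1 + x) ^ 2 * (-⟪p, M (w x)⟫_ℝ) ≤ 2 * (1 + x) ^ 2 * (b ^ 2 * (‖p‖ * ‖w x‖)) := by gcongr
        _ = b ^ 2 / κ * (1 + x) ^ 2 * (2 * κ * (‖p‖ * ‖w x‖)) := by field_simp
        _ ≤ _ := by gcongr
    rw [show ((1 + g) * (1 / (1 + x)) + b ^ 2 / (2 * κ) * (2 * (1 + x))) *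
      (‖p‖ ^ 2 + κ ^ 2 * ‖w x‖ ^ 2) = (1 + x)⁻¹ * ((1 + g) * (‖p‖ ^ 2 + κ ^ 2 * ‖w x‖ ^ 2) +
      b ^ 2 / κ * (1 + x) ^ 2 * (‖p‖ ^ 2 + κ ^ 2 * ‖w x‖ ^ 2)) by field_simp]
    refine le_trans (le_of_eq ?_) (mul_le_mul_of_nonneg_left (a := (1 + x)⁻¹)
      (b := ‖p‖ ^ 2 + κ ^ 2 * ‖w x‖ ^ 2 + 2 * ((1 / 4 - μ) + κ ^ 2) * ⟪w x, p⟫_ℝ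
        + 2 * (1 + x) ^ 2 * (-⟪p, M (w x)⟫_ℝ)) (by linarith) (by positivity))
    ring

end Mode

/-! ### Uniform bounds for a single frequency shell -/

section ModeBound

open scoped InnerProductSpace

variable {H : Type*} [NormedAddCommGroup H] [InnerProductSpace ℝ H]
variable {μ : ℝ} {M : H →L[ℝ] H} {w w₁ : ℝ → H}

theorem one_add_log_sq_le {x : ℝ} (hx : 1 ≤ x) : (1 + Real.log x) ^ 2 ≤ 4 * x := by
  have h0 : 0 < √x := Real.sqrt_pos.2 (by linarith)
  have h1 : Real.log x = 2 * Real.log √x := by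
    rw [Real.log_sqrt (by linarith)]; ring
  have h2 := Real.log_le_sub_one_of_pos h0
  have h3 : √x ^ 2 = x := Real.sq_sqrt (by linarith)
  have h4 := Real.log_nonneg hx
  calc (1 + Real.log x) ^ 2 ≤ (2 * √x) ^ 2 := by gcongr; linarith
    _ = 4 * x := by rw [mul_pow, h3]; norm_num

/-- At μ = 1/4 the unperturbed system w˙ = w/2 + p, p˙ = p/2 is a Jordan block. With l(t) =
log((1+T)/(1+t)), the combination w + lp diagonalizes it, so ‖w + lp‖² + ‖p‖² grows at rate 1. As
l(T) = 0, the logarithm appears only once, in the initial value. -/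
theorem IsModeSolution.low_le_of_eq (h : IsModeSolution (1 / 4) M w w₁)
    {b : ℝ} (hb : 0 ≤ b) (hM : ∀ x, ‖M x‖ ≤ b ^ 2 * ‖x‖) {T : ℝ} (hT : 0 ≤ T)
    (hTb : b * (1 + T) ≤ 1) :
    ‖logVelocity w w₁ T‖ ^ 2 + ‖w T‖ ^ 2 ≤
      3 * Real.exp 4 * (1 + T) * (1 + Real.log (1 + T)) ^ 2 *
        (‖logVelocity w w₁ 0‖ ^ 2 + ‖w 0‖ ^ 2) := by
  have hsub : Set.Icc 0 T ⊆ Set.Ici 0 := fun x hx => hx.1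
  have hT1 : 0 < 1 + T := by positivity
  set l : ℝ → ℝ := fun t => Real.log (1 + T) - Real.log (1 + t) with hl
  set p := logVelocity w w₁ with hp
  have hlc : ContinuousOn l (Set.Icc 0 T) := by
    refine continuousOn_const.sub (ContinuousOn.log (by fun_prop) fun x hx => ?_)
    have := hx.1
    positivity
  have hlog : ∀ x ∈ Set.Ioo 0 T, HasDerivAt (fun t : ℝ => Real.log (1 + t)) (1 / (1 + x)) x := by
    intro x hx
    have h1 : HasDerivAt (fun t : ℝ => 1 + t) 1 x := (hasDerivAt_id x).const_add 1
    have hne : 1 + x ≠ 0 := by have := hx.1; positivity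
    exact h1.log hne
  have hld : ∀ x ∈ Set.Ioo 0 T, HasDerivAt l (-(1 / (1 + x))) x := fun x hx =>
    (hlog x hx).const_sub _
  have key := le_exp_mul_of_deriv_le
    (F := fun t => ‖w t + l t • p t‖ ^ 2 + ‖p t‖ ^ 2)
    (F' := fun t => 2 * ⟪w t + l t • p t, (1 + t)⁻¹ • ((1 / 2 : ℝ) • (w t + l t • p t) -
        (l t * (1 + t) ^ 2) • M (w t))⟫_ℝ + 2 * ⟪p t, (1 + t)⁻¹ • ((1 / 2 : ℝ) • p t
      + (1 / 4 - 1 / 4 : ℝ) • w t - (1 + t) ^ 2 • M (w t))⟫_ℝ)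
    (K := fun t => Real.log (1 + t) + 4 * b * (1 + t))
    (K' := fun t => 1 / (1 + t) + 4 * b * 1) hT
    ?_ ?_ ?_ ?_ ?_
  · have h1 : l T = 0 := by simp [hl]
    have h2 : l 0 = Real.log (1 + T) := by simp [hl]
    simp only [h1, h2, zero_smul, add_zero, Real.log_one, zero_add, mul_one] at key
    have hlT : 0 ≤ Real.log (1 + T) := Real.log_nonneg (by linarith)
    have h3 : Real.exp (Real.log (1 + T) + 4 * b * (1 + T) - 4 * b) ≤ Real.exp 4 * (1 + T) := by
      rw [add_sub_assoc, Real.exp_add, Real.exp_log hT1, mul_comm]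
      gcongr
      nlinarith
    have h4 : ‖w 0 + Real.log (1 + T) • p 0‖ ≤ ‖w 0‖ + Real.log (1 + T) * ‖p 0‖ := by
      refine (norm_add_le _ _).trans ?_
      rw [norm_smul, Real.norm_of_nonneg hlT]
    have h5 : ‖w 0 + Real.log (1 + T) • p 0‖ ^ 2 + ‖p 0‖ ^ 2 ≤
        3 * (1 + Real.log (1 + T)) ^ 2 * (‖p 0‖ ^ 2 + ‖w 0‖ ^ 2) := by
      have h6 : ‖w 0 + Real.log (1 + T) • p 0‖ ^ 2 ≤ (‖w 0‖ + Real.log (1 + T) * ‖p 0‖) ^ 2 := by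
        gcongr
      have h7 := sq_nonneg (‖w 0‖ - Real.log (1 + T) * ‖p 0‖)
      have h8 := mul_nonneg hlT (sq_nonneg ‖p 0‖)
      have h9 := mul_nonneg hlT (sq_nonneg ‖w 0‖)
      have h10 := mul_nonneg (sq_nonneg (Real.log (1 + T))) (sq_nonneg ‖w 0‖)
      have h11 := mul_nonneg (sq_nonneg (Real.log (1 + T))) (sq_nonneg ‖p 0‖)
      nlinarith [sq_nonneg ‖p 0‖, sq_nonneg ‖w 0‖]
    calc ‖p T‖ ^ 2 + ‖w T‖ ^ 2 = ‖w T‖ ^ 2 + ‖p T‖ ^ 2 := add_comm _ _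
      _ ≤ _ := key
      _ ≤ (Real.exp 4 * (1 + T)) *
          (3 * (1 + Real.log (1 + T)) ^ 2 * (‖p 0‖ ^ 2 + ‖w 0‖ ^ 2)) := by gcongr
      _ = _ := by ring
  · have hpc := h.continuousOn_logVelocity.mono hsub
    exact (((h.cont.mono hsub).add (hlc.smul hpc)).norm.pow 2).add (hpc.norm.pow 2)
  · refine (ContinuousOn.log (by fun_prop) fun x hx => ?_).add (by fun_prop)
    have := hx.1
    positivity
  · intro x hx
    have hpd := h.hasDerivAt_logVelocity hx.1
    have hne : 1 + x ≠ 0 := by have := hx.1; positivity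
    have ha := (h.deriv x hx.1).add ((hld x hx).smul hpd)
    refine HasDerivAt.add (HasDerivAt.norm_sq (ha.congr_deriv ?_)) hpd.norm_sq
    rw [IsModeSolution.deriv_eq w w₁ hx.1, ← hp]
    match_scalars <;> field_simp <;> ring
  · intro x hx
    have h1 : HasDerivAt (fun t : ℝ => 1 + t) 1 x := (hasDerivAt_id x).const_add 1
    exact (hlog x hx).add (h1.const_mul _)
  · intro x hx
    have hx0 := hx.1
    have hτ : 0 < 1 + x := by positivity
    have hl0 : 0 ≤ l x := sub_nonneg.2 (Real.log_le_log hτ (by linarith [hx.2]))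
    -- A logarithm squared is traded for the ratio (1+T)/(1+x). The error rate from M becomes 4b
    -- instead of carrying logarithms, and its integral over [0, T] is at most 4.
    have hl1 : (1 + l x) ^ 2 ≤ 4 * ((1 + T) / (1 + x)) := by
      have : l x = Real.log ((1 + T) / (1 + x)) := (Real.log_div hT1.ne' hτ.ne').symm
      rw [this]
      exact one_add_log_sq_le ((one_le_div hτ).2 (by linarith [hx.2]))
    set a := w x + l x • p x with ha
    have hw : w x = a - l x • p x := by rw [ha, add_sub_cancel_right]
    have hwn : ‖w x‖ ≤ ‖a‖ + l x * ‖p x‖ := by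
      conv_lhs => rw [hw]
      refine (norm_sub_le _ _).trans ?_
      rw [norm_smul, Real.norm_of_nonneg hl0]
    have hin : -⟪l x • a + p x, M (w x)⟫_ℝ ≤ b ^ 2 * ((l x * ‖a‖ + ‖p x‖) * (‖a‖ + l x * ‖p x‖)) := by
      calc -⟪l x • a + p x, M (w x)⟫_ℝ ≤ ‖l x • a + p x‖ * ‖M (w x)‖ := by
            rw [← inner_neg_right, ← norm_neg (M (w x))]; exact real_inner_le_norm _ _
        _ ≤ (l x * ‖a‖ + ‖p x‖) * (b ^ 2 * (‖a‖ + l x * ‖p x‖)) := by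
            gcongr
            · refine (norm_add_le _ _).trans ?_
              rw [norm_smul, Real.norm_of_nonneg hl0]
            · exact (hM _).trans (by gcongr)
        _ = _ := by ring
    have h6 : (l x * ‖a‖ + ‖p x‖) * (‖a‖ + l x * ‖p x‖) ≤
        2 * ((1 + T) / (1 + x)) * (‖a‖ ^ 2 + ‖p x‖ ^ 2) := by
      have h7 : (l x * ‖a‖ + ‖p x‖) * (‖a‖ + l x * ‖p x‖) ≤
          (1 + l x) ^ 2 / 2 * (‖a‖ ^ 2 + ‖p x‖ ^ 2) := by
        nlinarith [mul_nonneg (sq_nonneg (‖a‖ - ‖p x‖)) (add_nonneg zero_le_one (sq_nonneg (l x)))]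
      refine h7.trans ?_
      gcongr
      linarith
    have h8 : 2 * (1 + x) ^ 2 * (-⟪l x • a + p x, M (w x)⟫_ℝ) ≤
        4 * b * (1 + x) * (‖a‖ ^ 2 + ‖p x‖ ^ 2) := by
      calc 2 * (1 + x) ^ 2 * (-⟪l x • a + p x, M (w x)⟫_ℝ) ≤
          2 * (1 + x) ^ 2 * (b ^ 2 * (2 * ((1 + T) / (1 + x)) * (‖a‖ ^ 2 + ‖p x‖ ^ 2))) := by
            gcongr
            exact hin.trans (by gcongr)
        -- One of the two factors b is absorbed by b(1+T) ≤ 1; the other remains as the constant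
        -- rate.
        _ = (b * (1 + T)) * (4 * b * (1 + x) * (‖a‖ ^ 2 + ‖p x‖ ^ 2)) := by field_simp; ring
        _ ≤ 1 * (4 * b * (1 + x) * (‖a‖ ^ 2 + ‖p x‖ ^ 2)) := by gcongr
        _ = _ := one_mul _
    simp only [inner_add_left, inner_smul_left, RCLike.conj_to_real] at h8
    simp only [sub_self, zero_smul, add_zero, inner_smul_right, inner_sub_right,
      real_inner_self_eq_norm_sq]
    have hfin := mul_le_mul_of_nonneg_left (add_le_add_right h8 (‖a‖ ^ 2 + ‖p x‖ ^ 2))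
      (inv_nonneg.2 hτ.le)
    refine (le_of_eq ?_).trans (hfin.trans (le_of_eq ?_))
    · ring
    · field_simp

theorem nu_re_of_le {μ : ℝ} (h : μ ≤ 1 / 4) : (nu μ).re = √(1 - 4 * μ) / 2 := by
  rw [nu, if_pos h, show (1 / 2 : ℂ) * (√(1 - 4 * μ) : ℝ) = ((1 / 2 * √(1 - 4 * μ) : ℝ) : ℂ) by
    push_cast; ring, Complex.ofReal_re]
  ring

theorem nu_re_of_lt {μ : ℝ} (h : 1 / 4 < μ) : (nu μ).re = 0 := by
  rw [nu, if_neg (not_le.2 h)]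
  simp

theorem nu_re_nonneg (μ : ℝ) : 0 ≤ (nu μ).re := by
  rcases le_or_gt μ (1 / 4) with h | h
  · rw [nu_re_of_le h]; positivity
  · rw [nu_re_of_lt h]

theorem add_le_mul_of_sq_mul_le {κ X Y X₀ Y₀ Z : ℝ} (hκ : 0 < κ) (hX : 0 ≤ X) (hY : 0 ≤ Y)
    (hX₀ : 0 ≤ X₀) (hY₀ : 0 ≤ Y₀) (hZ : 0 ≤ Z) (h : X + κ ^ 2 * Y ≤ Z * (X₀ + κ ^ 2 * Y₀)) :
    X + Y ≤ (1 + (κ ^ 2)⁻¹) * (1 + κ ^ 2) * Z * (X₀ + Y₀) := by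
  have hk : 0 < κ ^ 2 := by positivity
  have h1 : X + Y ≤ (1 + (κ ^ 2)⁻¹) * (X + κ ^ 2 * Y) := by
    have : (1 + (κ ^ 2)⁻¹) * (X + κ ^ 2 * Y) = X + Y + (κ ^ 2)⁻¹ * X + κ ^ 2 * Y := by
      field_simp; ring
    rw [this]
    have : 0 ≤ (κ ^ 2)⁻¹ * X := by positivity
    have : 0 ≤ κ ^ 2 * Y := by positivity
    linarith
  have h2 : X₀ + κ ^ 2 * Y₀ ≤ (1 + κ ^ 2) * (X₀ + Y₀) := by nlinarith [mul_nonneg hk.le hX₀]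
  calc X + Y ≤ (1 + (κ ^ 2)⁻¹) * (Z * ((1 + κ ^ 2) * (X₀ + Y₀))) := by
        refine h1.trans ?_
        gcongr
        exact h.trans (by gcongr)
    _ = _ := by ring

variable (H) in
-- The oscillating, critical and overdamped regimes of Euler's equation are gathered under the
-- exponents Re ν and δ. The initial log-velocity is estimated by w(0) and w₁(0).
theorem exists_mode_low_bound (μ : ℝ) : ∃ C : ℝ, 0 < C ∧
    ∀ (M : H →L[ℝ] H) (w w₁ : ℝ → H), IsModeSolution μ M w w₁ → ∀ b : ℝ, 0 ≤ b →
      (∀ x, ‖M x‖ ≤ b ^ 2 * ‖x‖) → ∀ T : ℝ, 0 ≤ T → b * (1 + T) ≤ 1 →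
        ‖logVelocity w w₁ T‖ ^ 2 + ‖w T‖ ^ 2 ≤
          C * (1 + T) ^ (1 + 2 * (nu μ).re) * (1 + Real.log (1 + T)) ^ (2 * delta μ) *
            (‖w 0‖ ^ 2 + ‖w₁ 0‖ ^ 2) := by
  have main : ∃ C : ℝ, 0 < C ∧
    ∀ (M : H →L[ℝ] H) (w w₁ : ℝ → H), IsModeSolution μ M w w₁ → ∀ b : ℝ, 0 ≤ b →
      (∀ x, ‖M x‖ ≤ b ^ 2 * ‖x‖) → ∀ T : ℝ, 0 ≤ T → b * (1 + T) ≤ 1 →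
        ‖logVelocity w w₁ T‖ ^ 2 + ‖w T‖ ^ 2 ≤
          C * (1 + T) ^ (1 + 2 * (nu μ).re) * (1 + Real.log (1 + T)) ^ (2 * delta μ) *
            (‖logVelocity w w₁ 0‖ ^ 2 + ‖w 0‖ ^ 2) := by
    by_cases hμ : μ = 1 / 4
    · subst hμ
      refine ⟨3 * Real.exp 4, by positivity, fun M w w₁ h b hb hM T hT hTb => ?_⟩
      have := h.low_le_of_eq hb hM hT hTb
      rw [nu_re_of_le le_rfl, delta, if_pos rfl]
      norm_num
      exact this
    -- Here κ = |ν|, which is positive away from μ = 1/4; the growth exponent 2Re ν is 2κ or 0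
    -- according to the sign of 1/4 - μ.
    · obtain ⟨κ, hκ, hg⟩ : ∃ κ : ℝ, 0 < κ ∧
          ((1 / 4 - μ = -κ ^ 2 ∧ 2 * (nu μ).re = 0) ∨
            (1 / 4 - μ = κ ^ 2 ∧ 2 * (nu μ).re = 2 * κ)) := by
        rcases lt_or_gt_of_ne hμ with h | h
        · refine ⟨√(1 - 4 * μ) / 2, ?_, Or.inr ⟨?_, ?_⟩⟩
          · have : 0 < 1 - 4 * μ := by linarith
            positivity
          · rw [div_pow, Real.sq_sqrt (by linarith)]; ring
          · rw [nu_re_of_le h.le]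
        · refine ⟨√(4 * μ - 1) / 2, ?_, Or.inl ⟨?_, ?_⟩⟩
          · have : 0 < 4 * μ - 1 := by linarith
            positivity
          · rw [div_pow, Real.sq_sqrt (by linarith)]; ring
          · rw [nu_re_of_lt h, mul_zero]
      refine ⟨(1 + (κ ^ 2)⁻¹) * (1 + κ ^ 2) * Real.exp (1 / (2 * κ)), by positivity,
        fun M w w₁ h b hb hM T hT hTb => ?_⟩
      have := add_le_mul_of_sq_mul_le hκ (by positivity) (by positivity) (by positivity)
        (by positivity) (by positivity) (h.low_le_of_ne hκ hg hb hM hT hTb)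
      rw [delta, if_neg hμ, mul_zero, Real.rpow_zero, mul_one]
      refine this.trans (le_of_eq (by ring))
  obtain ⟨C, hC, hmain⟩ := main
  refine ⟨3 * C, by positivity, fun M w w₁ h b hb hM T hT hTb => ?_⟩
  have h1 : 0 ≤ Real.log (1 + T) := Real.log_nonneg (by linarith)
  have h2 : ‖logVelocity w w₁ 0‖ ^ 2 + ‖w 0‖ ^ 2 ≤ 3 * (‖w 0‖ ^ 2 + ‖w₁ 0‖ ^ 2) := by
    nlinarith [logVelocity_zero_le w w₁, sq_nonneg ‖w₁ 0‖]
  calc _ ≤ _ := hmain M w w₁ h b hb hM T hT hTb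
    _ ≤ C * (1 + T) ^ (1 + 2 * (nu μ).re) * (1 + Real.log (1 + T)) ^ (2 * delta μ) *
            (3 * (‖w 0‖ ^ 2 + ‖w₁ 0‖ ^ 2)) := by gcongr
    _ = _ := by ring

theorem delta_nonneg (μ : ℝ) : 0 ≤ delta μ := by
  rw [delta]; split_ifs <;> norm_num

variable (H) in
-- Two regimes are glued at 1 + s = 1/b: the perturbed Euler equation up to that time, conservation
-- of energy up to a bounded factor afterwards.
theorem exists_mode_bound (μ : ℝ) : ∃ C : ℝ, 0 < C ∧
    ∀ (M : H →L[ℝ] H) (w w₁ : ℝ → H), IsModeSolution μ M w w₁ → ∀ b : ℝ, 0 < b → b ≤ 1 →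
      (∀ x, ‖M x‖ ≤ b ^ 2 * ‖x‖) →
      (∀ t, 0 ≤ t → (b / 2) ^ 2 * ‖w t‖ ^ 2 ≤ ⟪M (w t), w t⟫_ℝ) →
      ∀ t : ℝ, 0 ≤ t →
        ‖w t‖ ^ 2 ≤ C * (min (1 + t) b⁻¹) ^ (1 + 2 * (nu μ).re) *
          (1 + Real.log (1 + t)) ^ (2 * delta μ) * (‖w 0‖ ^ 2 + ‖w₁ 0‖ ^ 2) := by
  obtain ⟨C, hC, hlow⟩ := exists_mode_low_bound H μ
  -- The energy at the gluing time is at most 3b²(‖p‖² + ‖w‖²), and division by (b/2)² turns 3 into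
  -- 12. The exponential is the energy growth with a = b/2 and 1 + s = 1/b.
  refine ⟨12 * Real.exp (2 * |μ|) * C, by positivity, fun M w w₁ h b hb hb1 hM hlo t ht => ?_⟩
  have hlt : 0 ≤ Real.log (1 + t) := Real.log_nonneg (by linarith)
  have hCE : C ≤ 12 * Real.exp (2 * |μ|) * C := by
    have := Real.one_le_exp (show 0 ≤ 2 * |μ| by positivity)
    nlinarith
  rcases le_or_gt (1 + t) b⁻¹ with hc | hc
  · have h1 := hlow M w w₁ h b hb.le hM t ht (by
      calc b * (1 + t) ≤ b * b⁻¹ := by gcongr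
        _ = 1 := mul_inv_cancel₀ hb.ne')
    rw [min_eq_left hc]
    calc ‖w t‖ ^ 2 ≤ ‖logVelocity w w₁ t‖ ^ 2 + ‖w t‖ ^ 2 := by nlinarith [sq_nonneg ‖logVelocity w w₁ t‖]
      _ ≤ _ := h1
      _ ≤ _ := by gcongr
  · rw [min_eq_right hc.le]
    have hbi : 1 ≤ b⁻¹ := (one_le_inv₀ hb).2 hb1
    set s := b⁻¹ - 1 with hs
    have hs0 : 0 ≤ s := by linarith
    have hs1 : 1 + s = b⁻¹ := by rw [hs]; ring
    have h1 := hlow M w w₁ h b hb.le hM s hs0 (by rw [hs1, mul_inv_cancel₀ hb.ne'])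
    have h2 := h.energy_le (a := b / 2) (by positivity) hlo hs0 (show s ≤ t by linarith)
    rw [hs1] at h1 h2
    rw [show |μ| / (b / 2 * b⁻¹) = 2 * |μ| by field_simp] at h2
    have h3 : ⟪M (w s), w s⟫_ℝ ≤ b ^ 2 * ‖w s‖ ^ 2 := by
      calc ⟪M (w s), w s⟫_ℝ ≤ ‖M (w s)‖ * ‖w s‖ := real_inner_le_norm _ _
        _ ≤ b ^ 2 * ‖w s‖ * ‖w s‖ := by gcongr; exact hM _
        _ = _ := by ring
    have h4 := norm_sq_le_of_logVelocity w w₁ hs0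
    rw [hs1] at h4
    have h5 : ‖w₁ s‖ ^ 2 ≤ b ^ 2 * (2 * (‖w s‖ ^ 2 + ‖logVelocity w w₁ s‖ ^ 2)) := by
      calc ‖w₁ s‖ ^ 2 = b ^ 2 * (b⁻¹ ^ 2 * ‖w₁ s‖ ^ 2) := by field_simp
        _ ≤ _ := by gcongr
    have h6 : ‖w₁ s‖ ^ 2 + ⟪M (w s), w s⟫_ℝ ≤
        3 * b ^ 2 * (‖logVelocity w w₁ s‖ ^ 2 + ‖w s‖ ^ 2) := by
      nlinarith [mul_nonneg (sq_nonneg b) (sq_nonneg ‖logVelocity w w₁ s‖)]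
    have h7 : (b / 2) ^ 2 * ‖w t‖ ^ 2 ≤ Real.exp (2 * |μ|) *
        (3 * b ^ 2 * (C * b⁻¹ ^ (1 + 2 * (nu μ).re) * (1 + Real.log b⁻¹) ^ (2 * delta μ) *
            (‖w 0‖ ^ 2 + ‖w₁ 0‖ ^ 2))) := by
      calc (b / 2) ^ 2 * ‖w t‖ ^ 2 ≤ ‖w₁ t‖ ^ 2 + ⟪M (w t), w t⟫_ℝ :=
            (hlo t ht).trans (le_add_of_nonneg_left (sq_nonneg _))
        _ ≤ _ := h2
        _ ≤ _ := by
          gcongr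
          exact h6.trans (by gcongr)
    have h8 : (1 + Real.log b⁻¹) ^ (2 * delta μ) ≤ (1 + Real.log (1 + t)) ^ (2 * delta μ) := by
      have := Real.log_nonneg hbi
      have := delta_nonneg μ
      gcongr
    have hb2 : 0 < (b / 2) ^ 2 := by positivity
    refine le_of_mul_le_mul_left (h7.trans ?_) hb2
    calc Real.exp (2 * |μ|) *
        (3 * b ^ 2 * (C * b⁻¹ ^ (1 + 2 * (nu μ).re) * (1 + Real.log b⁻¹) ^ (2 * delta μ) *
            (‖w 0‖ ^ 2 + ‖w₁ 0‖ ^ 2))) ≤ Real.exp (2 * |μ|) *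
        (3 * b ^ 2 * (C * b⁻¹ ^ (1 + 2 * (nu μ).re) * (1 + Real.log (1 + t)) ^ (2 * delta μ) *
            (‖w 0‖ ^ 2 + ‖w₁ 0‖ ^ 2))) := by gcongr
      _ = _ := by ring

end ModeBound

/-! Multiplication by bounded functions on `L²` -/

section MulOp

open scoped InnerProductSpace

variable {d : ℕ}

/-- Multiplication by an essentially bounded function on `L²`. -/
def mulOp (m : Space d → ℂ) : L2 d →L[ℂ] L2 d :=
  open Classical in
  if h : MemLp m ⊤ (volume : Measure (Space d)) then
    (ContinuousLinearMap.lsmul ℂ ℂ : ℂ →L[ℂ] ℂ →L[ℂ] ℂ).holderL volume ⊤ 2 2 (h.toLp m)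
  else 0

theorem coeFn_mulOp {m : Space d → ℂ} (h : MemLp m ⊤ volume) (f : L2 d) :
    mulOp m f =ᵐ[volume] fun ξ => m ξ * f ξ := by
  rw [mulOp, dif_pos h]
  filter_upwards [(ContinuousLinearMap.lsmul ℂ ℂ : ℂ →L[ℂ] ℂ →L[ℂ] ℂ).coeFn_holder (r := 2)
    (h.toLp m) f, h.coeFn_toLp] with ξ h1 h2
  rw [ContinuousLinearMap.holderL_apply_apply, h1, h2]
  rfl

theorem norm_mulOp_le {m : Space d → ℂ} (h : MemLp m ⊤ volume) {C : ℝ} (hC : ∀ ξ, ‖m ξ‖ ≤ C)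
    (f : L2 d) : ‖mulOp m f‖ ≤ C * ‖f‖ := by
  refine Lp.norm_le_mul_norm_of_ae_le_mul ?_
  filter_upwards [coeFn_mulOp h f] with ξ hξ
  rw [hξ, norm_mul]
  gcongr
  exact hC ξ

theorem mulOp_mulOp {m n : Space d → ℂ} (hm : MemLp m ⊤ volume) (hn : MemLp n ⊤ volume)
    (hmn : MemLp (fun ξ => m ξ * n ξ) ⊤ volume) (f : L2 d) :
    mulOp m (mulOp n f) = mulOp (fun ξ => m ξ * n ξ) f := by
  apply Lp.ext
  filter_upwards [coeFn_mulOp hm (mulOp n f), coeFn_mulOp hn f, coeFn_mulOp hmn f]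
    with ξ h1 h2 h3
  rw [h1, h2, h3, mul_assoc]

theorem inner_mulOp_left {m : Space d → ℂ} (hm : MemLp m ⊤ volume) (hr : ∀ ξ, (m ξ).im = 0)
    (f g : L2 d) : ⟪mulOp m f, g⟫_ℝ = ⟪f, mulOp m g⟫_ℝ := by
  rw [L2.inner_def, L2.inner_def]
  apply integral_congr_ae
  filter_upwards [coeFn_mulOp hm f, coeFn_mulOp hm g] with ξ h1 h2
  rw [h1, h2]
  simp only [Complex.inner, map_mul, Complex.mul_re, Complex.mul_im, Complex.conj_re,
    Complex.conj_im, hr ξ]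
  ring

theorem memLp_top_of_measurable {m : Space d → ℂ} (hm : Measurable m) {C : ℝ}
    (hC : ∀ ξ, ‖m ξ‖ ≤ C) : MemLp m ⊤ (volume : Measure (Space d)) :=
  memLp_top_of_bound hm.aestronglyMeasurable C (Filter.Eventually.of_forall hC)

theorem toDistr_mulOp {m : Space d → ℂ} (hm : m.HasTemperateGrowth) (h : MemLp m ⊤ volume)
    (f : L2 d) : toDistr (mulOp m f) = TemperedDistribution.smulLeftCLM ℂ m (toDistr f) := by
  ext u
  rw [TemperedDistribution.smulLeftCLM_apply_apply, toDistr, toDistr,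
    Lp.toTemperedDistribution_apply, Lp.toTemperedDistribution_apply]
  apply integral_congr_ae
  filter_upwards [coeFn_mulOp h f] with ξ h1
  rw [h1, SchwartzMap.smulLeftCLM_apply_apply hm]
  simp only [smul_eq_mul]
  ring

theorem toDistr_injective : Function.Injective (toDistr : L2 d → Distr d) := by
  have h := LinearMap.ker_eq_bot.1
    (Lp.ker_toTemperedDistributionCLM_eq_bot (F := ℂ) (p := 2) (μ := (volume : Measure (Space d))))
  exact h

end MulOp

/-! Weak and strong derivatives -/

/-- Integrating each scalar derivative shows that Z(s) - Z(t) and the integral of D have the same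
image under a separating family. Hence they are equal, and continuity of D makes the weak derivative
a norm derivative. -/
theorem hasDerivAt_of_forall_functional {E ι : Type*} [NormedAddCommGroup E] [NormedSpace ℝ E]
    [CompleteSpace E] (L : ι → E →L[ℝ] ℂ) (hL : ∀ x, (∀ i, L i x = 0) → x = 0)
    {Z D : ℝ → E} (hD : ContinuousOn D (Set.Ioi 0))
    (hZ : ∀ i, ∀ t, 0 < t → HasDerivAt (fun s => L i (Z s)) (L i (D t)) t) {t : ℝ} (ht : 0 < t) :
    HasDerivAt Z (D t) t := by
  have hcont : ∀ s, 0 < s → ContinuousOn D (Set.uIcc t s) := fun s hs =>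
    hD.mono fun x hx => lt_of_lt_of_le (lt_min ht hs) hx.1
  have hint : ∀ s, 0 < s → IntervalIntegrable D volume t s := fun s hs =>
    (hcont s hs).intervalIntegrable
  have heq : ∀ s, 0 < s → Z s = Z t + ∫ x in t..s, D x := by
    intro s hs
    refine sub_eq_zero.1 (hL _ fun i => ?_)
    rw [map_sub, map_add, ← (L i).intervalIntegral_comp_comm (hint s hs),
      intervalIntegral.integral_eq_sub_of_hasDerivAt (f := fun x => L i (Z x))]
    · ring
    · exact fun x hx => hZ i x (lt_of_lt_of_le (lt_min ht hs) hx.1)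
    · exact ((L i).continuous.comp_continuousOn (hcont s hs)).intervalIntegrable
  have h1 : HasDerivAt (fun s => Z t + ∫ x in t..s, D x) (D t) t := by
    refine (intervalIntegral.integral_hasDerivAt_right (hint t ht) ?_ ?_).const_add _
    · exact hD.stronglyMeasurableAtFilter isOpen_Ioi t ht
    · exact hD.continuousAt (Ioi_mem_nhds ht)
  refine h1.congr_of_eventuallyEq ?_
  filter_upwards [Ioi_mem_nhds ht] with s hs using heq s hs

/-! ### The Klein-Gordon equation on the Fourier side -/

section FourierSide

open FourierTransform

variable {d : ℕ}

/-- The symbol `2π|ξ|` of `|∇|`. -/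
def freq (ξ : Space d) : ℝ := 2 * Real.pi * ‖ξ‖

theorem freq_nonneg (ξ : Space d) : 0 ≤ freq ξ := by unfold freq; positivity

theorem measurable_freq : Measurable (freq : Space d → ℝ) := by unfold freq; fun_prop

/-- The indicator function of a set of frequencies. -/
def cutoff (B : Set (Space d)) : Space d → ℂ := B.indicator 1

theorem measurable_cutoff {B : Set (Space d)} (hB : MeasurableSet B) : Measurable (cutoff B) :=
  measurable_one.indicator hB

theorem norm_cutoff_le (B : Set (Space d)) (ξ : Space d) : ‖cutoff B ξ‖ ≤ 1 := by
  unfold cutoff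
  by_cases h : ξ ∈ B <;> simp [h]

theorem memLp_cutoff {B : Set (Space d)} (hB : MeasurableSet B) :
    MemLp (cutoff B) ⊤ (volume : Measure (Space d)) :=
  memLp_top_of_measurable (measurable_cutoff hB) (norm_cutoff_le B)

theorem norm_cutoff_mul_le {B : Set (Space d)} {h : Space d → ℂ} {C : ℝ} (hC : 0 ≤ C)
    (hb : ∀ ξ ∈ B, ‖h ξ‖ ≤ C) (ξ : Space d) : ‖cutoff B ξ * h ξ‖ ≤ C := by
  unfold cutoff
  by_cases hξ : ξ ∈ B
  · simpa [hξ] using hb ξ hξ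
  · simpa [hξ] using hC

theorem memLp_cutoff_mul {B : Set (Space d)} (hB : MeasurableSet B) {h : Space d → ℂ}
    (hh : Measurable h) {C : ℝ} (hC : 0 ≤ C) (hb : ∀ ξ ∈ B, ‖h ξ‖ ≤ C) :
    MemLp (fun ξ => cutoff B ξ * h ξ) ⊤ (volume : Measure (Space d)) :=
  memLp_top_of_measurable ((measurable_cutoff hB).mul hh) (norm_cutoff_mul_le hC hb)

/-- `V` (with time derivative `V₁`) solves the Fourier transformed equation
`V'' + (2π|ξ|)² V + μ (1+t)⁻² V = 0`, tested against bounded sets of frequencies. -/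
structure IsFourierSolution (μ : ℝ) (V V₁ : ℝ → L2 d) : Prop where
  cont : ContinuousOn V (Set.Ici 0)
  cont₁ : ContinuousOn V₁ (Set.Ici 0)
  deriv : ∀ t, 0 < t → HasDerivAt V (V₁ t) t
  deriv₁ : ∀ B : Set (Space d), MeasurableSet B → ∀ R : ℝ, (∀ ξ ∈ B, freq ξ ≤ R) →
    ∀ t, 0 < t → HasDerivAt (fun s => mulOp (cutoff B) (V₁ s))
      (-mulOp (fun ξ => cutoff B ξ * ((freq ξ ^ 2 : ℝ) : ℂ)) (V t)
        - (μ / (1 + t) ^ 2) • mulOp (cutoff B) (V t)) t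

/-- The symbol `(1+|ξ|²)⁻¹`. -/
def bessel (d : ℕ) (ξ : Space d) : ℂ := ((1 + ‖ξ‖ ^ 2) ^ (-1 : ℝ) : ℝ)

theorem bessel_eq (ξ : Space d) : bessel d ξ = ((1 + ‖ξ‖ ^ 2)⁻¹ : ℝ) := by
  rw [bessel, Real.rpow_neg_one]

theorem hasTemperateGrowth_bessel : (bessel d).HasTemperateGrowth :=
  Function.Complex.hasTemperateGrowth_ofReal.comp
    (Function.hasTemperateGrowth_one_add_norm_sq_rpow (Space d) (-1))

theorem memLp_bessel : MemLp (bessel d) ⊤ (volume : Measure (Space d)) := by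
  refine memLp_top_of_measurable (C := 1) ?_ fun ξ => ?_
  · exact hasTemperateGrowth_bessel.1.continuous.measurable
  · rw [bessel_eq, Complex.norm_real, Real.norm_of_nonneg (by positivity)]
    exact inv_le_one_of_one_le₀ (by nlinarith [sq_nonneg ‖ξ‖])

/-- The symbol `(2π|ξ|)² (1+|ξ|²)⁻¹`. -/
def freqBessel (d : ℕ) (ξ : Space d) : ℂ := ((2 * Real.pi) ^ 2 * ‖ξ‖ ^ 2 : ℝ) * bessel d ξ

theorem hasTemperateGrowth_freqBessel : (freqBessel d).HasTemperateGrowth := by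
  have h : (fun ξ : Space d => (2 * Real.pi) ^ 2 * ‖ξ‖ ^ 2).HasTemperateGrowth := by fun_prop
  exact (Function.Complex.hasTemperateGrowth_ofReal.comp h).mul hasTemperateGrowth_bessel

theorem memLp_freqBessel : MemLp (freqBessel d) ⊤ (volume : Measure (Space d)) := by
  refine memLp_top_of_measurable (C := (2 * Real.pi) ^ 2) ?_ fun ξ => ?_
  · exact hasTemperateGrowth_freqBessel.1.continuous.measurable
  · rw [freqBessel, bessel_eq, ← Complex.ofReal_mul, Complex.norm_real,
      Real.norm_of_nonneg (by positivity), mul_assoc, ← div_eq_mul_inv]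
    refine mul_le_of_le_one_right (by positivity) ((div_le_one (by positivity)).2 (by linarith))

/-- Evaluation of an `L²` function, regarded as a tempered distribution, at a test function. -/
def testAgainst (u : 𝓢(Space d, ℂ)) : L2 d →L[ℝ] ℂ :=
  ((PointwiseConvergenceCLM.evalCLM (RingHom.id ℂ) ℂ u) ∘L
    (Lp.toTemperedDistributionCLM ℂ (volume : Measure (Space d)) 2)).restrictScalars ℝ

theorem testAgainst_apply (u : 𝓢(Space d, ℂ)) (f : L2 d) : testAgainst u f = toDistr f u := rfl

/-- The function Δv need not be in L², so the equation for ∂_t v is only distributional.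
Multiplication by (1+|ξ|²)⁻¹ makes the right-hand side a continuous L²-valued function, and the weak
equation then holds strongly. -/
theorem hasDerivAt_bessel_fourier {μ : ℝ} {v₀ v₁ : L2 d} {v vt : ℝ → L2 d}
    (h : IsSolution μ v₀ v₁ v vt) {t : ℝ} (ht : 0 < t) :
    HasDerivAt (fun s => mulOp (bessel d) (𝓕 (vt s)))
      (-mulOp (freqBessel d) (𝓕 (v t)) - (μ / (1 + t) ^ 2) • mulOp (bessel d) (𝓕 (v t))) t := by
  have hv : ContinuousOn (fun s => 𝓕 (v s)) (Set.Ioi 0) :=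
    (Lp.fourierTransformₗᵢ (Space d) ℂ).continuous.comp_continuousOn fun s hs =>
      ((h.hasDeriv s (le_of_lt hs)).continuousWithinAt).mono Set.Ioi_subset_Ici_self
  refine hasDerivAt_of_forall_functional
    (L := testAgainst)
    ?_ ?_ ?_ ht
    (D := fun t => -mulOp (freqBessel d) (𝓕 (v t))
      - (μ / (1 + t) ^ 2) • mulOp (bessel d) (𝓕 (v t)))
  · intro x hx
    apply toDistr_injective
    ext u
    rw [← testAgainst_apply, ← testAgainst_apply, hx u, map_zero]
  · refine ((mulOp (freqBessel d)).continuous.comp_continuousOn hv).neg.sub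
      (ContinuousOn.smul (f := fun t : ℝ => μ / (1 + t) ^ 2) ?_
        ((mulOp (bessel d)).continuous.comp_continuousOn hv))
    refine continuousOn_const.div (by fun_prop) fun x hx => ?_
    have : (0 : ℝ) < x := hx
    positivity
  · intro u t ht
    -- Testing the equation with the Fourier transform of the damped function moves both the
    -- transform and the damping onto the solution.
    have h1 := h.equation (𝓕 (SchwartzMap.smulLeftCLM ℂ (bessel d) u)) t ht
    have e1 : ∀ f : L2 d, toDistr f (𝓕 (SchwartzMap.smulLeftCLM ℂ (bessel d) u)) =
        toDistr (mulOp (bessel d) (𝓕 f)) u := by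
      intro f
      rw [toDistr_mulOp hasTemperateGrowth_bessel memLp_bessel,
        TemperedDistribution.smulLeftCLM_apply_apply, toDistr, toDistr,
        ← Lp.fourier_toTemperedDistribution_eq, TemperedDistribution.fourier_apply]
    have e2 : Δ (toDistr (v t)) (𝓕 (SchwartzMap.smulLeftCLM ℂ (bessel d) u)) =
        -toDistr (mulOp (freqBessel d) (𝓕 (v t))) u := by
      have e3 : SchwartzMap.smulLeftCLM ℂ (freqBessel d) u = ((2 * Real.pi) ^ 2 : ℝ) •
          SchwartzMap.smulLeftCLM ℂ (fun x : Space d => Complex.ofReal (‖x‖ ^ 2))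
            (SchwartzMap.smulLeftCLM ℂ (bessel d) u) := by
        ext x
        have hg : (fun x : Space d => Complex.ofReal (‖x‖ ^ 2)).HasTemperateGrowth := by fun_prop
        rw [smul_apply, SchwartzMap.smulLeftCLM_apply_apply hg,
          SchwartzMap.smulLeftCLM_apply_apply hasTemperateGrowth_bessel,
          SchwartzMap.smulLeftCLM_apply_apply hasTemperateGrowth_freqBessel, freqBessel]
        simp only [smul_eq_mul, Complex.real_smul]
        push_cast
        ring
      rw [toDistr_mulOp hasTemperateGrowth_freqBessel memLp_freqBessel,
        TemperedDistribution.smulLeftCLM_apply_apply, e3, toDistr, toDistr,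
        ← Lp.fourier_toTemperedDistribution_eq, TemperedDistribution.fourier_apply,
        TemperedDistribution.laplacian_eq_fourierMultiplierCLM]
      generalize Lp.toTemperedDistribution (v t) = T
      rw [← Complex.coe_smul (_ ^ 2), FourierTransform.fourier_smul, map_smul, ← Complex.coe_smul]
      simp
    simp only [e1, e2] at h1
    refine h1.congr_deriv ?_
    rw [map_sub, map_neg, map_smul, testAgainst_apply, testAgainst_apply, Complex.real_smul]

theorem memLp_cutoff_freq_sq {B : Set (Space d)} (hB : MeasurableSet B) {R : ℝ}
    (hR : ∀ ξ ∈ B, freq ξ ≤ R) :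
    MemLp (fun ξ => cutoff B ξ * ((freq ξ ^ 2 : ℝ) : ℂ)) ⊤ (volume : Measure (Space d)) := by
  refine memLp_cutoff_mul (C := R ^ 2) hB
    (Complex.measurable_ofReal.comp (measurable_freq.pow_const 2)) (by positivity) ?_
  intro ξ hξ
  rw [Complex.norm_real, Real.norm_of_nonneg (by positivity)]
  have := freq_nonneg ξ
  have := hR ξ hξ
  gcongr

theorem norm_cutoff_freq_sq_le {B : Set (Space d)} {R : ℝ}
    (hR : ∀ ξ ∈ B, freq ξ ≤ R) (ξ : Space d) : ‖cutoff B ξ * ((freq ξ ^ 2 : ℝ) : ℂ)‖ ≤ R ^ 2 := by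
  refine norm_cutoff_mul_le (h := fun ξ => ((freq ξ ^ 2 : ℝ) : ℂ)) (sq_nonneg R) (fun ξ hξ => ?_) ξ
  rw [Complex.norm_real, Real.norm_of_nonneg (by positivity)]
  have := freq_nonneg ξ
  have := hR ξ hξ
  gcongr

theorem cutoff_mul_self (B : Set (Space d)) (ξ : Space d) :
    cutoff B ξ * cutoff B ξ = cutoff B ξ := by
  unfold cutoff
  by_cases h : ξ ∈ B <;> simp [h]

/-- On a bounded set of frequencies the damping (1+|ξ|²)⁻¹ is undone by multiplication with the
bounded symbol 1+|ξ|². -/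
theorem IsSolution.isFourierSolution {μ : ℝ} {v₀ v₁ : L2 d} {v vt : ℝ → L2 d}
    (h : IsSolution μ v₀ v₁ v vt) :
    IsFourierSolution μ (fun t => 𝓕 (v t)) (fun t => 𝓕 (vt t)) where
  cont := (Lp.fourierTransformₗᵢ (Space d) ℂ).continuous.comp_continuousOn fun s hs =>
    (h.hasDeriv s hs).continuousWithinAt
  cont₁ := (Lp.fourierTransformₗᵢ (Space d) ℂ).continuous.comp_continuousOn h.continuous_vt
  deriv t ht := ((Lp.fourierTransformₗᵢ (Space d) ℂ).toContinuousLinearEquiv.toContinuousLinearMap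
    |>.restrictScalars ℝ).hasFDerivAt.comp_hasDerivAt t
      ((h.hasDeriv t ht.le).hasDerivAt (Ici_mem_nhds ht))
  deriv₁ B hB R hR t ht := by
    have hmeas : Measurable fun ξ : Space d => ((1 + ‖ξ‖ ^ 2 : ℝ) : ℂ) := by fun_prop
    have hbd : ∀ ξ ∈ B, ‖((1 + ‖ξ‖ ^ 2 : ℝ) : ℂ)‖ ≤ 1 + R ^ 2 := by
      intro ξ hξ
      rw [Complex.norm_real, Real.norm_of_nonneg (add_nonneg zero_le_one (sq_nonneg _))]
      have h1 := hR ξ hξ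
      have h2 : ‖ξ‖ ≤ freq ξ := by
        unfold freq
        nlinarith [Real.pi_gt_three, norm_nonneg ξ]
      have h3 := norm_nonneg ξ
      nlinarith
    have hR2 : 0 ≤ 1 + R ^ 2 := by positivity
    have hm := memLp_cutoff_mul hB hmeas hR2 hbd
    have hbe : ∀ ξ : Space d, ((1 + ‖ξ‖ ^ 2 : ℝ) : ℂ) * bessel d ξ = 1 := by
      intro ξ
      rw [bessel_eq, ← Complex.ofReal_mul, mul_inv_cancel₀ (by positivity : (1 + ‖ξ‖ ^ 2 : ℝ) ≠ 0),
        Complex.ofReal_one]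
    have c1 : (fun ξ => (cutoff B ξ * ((1 + ‖ξ‖ ^ 2 : ℝ) : ℂ)) * bessel d ξ) = cutoff B := by
      funext ξ
      rw [mul_assoc, hbe, mul_one]
    have c2 : (fun ξ => (cutoff B ξ * ((1 + ‖ξ‖ ^ 2 : ℝ) : ℂ)) * freqBessel d ξ) =
        fun ξ => cutoff B ξ * ((freq ξ ^ 2 : ℝ) : ℂ) := by
      funext ξ
      rw [freqBessel, mul_assoc, mul_left_comm _ _ (bessel d ξ), hbe, mul_one, freq, mul_pow (2 * Real.pi) ‖ξ‖]
    have hf2 := memLp_cutoff_freq_sq hB hR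
    have h1 := ((mulOp fun ξ => cutoff B ξ * ((1 + ‖ξ‖ ^ 2 : ℝ) : ℂ)).restrictScalars
      ℝ).hasFDerivAt.comp_hasDerivAt t (hasDerivAt_bessel_fourier h ht)
    have e1 : ∀ f : L2 d, mulOp (fun ξ => cutoff B ξ * ((1 + ‖ξ‖ ^ 2 : ℝ) : ℂ))
        (mulOp (bessel d) f) = mulOp (cutoff B) f := by
      intro f
      rw [mulOp_mulOp hm memLp_bessel (by rw [c1]; exact memLp_cutoff hB), c1]
    have e2 : ∀ f : L2 d, mulOp (fun ξ => cutoff B ξ * ((1 + ‖ξ‖ ^ 2 : ℝ) : ℂ))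
        (mulOp (freqBessel d) f) = mulOp (fun ξ => cutoff B ξ * ((freq ξ ^ 2 : ℝ) : ℂ)) f := by
      intro f
      rw [mulOp_mulOp hm memLp_freqBessel (by rw [c2]; exact hf2), c2]
    refine (h1.congr_of_eventuallyEq (Filter.Eventually.of_forall fun s => ?_)).congr_deriv ?_
    · exact (e1 _).symm
    · rw [map_sub, map_neg, map_smul, ContinuousLinearMap.coe_restrictScalars', e1, e2]

theorem IsFourierSolution.isModeSolution {μ : ℝ} {V V₁ : ℝ → L2 d}
    (h : IsFourierSolution μ V V₁) {B : Set (Space d)} (hB : MeasurableSet B) {R : ℝ}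
    (hR : ∀ ξ ∈ B, freq ξ ≤ R) :
    IsModeSolution μ ((mulOp fun ξ => cutoff B ξ * ((freq ξ ^ 2 : ℝ) : ℂ)).restrictScalars ℝ)
      (fun t => mulOp (cutoff B) (V t)) (fun t => mulOp (cutoff B) (V₁ t)) where
  symm := inner_mulOp_left (memLp_cutoff_freq_sq hB hR) fun ξ => by
    unfold cutoff
    by_cases hξ : ξ ∈ B
    · rw [Set.indicator_of_mem hξ, Pi.one_apply, one_mul, Complex.ofReal_im]
    · simp [hξ]
  cont := (mulOp (cutoff B)).continuous.comp_continuousOn h.cont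
  cont₁ := (mulOp (cutoff B)).continuous.comp_continuousOn h.cont₁
  deriv t ht := ((mulOp (cutoff B)).restrictScalars ℝ).hasFDerivAt.comp_hasDerivAt t (h.deriv t ht)
  deriv₁ t ht := by
    have e : (fun ξ => cutoff B ξ * ((freq ξ ^ 2 : ℝ) : ℂ) * cutoff B ξ) =
        fun ξ => cutoff B ξ * ((freq ξ ^ 2 : ℝ) : ℂ) := by
      funext ξ
      rw [mul_right_comm, cutoff_mul_self]
    refine (h.deriv₁ B hB R hR t ht).congr_deriv ?_
    rw [ContinuousLinearMap.coe_restrictScalars', mulOp_mulOp (memLp_cutoff_freq_sq hB hR)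
      (memLp_cutoff hB) (by rw [e]; exact memLp_cutoff_freq_sq hB hR), e]

end FourierSide

/-! The distribution of the `L²` mass over frequencies -/

section Mass

open FourierTransform
open scoped InnerProductSpace

variable {d : ℕ}

/-- The measure with density `|f|²`. -/
def mass (f : L2 d) : Measure (Space d) := volume.withDensity fun ξ => ‖f ξ‖ₑ ^ 2

theorem measurable_enorm_sq (f : L2 d) : Measurable fun ξ => ‖f ξ‖ₑ ^ 2 :=
  (Lp.stronglyMeasurable f).measurable.enorm.pow_const 2

theorem enorm_sq_eq_lintegral (f : L2 d) : ‖f‖ₑ ^ 2 = ∫⁻ ξ, ‖f ξ‖ₑ ^ 2 := by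
  rw [Lp.enorm_def, eLpNorm_eq_lintegral_rpow_enorm_toReal (by norm_num) (by norm_num)]
  simp only [ENNReal.toReal_ofNat, ENNReal.rpow_ofNat]
  rw [← ENNReal.rpow_natCast, ← ENNReal.rpow_mul]
  norm_num

theorem mass_univ (f : L2 d) : mass f Set.univ = ‖f‖ₑ ^ 2 := by
  rw [mass, withDensity_apply _ MeasurableSet.univ, Measure.restrict_univ, enorm_sq_eq_lintegral]

theorem mass_le (f : L2 d) (B : Set (Space d)) : mass f B ≤ ‖f‖ₑ ^ 2 :=
  mass_univ f ▸ measure_mono (Set.subset_univ B)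

theorem enorm_mulOp_cutoff_sq (f : L2 d) {B : Set (Space d)} (hB : MeasurableSet B) :
    ‖mulOp (cutoff B) f‖ₑ ^ 2 = mass f B := by
  rw [enorm_sq_eq_lintegral, mass, withDensity_apply _ hB, ← lintegral_indicator hB]
  apply lintegral_congr_ae
  filter_upwards [coeFn_mulOp (memLp_cutoff hB) f] with ξ hξ
  rw [hξ, cutoff]
  by_cases h : ξ ∈ B <;> simp [h]

theorem ofReal_norm_sq {E : Type*} [SeminormedAddCommGroup E] (x : E) :
    ENNReal.ofReal (‖x‖ ^ 2) = ‖x‖ₑ ^ 2 := by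
  rw [ENNReal.ofReal_pow (norm_nonneg x), ofReal_norm]

theorem mass_add_le (f g : L2 d) {B : Set (Space d)} (hB : MeasurableSet B) :
    mass (f + g) B ≤ 2 * (mass f B + mass g B) := by
  rw [← enorm_mulOp_cutoff_sq _ hB, ← enorm_mulOp_cutoff_sq _ hB, ← enorm_mulOp_cutoff_sq _ hB,
    map_add, ← ofReal_norm_sq, ← ofReal_norm_sq, ← ofReal_norm_sq,
    ← ENNReal.ofReal_add (by positivity) (by positivity)]
  refine (ENNReal.ofReal_le_ofReal (q := 2 * (‖mulOp (cutoff B) f‖ ^ 2 +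
    ‖mulOp (cutoff B) g‖ ^ 2)) ?_).trans (le_of_eq ?_)
  swap
  · rw [ENNReal.ofReal_mul (by positivity), ENNReal.ofReal_ofNat]
  have h := norm_add_le (mulOp (cutoff B) f) (mulOp (cutoff B) g)
  nlinarith [sq_nonneg (‖mulOp (cutoff B) f‖ - ‖mulOp (cutoff B) g‖),
    norm_nonneg (mulOp (cutoff B) f + mulOp (cutoff B) g)]

theorem mass_smul (c : ℂ) (f : L2 d) {B : Set (Space d)} (hB : MeasurableSet B) :
    mass (c • f) B = ‖c‖ₑ ^ 2 * mass f B := by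
  rw [← enorm_mulOp_cutoff_sq _ hB, ← enorm_mulOp_cutoff_sq _ hB, map_smul, enorm_smul, mul_pow]

theorem inner_mulOp_freq_sq_ge {B : Set (Space d)} (hB : MeasurableSet B) {a R : ℝ} (ha : 0 ≤ a)
    (hR : ∀ ξ ∈ B, freq ξ ≤ R) (hlo : ∀ ξ ∈ B, a ≤ freq ξ) (f : L2 d) :
    a ^ 2 * ‖mulOp (cutoff B) f‖ ^ 2 ≤
      ⟪mulOp (fun ξ => cutoff B ξ * ((freq ξ ^ 2 : ℝ) : ℂ)) (mulOp (cutoff B) f),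
        mulOp (cutoff B) f⟫_ℝ := by
  rw [← real_inner_self_eq_norm_sq, L2.inner_def, L2.inner_def, ← integral_const_mul]
  refine integral_mono_ae ((L2.integrable_inner _ _).const_mul _) (L2.integrable_inner _ _) ?_
  filter_upwards [coeFn_mulOp (memLp_cutoff_freq_sq hB hR) (mulOp (cutoff B) f),
    coeFn_mulOp (memLp_cutoff hB) f] with ξ h1 h2
  simp only [h1, h2]
  unfold cutoff
  by_cases h : ξ ∈ B
  · simp only [h, Set.indicator_of_mem, Pi.one_apply, one_mul]
    rw [← Complex.real_smul, inner_smul_left, real_inner_self_eq_norm_sq]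
    have := hlo ξ h
    simp only [RCLike.conj_to_real]
    gcongr
  · simp [h]

theorem inner_mulOp_freq_sq_eq {B : Set (Space d)} (hB : MeasurableSet B) {R : ℝ}
    (hR : ∀ ξ ∈ B, freq ξ ≤ R) (f g : L2 d) (hg : g =ᵐ[volume] fun ξ => (freq ξ : ℂ) * f ξ) :
    ⟪mulOp (fun ξ => cutoff B ξ * ((freq ξ ^ 2 : ℝ) : ℂ)) (mulOp (cutoff B) f),
        mulOp (cutoff B) f⟫_ℝ = ‖mulOp (cutoff B) g‖ ^ 2 := by
  rw [← real_inner_self_eq_norm_sq, L2.inner_def, L2.inner_def]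
  refine integral_congr_ae ?_
  filter_upwards [coeFn_mulOp (memLp_cutoff_freq_sq hB hR) (mulOp (cutoff B) f),
    coeFn_mulOp (memLp_cutoff hB) f, coeFn_mulOp (memLp_cutoff hB) g, hg] with ξ h1 h2 h3 h4
  simp only [h1, h2, h3, h4]
  unfold cutoff
  by_cases h : ξ ∈ B
  · simp only [h, Set.indicator_of_mem, Pi.one_apply, one_mul]
    rw [← Complex.real_smul, ← Complex.real_smul, inner_smul_left, inner_smul_left,
      inner_smul_right]
    simp only [RCLike.conj_to_real]
    ring
  · simp [h]

/-- The dyadic shell `2^{-j-1} < 2π|ξ| ≤ 2^{-j}`. -/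
def shell (d j : ℕ) : Set (Space d) := {ξ | (2 ^ (j + 1) : ℝ)⁻¹ < freq ξ ∧ freq ξ ≤ (2 ^ j : ℝ)⁻¹}

theorem measurableSet_shell (j : ℕ) : MeasurableSet (shell d j) :=
  (measurableSet_lt measurable_const measurable_freq).inter
    (measurableSet_le measurable_freq measurable_const)

/-- The high frequencies `2π|ξ| > 1`. -/
def highFreq (d : ℕ) : Set (Space d) := {ξ | 1 < freq ξ}

theorem univ_subset_union_shell :
    (Set.univ : Set (Space d)) ⊆ ((⋃ j, shell d j) ∪ highFreq d) ∪ {0} := by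
  intro ξ _
  by_cases h0 : ξ = 0
  · exact Or.inr h0
  refine Or.inl ?_
  by_cases h1 : 1 < freq ξ
  · exact Or.inr h1
  refine Or.inl (Set.mem_iUnion.2 ?_)
  have hp : 0 < freq ξ := by
    have := norm_pos_iff.2 h0
    unfold freq
    positivity
  obtain ⟨n, hn1, hn2⟩ := exists_nat_pow_near (x := (freq ξ)⁻¹) (y := (2 : ℝ))
    ((one_le_inv₀ hp).2 (not_lt.1 h1)) one_lt_two
  exact ⟨n, inv_lt_of_inv_lt₀ hp hn2, (le_inv_comm₀ (by positivity) hp).1 hn1⟩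

theorem enorm_sq_le_tsum_mass (hd : 1 ≤ d) (f : L2 d) :
    ‖f‖ₑ ^ 2 ≤ (∑' j, mass f (shell d j)) + mass f (highFreq d) := by
  -- The shells and the high frequencies miss the origin, which is a null set only in positive
  -- dimension.
  have : Nonempty (Fin d) := ⟨⟨0, hd⟩⟩
  have h0 : mass f {0} = 0 := withDensity_absolutelyContinuous _ _ (measure_singleton 0)
  calc ‖f‖ₑ ^ 2 = mass f Set.univ := (mass_univ f).symm
    _ ≤ mass f (((⋃ j, shell d j) ∪ highFreq d) ∪ {0}) := measure_mono univ_subset_union_shell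
    _ ≤ mass f ((⋃ j, shell d j) ∪ highFreq d) + mass f {0} := measure_union_le _ _
    _ ≤ mass f (⋃ j, shell d j) + mass f (highFreq d) := by
        rw [h0, add_zero]; exact measure_union_le _ _
    _ ≤ _ := by gcongr; exact measure_iUnion_le _

theorem exists_mass_shell_le (d : ℕ) (μ : ℝ) : ∃ C : ℝ, 0 < C ∧ ∀ V V₁ : ℝ → L2 d,
    IsFourierSolution μ V V₁ → ∀ j : ℕ, ∀ t : ℝ, 0 ≤ t → mass (V t) (shell d j) ≤
      ENNReal.ofReal (C * (1 + Real.log (1 + t)) ^ (2 * delta μ)) *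
        (ENNReal.ofReal ((min (1 + t) (2 ^ j)) ^ (1 + 2 * (nu μ).re)) *
          (mass (V 0) (shell d j) + mass (V₁ 0) (shell d j))) := by
  obtain ⟨C, hC, h⟩ := exists_mode_bound (L2 d) μ
  refine ⟨C, hC, fun V V₁ hV j t ht => ?_⟩
  have hS := measurableSet_shell (d := d) j
  have hb : (0 : ℝ) < (2 ^ j : ℝ)⁻¹ := by positivity
  have hR : ∀ ξ ∈ shell d j, freq ξ ≤ (2 ^ j : ℝ)⁻¹ := fun ξ hξ => hξ.2
  have hlo : ∀ ξ ∈ shell d j, (2 ^ j : ℝ)⁻¹ / 2 ≤ freq ξ := fun ξ hξ => by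
    have := hξ.1.le
    rwa [pow_succ, mul_inv] at this
  have hb1 : (2 ^ j : ℝ)⁻¹ ≤ 1 := inv_le_one_of_one_le₀ (one_le_pow₀ one_le_two)
  have key := h _ _ _ (hV.isModeSolution hS hR) _ hb hb1
    (norm_mulOp_le (memLp_cutoff_freq_sq hS hR) (norm_cutoff_freq_sq_le hR))
    (fun t _ => inner_mulOp_freq_sq_ge hS (by positivity) hR hlo (V t)) t ht
  rw [inv_inv] at key
  have hl : 0 ≤ Real.log (1 + t) := Real.log_nonneg (by linarith)
  rw [← enorm_mulOp_cutoff_sq _ hS, ← enorm_mulOp_cutoff_sq _ hS, ← enorm_mulOp_cutoff_sq _ hS,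
    ← ofReal_norm_sq, ← ofReal_norm_sq, ← ofReal_norm_sq,
    ← ENNReal.ofReal_add (by positivity) (by positivity), ← ENNReal.ofReal_mul (by positivity),
    ← ENNReal.ofReal_mul (by positivity)]
  exact ENNReal.ofReal_le_ofReal (key.trans (le_of_eq (by ring)))

/-- Above frequency 1 the energy dominates ‖V‖² and grows by at most exp|μ| from time 0. The set is
exhausted by bounded pieces to keep M bounded; the estimate is uniform because the initial potential
energy of each piece is at most ‖g‖². -/
theorem mass_highFreq_le {μ : ℝ} {V V₁ : ℝ → L2 d} (h : IsFourierSolution μ V V₁) {g : L2 d}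
    (hg : g =ᵐ[volume] fun ξ => (freq ξ : ℂ) * V 0 ξ) {t : ℝ} (ht : 0 ≤ t) :
    mass (V t) (highFreq d) ≤ ENNReal.ofReal (Real.exp |μ|) * (‖V₁ 0‖ₑ ^ 2 + ‖g‖ₑ ^ 2) := by
  have hU : highFreq d = ⋃ n : ℕ, {ξ : Space d | 1 < freq ξ ∧ freq ξ ≤ n} := by
    ext ξ
    simp only [Set.mem_iUnion, Set.mem_ofPred_eq, highFreq, exists_and_left, iff_self_and]
    exact fun _ => exists_nat_ge _
  have hmono : Monotone fun n : ℕ => {ξ : Space d | 1 < freq ξ ∧ freq ξ ≤ n} := by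
    intro m n hmn ξ hξ
    exact ⟨hξ.1, hξ.2.trans (by exact_mod_cast hmn)⟩
  rw [hU, hmono.measure_iUnion]
  refine iSup_le fun n => ?_
  set B := {ξ : Space d | 1 < freq ξ ∧ freq ξ ≤ n}
  have hB : MeasurableSet B := (measurableSet_lt measurable_const measurable_freq).inter
    (measurableSet_le measurable_freq measurable_const)
  have hR : ∀ ξ ∈ B, freq ξ ≤ n := fun ξ hξ => hξ.2
  have hlow := fun t => inner_mulOp_freq_sq_ge hB zero_le_one hR (fun ξ hξ => hξ.1.le) (V t)
  have key := (h.isModeSolution hB hR).energy_le one_pos (fun t _ => hlow t) le_rfl ht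
  simp only [ContinuousLinearMap.coe_restrictScalars'] at key
  rw [inner_mulOp_freq_sq_eq hB hR _ _ hg] at key
  have h1 : ‖mulOp (cutoff B) (V t)‖ ^ 2 ≤
      Real.exp |μ| * (‖mulOp (cutoff B) (V₁ 0)‖ ^ 2 + ‖mulOp (cutoff B) g‖ ^ 2) := by
    have h2 := hlow t
    rw [one_pow, one_mul] at h2
    rw [add_zero, mul_one, div_one] at key
    exact h2.trans ((le_add_of_nonneg_left (sq_nonneg _)).trans key)
  rw [← enorm_mulOp_cutoff_sq _ hB, ← ofReal_norm_sq]
  refine (ENNReal.ofReal_le_ofReal h1).trans ?_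
  rw [ENNReal.ofReal_mul (by positivity), ENNReal.ofReal_add (by positivity) (by positivity),
    ofReal_norm_sq, ofReal_norm_sq, enorm_mulOp_cutoff_sq _ hB, enorm_mulOp_cutoff_sq _ hB]
  gcongr <;> exact mass_le _ _

end Mass

/-! The Fourier transform of `L¹` functions -/

section FourierLOne

open FourierTransform

variable {d : ℕ}

/-- For an integrable L² function, the Plancherel transform coincides almost everywhere with the
Fourier integral: both give the same result against smooth compactly supported functions, by moving
the transform to the test function. -/
theorem enorm_fourier_le (g : L2 d) (hg : Integrable g) :
    ∀ᵐ ξ, ‖(𝓕 g : L2 d) ξ‖ₑ ≤ ∫⁻ x, ‖g x‖ₑ := by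
  set F : Space d → ℂ := VectorFourier.fourierIntegral Real.fourierChar volume
    (innerₗ (Space d)) g with hF
  have hcont : Continuous F := VectorFourier.fourierIntegral_continuous
    Real.continuous_fourierChar continuous_inner hg
  have hae : ∀ᵐ ξ, (𝓕 g : L2 d) ξ = F ξ := by
    refine ae_eq_of_integral_contDiff_smul_eq
      ((Lp.memLp (𝓕 g : L2 d)).locallyIntegrable (by norm_num)) hcont.locallyIntegrable ?_
    intro u hu hc
    have hc₁ : HasCompactSupport (Complex.ofRealCLM ∘ u) := hc.comp_left rfl
    have hu₁ : ContDiff ℝ ∞ (Complex.ofRealCLM ∘ u) := by fun_prop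
    set w : 𝓢(Space d, ℂ) := hc₁.toSchwartzMap hu₁ with hw
    have hwu : ∀ x, w x = (u x : ℂ) := fun x => rfl
    have h1 : toDistr (𝓕 g : L2 d) w = toDistr g (𝓕 w) := by
      rw [toDistr, ← Lp.fourier_toTemperedDistribution_eq, TemperedDistribution.fourier_apply]
    rw [toDistr, toDistr, Lp.toTemperedDistribution_apply, Lp.toTemperedDistribution_apply] at h1
    have h2 := VectorFourier.integral_fourierIntegral_smul_eq_flip (L := innerₗ (Space d))
      Real.continuous_fourierChar continuous_inner w.integrable hg (μ := volume) (ν := volume)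
    have h3 : (innerₗ (Space d)).flip = innerₗ (Space d) := by
      ext x y
      simp
    rw [h3] at h2
    calc ∫ x, u x • (𝓕 g : L2 d) x = ∫ x, w x • (𝓕 g : L2 d) x := by simp [hwu]
      _ = ∫ x, (𝓕 w) x • g x := h1
      _ = ∫ x, w x • F x := h2
      _ = _ := by simp [hwu]
  filter_upwards [hae] with ξ hξ
  rw [hξ, ← ofReal_norm, ← ofReal_integral_norm_eq_lintegral_enorm hg]
  exact ENNReal.ofReal_le_ofReal (VectorFourier.norm_fourierIntegral_le_integral_norm _ _ _ _ _)

/-- The sup bound on the transform is integrated over a shell lying in the ball of radius 2^{-j}. -/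
theorem mass_fourier_shell_le (d : ℕ) : ∃ c : ℝ, 0 < c ∧ ∀ g : L2 d, ∀ j : ℕ,
    mass (𝓕 g) (shell d j) ≤ ENNReal.ofReal (c * ((2 ^ j : ℝ)⁻¹) ^ d) * (∫⁻ x, ‖g x‖ₑ) ^ 2 := by
  set c := volume (Metric.closedBall (0 : Space d) 1) with hc
  have hc0 : c ≠ 0 := (Metric.measure_closedBall_pos volume 0 one_pos).ne'
  have hct : c ≠ ⊤ := measure_closedBall_lt_top.ne
  refine ⟨c.toReal, ENNReal.toReal_pos hc0 hct, fun g j => ?_⟩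
  have hb : (0 : ℝ) < (2 ^ j : ℝ)⁻¹ := by positivity
  have hpos : ENNReal.ofReal (c.toReal * ((2 ^ j : ℝ)⁻¹) ^ d) ≠ 0 := by
    rw [ne_eq, ENNReal.ofReal_eq_zero, not_le]
    exact mul_pos (ENNReal.toReal_pos hc0 hct) (by positivity)
  by_cases htop : (∫⁻ x, ‖g x‖ₑ) = ⊤
  · rw [htop, ENNReal.top_pow two_ne_zero, ENNReal.mul_top hpos]
    exact le_top
  have hg : Integrable g := ⟨Lp.aestronglyMeasurable g, lt_top_iff_ne_top.2 htop⟩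
  have hsub : shell d j ⊆ Metric.closedBall 0 (2 ^ j : ℝ)⁻¹ := by
    intro ξ hξ
    rw [mem_closedBall_zero_iff]
    refine le_trans ?_ hξ.2
    unfold freq
    nlinarith [Real.pi_gt_three, norm_nonneg ξ]
  have hvol : volume (shell d j) ≤ ENNReal.ofReal (c.toReal * ((2 ^ j : ℝ)⁻¹) ^ d) := by
    refine (measure_mono hsub).trans (le_of_eq ?_)
    rw [Measure.addHaar_closedBall' _ _ hb.le, finrank_euclideanSpace_fin, mul_comm c.toReal,
      ENNReal.ofReal_mul (by positivity), ENNReal.ofReal_toReal hct]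
  calc mass (𝓕 g) (shell d j) = ∫⁻ ξ in shell d j, ‖(𝓕 g : L2 d) ξ‖ₑ ^ 2 := by
        rw [mass, withDensity_apply _ (measurableSet_shell j)]
    _ ≤ ∫⁻ ξ in shell d j, (∫⁻ x, ‖g x‖ₑ) ^ 2 := by
        apply lintegral_mono_ae
        filter_upwards [ae_restrict_of_ae (enorm_fourier_le g hg)] with ξ hξ
        gcongr
    _ = (∫⁻ x, ‖g x‖ₑ) ^ 2 * volume (shell d j) := setLIntegral_const _ _
    _ ≤ _ := by rw [mul_comm]; gcongr

theorem mass_fourier_le (g : L2 d) (B : Set (Space d)) :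
    mass (𝓕 g) B ≤ ∫⁻ x, ‖g x‖ₑ ^ 2 := by
  rw [← enorm_sq_eq_lintegral]
  refine (mass_le _ _).trans (le_of_eq ?_)
  rw [← ofReal_norm_sq, Lp.norm_fourier_eq, ofReal_norm_sq]

end FourierLOne

/-! Sums over dyadic numbers -/

section Dyadic

theorem dyadic_rpow (a : ℝ) (j : ℕ) : ((2 : ℝ) ^ j) ^ a = ((2 : ℝ) ^ a) ^ j := by
  rw [← Real.rpow_natCast, ← Real.rpow_mul (by norm_num), mul_comm, Real.rpow_mul (by norm_num),
    Real.rpow_natCast]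

/-- A growing geometric series is comparable to its last term; in the companion bound
`exists_tsum_dyadic_gt`, a decaying one to its first. -/
theorem exists_tsum_dyadic_le {κ : ℝ} (hκ : 0 < κ) : ∃ C : ℝ, 0 < C ∧ ∀ y : ℝ, 0 < y →
    ∑' j : ℕ, (if (2 : ℝ) ^ j ≤ y then ENNReal.ofReal (((2 : ℝ) ^ j) ^ κ) else 0) ≤
      ENNReal.ofReal (C * y ^ κ) := by
  set x : ℝ := 2 ^ κ with hx
  have hx1 : 1 < x := Real.one_lt_rpow one_lt_two hκ
  have hC : 0 < x / (x - 1) := div_pos (by linarith) (by linarith)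
  refine ⟨x / (x - 1), hC, fun y hy => ?_⟩
  by_cases hy1 : 1 ≤ y
  · obtain ⟨n, hn1, hn2⟩ := exists_nat_pow_near hy1 (one_lt_two (α := ℝ))
    have hz : ∀ j ∉ Finset.range (n + 1),
        (if (2 : ℝ) ^ j ≤ y then ENNReal.ofReal (((2 : ℝ) ^ j) ^ κ) else 0) = 0 := by
      intro j hj
      rw [Finset.mem_range, not_lt] at hj
      exact if_neg (not_le.2 (hn2.trans_le (pow_le_pow_right₀ one_le_two hj)))
    rw [tsum_eq_sum hz]
    calc _ ≤ ∑ j ∈ Finset.range (n + 1), ENNReal.ofReal (x ^ j) := by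
          refine Finset.sum_le_sum fun j _ => ?_
          split_ifs
          · rw [dyadic_rpow]
          · exact zero_le
      _ = ENNReal.ofReal (∑ j ∈ Finset.range (n + 1), x ^ j) :=
          (ENNReal.ofReal_sum_of_nonneg fun j _ => by positivity).symm
      _ ≤ _ := by
          refine ENNReal.ofReal_le_ofReal ?_
          rw [geom_sum_eq hx1.ne']
          have h1 : x ^ n ≤ y ^ κ := by
            rw [hx, ← dyadic_rpow]
            gcongr
          rw [div_mul_eq_mul_div, div_le_div_iff_of_pos_right (by linarith), pow_succ]
          nlinarith
  · have hz : ∀ j : ℕ, (if (2 : ℝ) ^ j ≤ y then ENNReal.ofReal (((2 : ℝ) ^ j) ^ κ) else 0) = 0 := by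
      intro j
      exact if_neg (not_le.2 ((not_le.1 hy1).trans_le (one_le_pow₀ one_le_two)))
    simp [hz]

theorem exists_tsum_dyadic_gt {κ : ℝ} (hκ : 0 < κ) : ∃ C : ℝ, 0 < C ∧ ∀ y : ℝ, 0 < y →
    ∑' j : ℕ, (if y < (2 : ℝ) ^ j then ENNReal.ofReal (((2 : ℝ) ^ j) ^ (-κ)) else 0) ≤
      ENNReal.ofReal (C * y ^ (-κ)) := by
  set x : ℝ := 2 ^ (-κ) with hx
  have hx0 : 0 < x := by positivity
  have hx1 : x < 1 := Real.rpow_lt_one_of_one_lt_of_neg one_lt_two (by linarith)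
  refine ⟨(1 - x)⁻¹, inv_pos.2 (by linarith), fun y hy => ?_⟩
  have hex : ∃ j : ℕ, y < (2 : ℝ) ^ j := pow_unbounded_of_one_lt y one_lt_two
  classical
  set n := Nat.find hex with hn
  have hlt : ∀ j < n, ¬ y < (2 : ℝ) ^ j := fun j hj => Nat.find_min hex hj
  have hny : x ^ n ≤ y ^ (-κ) := by
    rw [hx, ← dyadic_rpow]
    exact Real.rpow_le_rpow_of_nonpos hy (Nat.find_spec hex).le (by linarith)
  rw [← ENNReal.summable.sum_add_tsum_nat_add' (k := n),
    Finset.sum_eq_zero fun j hj => if_neg (hlt j (Finset.mem_range.1 hj)), zero_add]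
  calc _ ≤ ∑' i : ℕ, ENNReal.ofReal (x ^ n) * ENNReal.ofReal x ^ i := by
        refine ENNReal.tsum_le_tsum fun i => ?_
        split_ifs
        · rw [dyadic_rpow, pow_add, ENNReal.ofReal_mul (by positivity), mul_comm,
            ENNReal.ofReal_pow hx0.le i]
        · exact zero_le
    _ = ENNReal.ofReal ((1 - x)⁻¹ * x ^ n) := by
        rw [ENNReal.tsum_mul_left, ENNReal.tsum_geometric, mul_comm (1 - x)⁻¹,
          ENNReal.ofReal_mul (by positivity), ENNReal.ofReal_inv_of_pos (by linarith),
          ENNReal.ofReal_sub _ hx0.le, ENNReal.ofReal_one]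
    _ ≤ _ := by
        refine ENNReal.ofReal_le_ofReal ?_
        have : 0 < 1 - x := by linarith
        gcongr

theorem tsum_sq_le_sq_tsum (a : ℕ → ℝ≥0∞) : ∑' j, a j ^ 2 ≤ (∑' j, a j) ^ 2 := by
  rw [sq, ← ENNReal.tsum_mul_right]
  refine ENNReal.tsum_le_tsum fun j => ?_
  rw [sq]
  gcongr
  exact ENNReal.le_tsum j

theorem exists_tsum_dyadic_count : ∃ C : ℝ, 0 < C ∧ ∀ y : ℝ, 1 ≤ y →
    ∑' j : ℕ, (if (2 : ℝ) ^ j ≤ y then (1 : ℝ≥0∞) else 0) ≤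
      ENNReal.ofReal (C * (1 + Real.log y)) := by
  have hl2 : 0 < Real.log 2 := Real.log_pos one_lt_two
  refine ⟨1 + (Real.log 2)⁻¹, by positivity, fun y hy => ?_⟩
  obtain ⟨n, hn1, hn2⟩ := exists_nat_pow_near hy (one_lt_two (α := ℝ))
  have hz : ∀ j ∉ Finset.range (n + 1), (if (2 : ℝ) ^ j ≤ y then (1 : ℝ≥0∞) else 0) = 0 := by
    intro j hj
    rw [Finset.mem_range, not_lt] at hj
    exact if_neg (not_le.2 (hn2.trans_le (pow_le_pow_right₀ one_le_two hj)))
  rw [tsum_eq_sum hz]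
  calc _ ≤ ∑ j ∈ Finset.range (n + 1), (1 : ℝ≥0∞) := by
        refine Finset.sum_le_sum fun j _ => ?_
        split_ifs <;> simp
    _ = ENNReal.ofReal (n + 1) := by
        rw [Finset.sum_const, Finset.card_range, nsmul_eq_mul, mul_one]
        rw [show (n + 1 : ℝ) = ((n + 1 : ℕ) : ℝ) by push_cast; ring, ENNReal.ofReal_natCast]
    _ ≤ _ := by
        refine ENNReal.ofReal_le_ofReal ?_
        have h1 : n * Real.log 2 ≤ Real.log y := by
          rw [← Real.log_pow]
          exact Real.log_le_log (by positivity) hn1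
        have h2 : (n : ℝ) ≤ (Real.log 2)⁻¹ * Real.log y := by
          rw [inv_mul_eq_div, le_div_iff₀ hl2]
          exact h1
        have h3 : 0 ≤ Real.log y := Real.log_nonneg hy
        have h4 : 0 < (Real.log 2)⁻¹ := by positivity
        nlinarith

end Dyadic

/-! The Hardy-Littlewood-Sobolev inequality `‖|∇|^{-γ} f‖_{L²} ≲ ‖f‖_{L^r}` for low frequencies,
where `γ = d (1/r - 1/2)` -/

section HLS

open FourierTransform

variable {d : ℕ}

/-- For z ≠ 0 the threshold condition means 2^j > y with y = |z|^{-r/D}. The geometric sum is of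
size y^{-D(1-1/r)} = |z|^{r-1}, and the factor |z| completes the power. Convergence needs r > 1. -/
theorem exists_tsum_above_threshold {D r : ℝ} (hD : 0 < D) (hr : 1 < r) :
    ∃ C : ℝ, 0 < C ∧ ∀ z : ℂ, ∑' j : ℕ,
      (if ((2 : ℝ) ^ j) ^ (-(D / r)) < ‖z‖ then
        ENNReal.ofReal (((2 : ℝ) ^ j) ^ (-(D * (1 - 1 / r)))) * ‖z‖ₑ else 0) ≤
      ENNReal.ofReal C * ‖z‖ₑ ^ r := by
  have hr0 : 0 < r := by linarith
  have hθ : 0 < D * (1 - 1 / r) := by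
    have : 1 / r < 1 := (div_lt_one hr0).2 hr
    exact mul_pos hD (by linarith)
  obtain ⟨C, hC, h⟩ := exists_tsum_dyadic_gt hθ
  refine ⟨C, hC, fun z => ?_⟩
  rcases eq_or_ne z 0 with rfl | hz
  · simp
  have hx : 0 < ‖z‖ := norm_pos_iff.2 hz
  set y := ‖z‖ ^ (-(r / D)) with hy
  have hy0 : 0 < y := by positivity
  have hxy : ‖z‖ = y ^ (-(D / r)) := by
    rw [hy, ← Real.rpow_mul hx.le, show -(r / D) * -(D / r) = 1 by field_simp, Real.rpow_one]
  have hiff : ∀ j : ℕ, ((2 : ℝ) ^ j) ^ (-(D / r)) < ‖z‖ ↔ y < (2 : ℝ) ^ j := by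
    intro j
    rw [hxy]
    exact Real.rpow_lt_rpow_iff_of_neg (by positivity) hy0 (neg_neg_of_pos (by positivity))
  have e : ∀ j : ℕ, (if ((2 : ℝ) ^ j) ^ (-(D / r)) < ‖z‖ then
        ENNReal.ofReal (((2 : ℝ) ^ j) ^ (-(D * (1 - 1 / r)))) * ‖z‖ₑ else 0) =
      (if y < (2 : ℝ) ^ j then ENNReal.ofReal (((2 : ℝ) ^ j) ^ (-(D * (1 - 1 / r)))) else 0) *
        ‖z‖ₑ := by
    intro j
    simp only [hiff j, ite_mul, zero_mul]
  simp only [e]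
  rw [ENNReal.tsum_mul_right]
  refine (mul_le_mul_left (h y hy0) _).trans (le_of_eq ?_)
  rw [← ofReal_norm, ENNReal.ofReal_rpow_of_nonneg hx.le hr0.le,
    ← ENNReal.ofReal_mul (by positivity), ← ENNReal.ofReal_mul hC.le, mul_assoc]
  congr 2
  rw [hy, ← Real.rpow_mul hx.le, ← Real.rpow_add_one hx.ne']
  congr 1
  field_simp
  ring

/-- With the same y, the sum over 2^j ≤ y is of size y^{D(2-r)/r} = |z|^{r-2}, and the factor |z|²
completes the power. This requires r < 2. -/
theorem exists_tsum_below_threshold {D r : ℝ} (hD : 0 < D) (hr : 0 < r) (hr₂ : r < 2) :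
    ∃ C : ℝ, 0 < C ∧ ∀ z : ℂ, ∑' j : ℕ,
      (if ¬ ((2 : ℝ) ^ j) ^ (-(D / r)) < ‖z‖ then
        ENNReal.ofReal (((2 : ℝ) ^ j) ^ (D * (2 - r) / r)) * ‖z‖ₑ ^ 2 else 0) ≤
      ENNReal.ofReal C * ‖z‖ₑ ^ r := by
  have hθ : 0 < D * (2 - r) / r := div_pos (mul_pos hD (by linarith)) hr
  obtain ⟨C, hC, h⟩ := exists_tsum_dyadic_le hθ
  refine ⟨C, hC, fun z => ?_⟩
  rcases eq_or_ne z 0 with rfl | hz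
  · simp
  have hx : 0 < ‖z‖ := norm_pos_iff.2 hz
  set y := ‖z‖ ^ (-(r / D)) with hy
  have hy0 : 0 < y := by positivity
  have hxy : ‖z‖ = y ^ (-(D / r)) := by
    rw [hy, ← Real.rpow_mul hx.le, show -(r / D) * -(D / r) = 1 by field_simp, Real.rpow_one]
  have hiff : ∀ j : ℕ, ((2 : ℝ) ^ j) ^ (-(D / r)) < ‖z‖ ↔ y < (2 : ℝ) ^ j := by
    intro j
    rw [hxy]
    exact Real.rpow_lt_rpow_iff_of_neg (by positivity) hy0 (neg_neg_of_pos (by positivity))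
  have e : ∀ j : ℕ, (if ¬ ((2 : ℝ) ^ j) ^ (-(D / r)) < ‖z‖ then
        ENNReal.ofReal (((2 : ℝ) ^ j) ^ (D * (2 - r) / r)) * ‖z‖ₑ ^ 2 else 0) =
      (if (2 : ℝ) ^ j ≤ y then ENNReal.ofReal (((2 : ℝ) ^ j) ^ (D * (2 - r) / r)) else 0) *
        ‖z‖ₑ ^ 2 := by
    intro j
    simp only [hiff j, not_lt, ite_mul, zero_mul]
  simp only [e]
  rw [ENNReal.tsum_mul_right]
  refine (mul_le_mul_left (h y hy0) _).trans (le_of_eq ?_)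
  rw [← ofReal_norm, ENNReal.ofReal_rpow_of_nonneg hx.le hr.le, ← ENNReal.ofReal_pow hx.le,
    ← ENNReal.ofReal_mul (by positivity), ← ENNReal.ofReal_mul hC.le, mul_assoc]
  congr 2
  rw [hy, ← Real.rpow_mul hx.le, ← Real.rpow_natCast ‖z‖ 2, ← Real.rpow_add hx]
  congr 1
  field_simp
  push_cast
  ring

/-- The set where `|f|` exceeds the height `l`. -/
def abovePart (f : L2 d) (l : ℝ) : Set (Space d) := {x | l < ‖f x‖}

theorem measurableSet_abovePart (f : L2 d) (l : ℝ) : MeasurableSet (abovePart f l) :=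
  measurableSet_lt measurable_const (Lp.stronglyMeasurable f).measurable.norm

theorem lintegral_enorm_mulOp_cutoff (f : L2 d) {S : Set (Space d)} (hS : MeasurableSet S) :
    ∫⁻ x, ‖mulOp (cutoff S) f x‖ₑ = ∫⁻ x in S, ‖f x‖ₑ := by
  rw [← lintegral_indicator hS]
  apply lintegral_congr_ae
  filter_upwards [coeFn_mulOp (memLp_cutoff hS) f] with ξ hξ
  rw [hξ, cutoff]
  by_cases h : ξ ∈ S <;> simp [h]

theorem mulOp_cutoff_add_compl (f : L2 d) {S : Set (Space d)} (hS : MeasurableSet S) :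
    mulOp (cutoff S) f + mulOp (cutoff Sᶜ) f = f := by
  apply Lp.ext
  filter_upwards [coeFn_mulOp (memLp_cutoff hS) f, coeFn_mulOp (memLp_cutoff hS.compl) f,
    Lp.coeFn_add (mulOp (cutoff S) f) (mulOp (cutoff Sᶜ) f)] with ξ h1 h2 h3
  rw [h3, Pi.add_apply, h1, h2, cutoff, cutoff]
  by_cases h : ξ ∈ S <;> simp [h]

theorem mass_fourier_shell_le_split {c : ℝ} {j : ℕ} (hc : ∀ g : L2 d, mass (𝓕 g) (shell d j) ≤
      ENNReal.ofReal (c * ((2 ^ j : ℝ)⁻¹) ^ d) * (∫⁻ x, ‖g x‖ₑ) ^ 2)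
    (f : L2 d) {S : Set (Space d)} (hS : MeasurableSet S) :
    mass (𝓕 f) (shell d j) ≤ 2 * (ENNReal.ofReal (c * ((2 ^ j : ℝ)⁻¹) ^ d) *
      (∫⁻ x in S, ‖f x‖ₑ) ^ 2 + ∫⁻ x in Sᶜ, ‖f x‖ₑ ^ 2) := by
  have e : (𝓕 f : L2 d) = 𝓕 (mulOp (cutoff S) f) + 𝓕 (mulOp (cutoff Sᶜ) f) := by
    rw [← FourierTransform.fourier_add, mulOp_cutoff_add_compl f hS]
  rw [e]
  refine (mass_add_le _ _ (measurableSet_shell j)).trans ?_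
  gcongr
  · rw [← lintegral_enorm_mulOp_cutoff f hS]
    exact hc _
  · refine (mass_fourier_le _ _).trans (le_of_eq ?_)
    rw [← enorm_sq_eq_lintegral, enorm_mulOp_cutoff_sq _ hS.compl, mass,
      withDensity_apply _ hS.compl]

/-- Real interpolation: for the shell j, f is split at height 2^{-jd/r}. The part above is measured
in L¹ and uses the small volume of the shell; the part below is measured in L² by Plancherel.
Exchanging sum and integral reduces both to the pointwise threshold sums. -/
theorem exists_tsum_mass_le_of_le_one (hd : 1 ≤ d) {r : ℝ} (hr : 1 < r) (hr₂ : r < 2) :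
    ∃ C : ℝ, 0 < C ∧ ∀ f : L2 d, ∫⁻ x, ‖f x‖ₑ ^ r ≤ 1 →
      ∑' j : ℕ, ENNReal.ofReal (((2 : ℝ) ^ j) ^ (d * (2 - r) / r)) * mass (𝓕 f) (shell d j) ≤
        ENNReal.ofReal C := by
  have hD : (0 : ℝ) < d := by exact_mod_cast hd
  have hr0 : 0 < r := by linarith
  obtain ⟨C₁, hC₁, h₁⟩ := exists_tsum_above_threshold hD hr
  obtain ⟨C₂, hC₂, h₂⟩ := exists_tsum_below_threshold hD hr0 hr₂
  obtain ⟨c, hc, hmass⟩ := mass_fourier_shell_le d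
  refine ⟨2 * (c * C₁ ^ 2 + C₂), by positivity, fun f hf => ?_⟩
  set S : ℕ → Set (Space d) := fun j => abovePart f (((2 : ℝ) ^ j) ^ (-(d / r))) with hS
  have hSm : ∀ j, MeasurableSet (S j) := fun j => measurableSet_abovePart f _
  have hfm : Measurable fun x => ‖f x‖ₑ := (Lp.stronglyMeasurable f).measurable.enorm
  set A : ℕ → ℝ≥0∞ := fun j =>
    ENNReal.ofReal (((2 : ℝ) ^ j) ^ (-(d * (1 - 1 / r)))) * ∫⁻ x in S j, ‖f x‖ₑ with hA
  set B : ℕ → ℝ≥0∞ := fun j =>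
    ENNReal.ofReal (((2 : ℝ) ^ j) ^ (d * (2 - r) / r)) * ∫⁻ x in (S j)ᶜ, ‖f x‖ₑ ^ 2 with hB
  have hAs : ∑' j, A j ≤ ENNReal.ofReal C₁ := by
    calc ∑' j, A j = ∑' j, ∫⁻ x, (if ((2 : ℝ) ^ j) ^ (-(d / r)) < ‖f x‖ then
        ENNReal.ofReal (((2 : ℝ) ^ j) ^ (-(d * (1 - 1 / r)))) * ‖f x‖ₑ else 0) := by
          refine tsum_congr fun j => ?_
          rw [hA]
          simp only
          rw [← lintegral_const_mul _ hfm, ← lintegral_indicator (hSm j)]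
          rfl
      _ = ∫⁻ x, ∑' j, (if ((2 : ℝ) ^ j) ^ (-(d / r)) < ‖f x‖ then
        ENNReal.ofReal (((2 : ℝ) ^ j) ^ (-(d * (1 - 1 / r)))) * ‖f x‖ₑ else 0) := by
          rw [lintegral_tsum]
          exact fun j => (Measurable.ite (hSm j) (hfm.const_mul _) measurable_const).aemeasurable
      _ ≤ ∫⁻ x, ENNReal.ofReal C₁ * ‖f x‖ₑ ^ r := lintegral_mono fun x => h₁ (f x)
      _ = ENNReal.ofReal C₁ * ∫⁻ x, ‖f x‖ₑ ^ r := lintegral_const_mul _ (hfm.pow_const r)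
      _ ≤ ENNReal.ofReal C₁ * 1 := by gcongr
      _ = _ := mul_one _
  have hBs : ∑' j, B j ≤ ENNReal.ofReal C₂ := by
    calc ∑' j, B j = ∑' j, ∫⁻ x, (if ¬ ((2 : ℝ) ^ j) ^ (-(d / r)) < ‖f x‖ then
        ENNReal.ofReal (((2 : ℝ) ^ j) ^ (d * (2 - r) / r)) * ‖f x‖ₑ ^ 2 else 0) := by
          refine tsum_congr fun j => ?_
          rw [hB]
          simp only
          rw [← lintegral_const_mul _ (hfm.pow_const 2), ← lintegral_indicator (hSm j).compl]
          refine lintegral_congr fun x => ?_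
          by_cases hx : x ∈ (S j)ᶜ
          · exact (Set.indicator_of_mem hx _).trans (if_pos hx).symm
          · exact (Set.indicator_of_notMem hx _).trans (if_neg hx).symm
      _ = ∫⁻ x, ∑' j, (if ¬ ((2 : ℝ) ^ j) ^ (-(d / r)) < ‖f x‖ then
        ENNReal.ofReal (((2 : ℝ) ^ j) ^ (d * (2 - r) / r)) * ‖f x‖ₑ ^ 2 else 0) := by
          rw [lintegral_tsum]
          exact fun j => (Measurable.ite (hSm j).compl ((hfm.pow_const 2).const_mul _)
            measurable_const).aemeasurable
      _ ≤ ∫⁻ x, ENNReal.ofReal C₂ * ‖f x‖ₑ ^ r := lintegral_mono fun x => h₂ (f x)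
      _ = ENNReal.ofReal C₂ * ∫⁻ x, ‖f x‖ₑ ^ r := lintegral_const_mul _ (hfm.pow_const r)
      _ ≤ ENNReal.ofReal C₂ * 1 := by gcongr
      _ = _ := mul_one _
  have hterm : ∀ j : ℕ, ENNReal.ofReal (((2 : ℝ) ^ j) ^ (d * (2 - r) / r)) *
      mass (𝓕 f) (shell d j) ≤ 2 * (ENNReal.ofReal c * A j ^ 2 + B j) := by
    intro j
    -- The exponents satisfy d(2-r)/r - d = -2d(1-1/r), so the weighted L¹ contribution is exactly
    -- the square of A j.
    have h3 : ENNReal.ofReal (((2 : ℝ) ^ j) ^ (d * (2 - r) / r)) *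
        ENNReal.ofReal (c * ((2 ^ j : ℝ)⁻¹) ^ d) =
        ENNReal.ofReal c * ENNReal.ofReal (((2 : ℝ) ^ j) ^ (-(d * (1 - 1 / r)))) ^ 2 := by
      have h2j : (0 : ℝ) < 2 ^ j := by positivity
      rw [← ENNReal.ofReal_mul (by positivity), ← ENNReal.ofReal_pow (by positivity),
        ← ENNReal.ofReal_mul hc.le]
      congr 1
      rw [← Real.rpow_neg_one, ← Real.rpow_natCast (((2 : ℝ) ^ j) ^ (-1 : ℝ)) d,
        ← Real.rpow_mul h2j.le, ← Real.rpow_natCast _ 2, ← Real.rpow_mul h2j.le, mul_left_comm,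
        ← Real.rpow_add h2j]
      congr 2
      field_simp
      push_cast
      ring
    refine (mul_le_mul_right (mass_fourier_shell_le_split (fun g => hmass g j) f (hSm j)) _).trans
      (le_of_eq ?_)
    rw [mul_left_comm, mul_add, ← mul_assoc, h3, hA, hB]
    ring
  calc _ ≤ ∑' j, 2 * (ENNReal.ofReal c * A j ^ 2 + B j) := ENNReal.tsum_le_tsum hterm
    _ = 2 * (ENNReal.ofReal c * ∑' j, A j ^ 2 + ∑' j, B j) := by
        rw [ENNReal.tsum_mul_left, ENNReal.tsum_add, ENNReal.tsum_mul_left]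
    _ ≤ 2 * (ENNReal.ofReal c * ENNReal.ofReal C₁ ^ 2 + ENNReal.ofReal C₂) := by
        gcongr
        exact (tsum_sq_le_sq_tsum A).trans (by gcongr)
    _ = _ := by
        rw [← ENNReal.ofReal_pow hC₁.le, ← ENNReal.ofReal_mul hc.le,
          ← ENNReal.ofReal_add (by positivity) hC₂.le, ENNReal.ofReal_mul (by positivity),
          ENNReal.ofReal_ofNat]

/-- The bounds for the two parts scale as different powers of the integral of |f|^r, so the unit
ball is treated first and the general case follows by homogeneity. Norms 0 and infinity are set
apart because of the division. -/
theorem exists_tsum_mass_le (hd : 1 ≤ d) {r : ℝ} (hr : 1 < r) (hr₂ : r < 2) :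
    ∃ C : ℝ, 0 < C ∧ ∀ f : L2 d,
      ∑' j : ℕ, ENNReal.ofReal (((2 : ℝ) ^ j) ^ (d * (2 - r) / r)) * mass (𝓕 f) (shell d j) ≤
        ENNReal.ofReal C * eLpNorm f (ENNReal.ofReal r) volume ^ 2 := by
  obtain ⟨C, hC, h⟩ := exists_tsum_mass_le_of_le_one hd hr hr₂
  have hr0 : 0 < r := by linarith
  refine ⟨C, hC, fun f => ?_⟩
  set N := eLpNorm f (ENNReal.ofReal r) volume with hN
  have hor : ENNReal.ofReal r ≠ 0 := by simpa using hr0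
  rcases eq_or_ne N ⊤ with hNt | hNt
  · rw [hNt, ENNReal.top_pow two_ne_zero, ENNReal.mul_top (by simpa using hC)]
    exact le_top
  rcases eq_or_ne N 0 with hN0 | hN0
  · have hf : f = 0 := by
      rw [Lp.eq_zero_iff_ae_eq_zero]
      exact (eLpNorm_eq_zero_iff (Lp.aestronglyMeasurable f) hor).1 hN0
    have h0 : ∀ j, mass (𝓕 f) (shell d j) = 0 := by
      intro j
      rw [hf, ← zero_smul ℂ (0 : L2 d), FourierTransform.fourier_smul,
        mass_smul _ _ (measurableSet_shell j)]
      simp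
    simp [h0]
  set a : ℂ := Complex.ofReal (N.toReal)⁻¹ with ha
  have hNr : 0 < N.toReal := ENNReal.toReal_pos hN0 hNt
  have hae : ‖a‖ₑ = N⁻¹ := by
    rw [ha, ← ofReal_norm, Complex.norm_real, Real.norm_of_nonneg (by positivity),
      ENNReal.ofReal_inv_of_pos hNr, ENNReal.ofReal_toReal hNt]
  have hone : eLpNorm (a • f : L2 d) (ENNReal.ofReal r) volume = 1 := by
    rw [eLpNorm_congr_ae (Lp.coeFn_smul a f), eLpNorm_const_smul, hae, ← hN,
      ENNReal.inv_mul_cancel hN0 hNt]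
  have hint : ∫⁻ x, ‖(a • f : L2 d) x‖ₑ ^ r ≤ 1 := by
    rw [eLpNorm_eq_lintegral_rpow_enorm_toReal hor ENNReal.ofReal_ne_top,
      ENNReal.toReal_ofReal hr0.le] at hone
    have : (∫⁻ x, ‖(a • f : L2 d) x‖ₑ ^ r) = 1 ^ r := by
      rw [← hone, ← ENNReal.rpow_mul, one_div, inv_mul_cancel₀ hr0.ne', ENNReal.rpow_one]
    rw [this, ENNReal.one_rpow]
  have key := h (a • f) hint
  have e : ∀ j, ENNReal.ofReal (((2 : ℝ) ^ j) ^ (d * (2 - r) / r)) *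
      mass (𝓕 (a • f)) (shell d j) = (N⁻¹) ^ 2 *
      (ENNReal.ofReal (((2 : ℝ) ^ j) ^ (d * (2 - r) / r)) * mass (𝓕 f) (shell d j)) := by
    intro j
    rw [FourierTransform.fourier_smul, mass_smul _ _ (measurableSet_shell j), hae]
    ring
  simp only [e] at key
  rw [ENNReal.tsum_mul_left] at key
  rw [← ENNReal.inv_pow, mul_comm, ← div_eq_mul_inv] at key
  exact (ENNReal.div_le_iff (pow_ne_zero 2 hN0) (ENNReal.pow_ne_top hNt)).1 key

end HLS

/-! Growth of the `L²` norm -/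

section Growth

open FourierTransform

variable {d : ℕ}

theorem exists_tsum_min_of_lt {g D : ℝ} (hg : 0 ≤ g) (h : g < D) : ∃ C : ℝ, 0 < C ∧
    ∀ y : ℝ, 1 ≤ y → ∑' j : ℕ, ENNReal.ofReal ((min y (2 ^ j)) ^ g * ((2 : ℝ) ^ j) ^ (-D)) ≤
      ENNReal.ofReal C := by
  obtain ⟨C, hC, hs⟩ := exists_tsum_dyadic_gt (sub_pos.2 h)
  -- All dyadic numbers 2^j exceed 1/2, so the tail sum from 1/2 is the full series.
  refine ⟨C * (1 / 2) ^ (-(D - g)), by positivity, fun y hy => ?_⟩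
  refine (ENNReal.tsum_le_tsum fun j => ?_).trans (hs (1 / 2) (by norm_num))
  have h1 : (1 : ℝ) ≤ 2 ^ j := one_le_pow₀ one_le_two
  rw [if_pos (by linarith)]
  refine ENNReal.ofReal_le_ofReal ?_
  rw [show -(D - g) = g + -D by ring, Real.rpow_add (by positivity)]
  gcongr
  exact min_le_right _ _

/-- The minimum changes branch at x = y: below it the terms behave as x^{g-D}, above it as y^g
x^{-D}. The first range dominates, balances or is negligible according to the sign of g - D. -/
theorem ofReal_min_rpow_le {y x g D : ℝ} (hy : 0 < y) (hx : 0 < x) :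
    ENNReal.ofReal ((min y x) ^ g * x ^ (-D)) ≤
      (if x ≤ y then ENNReal.ofReal (x ^ (g - D)) else 0) +
        ENNReal.ofReal (y ^ g) * (if y < x then ENNReal.ofReal (x ^ (-D)) else 0) := by
  rcases le_or_gt x y with h | h
  · rw [if_pos h, if_neg (not_lt.2 h), min_eq_right h, ← Real.rpow_add hx, ← sub_eq_add_neg]
    simp
  · rw [if_neg (not_le.2 h), if_pos h, min_eq_left h.le, ← ENNReal.ofReal_mul (by positivity),
      zero_add]

theorem exists_tsum_min_of_gt {g D : ℝ} (hD : 0 < D) (h : D < g) : ∃ C : ℝ, 0 < C ∧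
    ∀ y : ℝ, 1 ≤ y → ∑' j : ℕ, ENNReal.ofReal ((min y (2 ^ j)) ^ g * ((2 : ℝ) ^ j) ^ (-D)) ≤
      ENNReal.ofReal (C * y ^ (g - D)) := by
  obtain ⟨C₁, hC₁, h₁⟩ := exists_tsum_dyadic_le (sub_pos.2 h)
  obtain ⟨C₂, hC₂, h₂⟩ := exists_tsum_dyadic_gt hD
  refine ⟨C₁ + C₂, by positivity, fun y hy => ?_⟩
  have hy0 : 0 < y := by linarith
  calc _ ≤ ∑' j : ℕ, ((if (2 : ℝ) ^ j ≤ y then ENNReal.ofReal (((2 : ℝ) ^ j) ^ (g - D)) else 0) +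
        ENNReal.ofReal (y ^ g) *
          (if y < (2 : ℝ) ^ j then ENNReal.ofReal (((2 : ℝ) ^ j) ^ (-D)) else 0)) :=
        ENNReal.tsum_le_tsum fun j => ofReal_min_rpow_le hy0 (by positivity)
    _ ≤ ENNReal.ofReal (C₁ * y ^ (g - D)) +
          ENNReal.ofReal (y ^ g) * ENNReal.ofReal (C₂ * y ^ (-D)) := by
        rw [ENNReal.tsum_add, ENNReal.tsum_mul_left]
        gcongr
        · exact h₁ y hy0
        · exact h₂ y hy0
    _ = _ := by
        rw [← ENNReal.ofReal_mul (by positivity), ← ENNReal.ofReal_add (by positivity)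
          (by positivity), sub_eq_add_neg g D, Real.rpow_add hy0]
        congr 1
        ring

theorem exists_tsum_min_of_eq {g : ℝ} (hg : 0 < g) : ∃ C : ℝ, 0 < C ∧
    ∀ y : ℝ, 1 ≤ y → ∑' j : ℕ, ENNReal.ofReal ((min y (2 ^ j)) ^ g * ((2 : ℝ) ^ j) ^ (-g)) ≤
      ENNReal.ofReal (C * (1 + Real.log y)) := by
  obtain ⟨C₁, hC₁, h₁⟩ := exists_tsum_dyadic_count
  obtain ⟨C₂, hC₂, h₂⟩ := exists_tsum_dyadic_gt hg
  refine ⟨C₁ + C₂, by positivity, fun y hy => ?_⟩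
  have hy0 : 0 < y := by linarith
  have hl : 0 ≤ Real.log y := Real.log_nonneg hy
  calc _ ≤ ∑' j : ℕ, ((if (2 : ℝ) ^ j ≤ y then (1 : ℝ≥0∞) else 0) +
        ENNReal.ofReal (y ^ g) *
          (if y < (2 : ℝ) ^ j then ENNReal.ofReal (((2 : ℝ) ^ j) ^ (-g)) else 0)) := by
        refine ENNReal.tsum_le_tsum fun j =>
          (ofReal_min_rpow_le hy0 (by positivity)).trans (le_of_eq ?_)
        simp
    _ ≤ ENNReal.ofReal (C₁ * (1 + Real.log y)) +
          ENNReal.ofReal (y ^ g) * ENNReal.ofReal (C₂ * y ^ (-g)) := by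
        rw [ENNReal.tsum_add, ENNReal.tsum_mul_left]
        gcongr
        · exact h₁ y hy
        · exact h₂ y hy0
    _ ≤ _ := by
        rw [← ENNReal.ofReal_mul (by positivity), ← ENNReal.ofReal_add (by positivity)
          (by positivity), mul_left_comm, ← Real.rpow_add hy0, add_neg_cancel, Real.rpow_zero]
        refine ENNReal.ofReal_le_ofReal ?_
        nlinarith

theorem two_mul_alpha (d : ℕ) (r μ : ℝ) :
    2 * alpha d r μ = 1 + 2 * (nu μ).re - d * (2 - r) / r := by
  rw [alpha, mul_comm 2 r, ← div_div]
  ring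

/-- Either the weight x^G alone suffices, or the exponent g is divided exactly, with 2a powers
bounded by y and G powers by x. -/
theorem min_rpow_le {y x g G a : ℝ} (hy : 1 ≤ y) (hx : 1 ≤ x) (hG : 0 ≤ G) (hg : 0 ≤ g)
    (ha : 0 ≤ a) (h : g ≤ 2 * a + G) (h' : a = 0 ∨ g = 2 * a + G) :
    (min y x) ^ g ≤ (y ^ a) ^ 2 * x ^ G := by
  have hm : 0 < min y x := lt_min (by linarith) (by linarith)
  rcases h' with rfl | rfl
  · rw [Real.rpow_zero, one_pow, one_mul]
    calc (min y x) ^ g ≤ x ^ g := by gcongr; exact min_le_right _ _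
      _ ≤ x ^ G := Real.rpow_le_rpow_of_exponent_le hx (by linarith)
  · rw [Real.rpow_add hm, ← Real.rpow_natCast (y ^ a) 2, ← Real.rpow_mul (by linarith), mul_comm a]
    push_cast
    gcongr
    · exact min_le_left _ _
    · exact min_le_right _ _

/-- The dyadic estimate behind the growth of the `L²` norm, with the exponents of `rate`. -/
theorem exists_rate_exponents (hd : 1 ≤ d) {r : ℝ} (hr₁ : 1 ≤ r) (hr₂ : r < 2) {μ : ℝ}
    (hα : alpha d r μ < 1) : ∃ a κ C : ℝ, 0 ≤ a ∧ a < 1 ∧ 0 ≤ κ ∧ 0 < C ∧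
      (∀ t, 0 ≤ t → rate d r μ t =
        (1 + t) ^ (a - 1) * (1 + Real.log (1 + t)) ^ (κ + delta μ)) ∧
      ∀ f : L2 d, ∀ t, 0 ≤ t →
        ∑' j : ℕ, ENNReal.ofReal ((min (1 + t) (2 ^ j)) ^ (1 + 2 * (nu μ).re)) *
          mass (𝓕 f) (shell d j) ≤
        ENNReal.ofReal (C * ((1 + t) ^ a * (1 + Real.log (1 + t)) ^ κ) ^ 2) *
          eLpNorm f (ENNReal.ofReal r) volume ^ 2 := by
  have hD : (0 : ℝ) < d := by exact_mod_cast hd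
  have hν := nu_re_nonneg μ
  have h2α := two_mul_alpha d r μ
  set g := 1 + 2 * (nu μ).re with hg
  have hg1 : 1 ≤ g := by linarith
  rcases eq_or_lt_of_le hr₁ with rfl | hr
  · obtain ⟨c, hc, hmass⟩ := mass_fourier_shell_le d
    have h2α' : 2 * alpha d 1 μ = g - d := by rw [h2α]; norm_num
    have reduce : ∀ a κ C : ℝ, 0 < C → (∀ y : ℝ, 1 ≤ y →
        ∑' j : ℕ, ENNReal.ofReal ((min y (2 ^ j)) ^ g * ((2 : ℝ) ^ j) ^ (-(d : ℝ))) ≤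
          ENNReal.ofReal (C * (y ^ a * (1 + Real.log y) ^ κ) ^ 2)) →
        ∀ f : L2 d, ∀ t, 0 ≤ t → ∑' j : ℕ, ENNReal.ofReal ((min (1 + t) (2 ^ j)) ^ g) *
          mass (𝓕 f) (shell d j) ≤
        ENNReal.ofReal (c * C * ((1 + t) ^ a * (1 + Real.log (1 + t)) ^ κ) ^ 2) *
          eLpNorm f (ENNReal.ofReal 1) volume ^ 2 := by
      intro a κ C hC h f t ht
      rw [ENNReal.ofReal_one, eLpNorm_one_eq_lintegral_enorm]
      calc _ ≤ ∑' j : ℕ, ENNReal.ofReal c * (ENNReal.ofReal ((min (1 + t) (2 ^ j)) ^ g *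
              ((2 : ℝ) ^ j) ^ (-(d : ℝ))) * (∫⁻ x, ‖f x‖ₑ) ^ 2) := by
            refine ENNReal.tsum_le_tsum fun j => ?_
            refine (mul_le_mul_right (hmass f j) _).trans (le_of_eq ?_)
            have hm : 0 ≤ min (1 + t) (2 ^ j) := le_min (by positivity) (by positivity)
            rw [← mul_assoc, ← mul_assoc, ← ENNReal.ofReal_mul (by positivity),
              ← ENNReal.ofReal_mul hc.le, Real.rpow_neg (by positivity), Real.rpow_natCast,
              inv_pow, mul_left_comm]
        _ ≤ ENNReal.ofReal c * (ENNReal.ofReal (C * ((1 + t) ^ a *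
              (1 + Real.log (1 + t)) ^ κ) ^ 2) * (∫⁻ x, ‖f x‖ₑ) ^ 2) := by
            rw [ENNReal.tsum_mul_left, ENNReal.tsum_mul_right]
            gcongr
            exact h (1 + t) (by linarith)
        _ = _ := by
            rw [← mul_assoc, ← ENNReal.ofReal_mul hc.le, mul_assoc c]
    -- Since 2α = g - d, the sign of α decides whether the weighted geometric series converges, has
    -- equal terms, or grows.
    rcases lt_trichotomy (alpha d 1 μ) 0 with h | h | h
    · obtain ⟨C, hC, hs⟩ := exists_tsum_min_of_lt (g := g) (D := d) (by linarith) (by linarith)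
      refine ⟨0, 0, c * C, le_rfl, one_pos, le_rfl, by positivity, fun t ht => ?_,
        reduce 0 0 C hC ?_⟩
      · rw [rate, if_pos (Or.inl h), zero_sub, zero_add]
      · simpa using hs
    -- The sum bounds the square of the norm, so its single logarithm becomes the exponent κ = 1/2.
    · obtain ⟨C, hC, hs⟩ := exists_tsum_min_of_eq (g := g) (by linarith)
      refine ⟨0, 1 / 2, c * C, le_rfl, one_pos, by norm_num, by positivity, fun t ht => ?_,
        reduce 0 (1 / 2) C hC fun y hy => ?_⟩
      · rw [rate, if_neg (by simp [h]), if_pos ⟨h, rfl⟩, zero_sub]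
      · have hgd : g = d := by linarith
        have hl : 0 ≤ 1 + Real.log y := by linarith [Real.log_nonneg hy]
        rw [Real.rpow_zero, one_mul, ← Real.sqrt_eq_rpow, Real.sq_sqrt hl, ← hgd]
        exact hs y hy
    · obtain ⟨C, hC, hs⟩ := exists_tsum_min_of_gt (g := g) hD (by linarith)
      refine ⟨alpha d 1 μ, 0, c * C, h.le, hα, le_rfl, by positivity, fun t ht => ?_,
        reduce (alpha d 1 μ) 0 C hC fun y hy => ?_⟩
      · rw [rate, if_neg (by rintro (h' | h') <;> linarith), if_neg (by rintro ⟨h', -⟩; linarith),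
          zero_add]
      · rw [Real.rpow_zero, mul_one, ← Real.rpow_natCast (y ^ alpha d 1 μ) 2,
          ← Real.rpow_mul (by linarith), mul_comm (alpha d 1 μ)]
        push_cast
        rw [h2α']
        exact hs y hy
  · obtain ⟨C, hC, hs⟩ := exists_tsum_mass_le hd hr hr₂
    have hG : 0 ≤ d * (2 - r) / r := div_nonneg (mul_nonneg hD.le (by linarith)) (by linarith)
    -- For r > 1 the weighted masses are already summable, so only the supremum of the remaining
    -- factor matters and α = 0 produces no logarithm.
    refine ⟨max (alpha d r μ) 0, 0, C, le_max_right _ _, max_lt hα one_pos, le_rfl, hC,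
      fun t ht => ?_, fun f t ht => ?_⟩
    · rw [rate, zero_add]
      rcases le_or_gt (alpha d r μ) 0 with h | h
      · rw [if_pos (h.lt_or_eq.imp id fun h' => ⟨h', hr⟩), max_eq_right h, zero_sub]
      · rw [if_neg (by rintro (h' | h') <;> linarith), if_neg (by rintro ⟨h', -⟩; linarith),
          max_eq_left h.le]
    · rw [Real.rpow_zero, mul_one]
      calc _ ≤ ∑' j : ℕ, ENNReal.ofReal (((1 + t) ^ max (alpha d r μ) 0) ^ 2) *
              (ENNReal.ofReal (((2 : ℝ) ^ j) ^ (d * (2 - r) / r)) * mass (𝓕 f) (shell d j)) := by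
            refine ENNReal.tsum_le_tsum fun j => ?_
            rw [← mul_assoc, ← ENNReal.ofReal_mul (by positivity)]
            gcongr
            refine min_rpow_le (by linarith) (one_le_pow₀ one_le_two) hG (by linarith)
              (le_max_right _ _) (by linarith [le_max_left (alpha d r μ) 0]) ?_
            rcases le_or_gt (alpha d r μ) 0 with h | h
            · exact Or.inl (max_eq_right h)
            · right
              rw [max_eq_left h.le]
              linarith
        _ ≤ ENNReal.ofReal (((1 + t) ^ max (alpha d r μ) 0) ^ 2) *
              (ENNReal.ofReal C * eLpNorm f (ENNReal.ofReal r) volume ^ 2) := by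
            rw [ENNReal.tsum_mul_left]
            gcongr
            exact hs f
        _ = _ := by
            rw [← mul_assoc, ← ENNReal.ofReal_mul (by positivity), mul_comm C]

end Growth

/-! The norms on the Fourier side -/

section Norms

open FourierTransform

variable {d : ℕ}

theorem l2Norm_toDistr (f : L2 d) : l2Norm (toDistr f) = ‖f‖ₑ := by
  refine le_antisymm
    (iInf₂_le (f := fun (g : L2 d) (_ : toDistr g = toDistr f) => ‖g‖ₑ) f rfl) (le_iInf₂ fun g hg => ?_)
  rw [toDistr_injective hg]

theorem exists_of_l2Norm_lt_top {T : Distr d} (h : l2Norm T < ⊤) : ∃ f : L2 d, toDistr f = T := by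
  obtain ⟨f, hf⟩ := iInf_lt_iff.1 h
  obtain ⟨hfT, -⟩ := iInf_lt_iff.1 hf
  exact ⟨f, hfT⟩

theorem hDotOneNorm_sq (T : Distr d) : hDotOneNorm T ^ 2 = ∑ j, l2Norm (pderiv j T) ^ 2 := by
  rw [hDotOneNorm, ← ENNReal.rpow_natCast, ← ENNReal.rpow_mul]
  norm_num

/-- The symbol `2πi ξ_j` of the partial derivative. -/
def pderivSymbol (j : Fin d) (ξ : Space d) : ℂ := 2 * Real.pi * Complex.I * (ξ j : ℝ)

theorem hasTemperateGrowth_coord (j : Fin d) :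
    (fun ξ : Space d => ((ξ j : ℝ) : ℂ)).HasTemperateGrowth :=
  Function.Complex.hasTemperateGrowth_ofReal.comp
    (EuclideanSpace.proj (𝕜 := ℝ) j : Space d →L[ℝ] ℝ).hasTemperateGrowth

theorem hasTemperateGrowth_pderivSymbol (j : Fin d) : (pderivSymbol j).HasTemperateGrowth :=
  (Function.HasTemperateGrowth.const (2 * Real.pi * Complex.I : ℂ)).mul (hasTemperateGrowth_coord j)

theorem measurable_pderivSymbol (j : Fin d) : Measurable (pderivSymbol j) :=
  (hasTemperateGrowth_pderivSymbol j).1.continuous.measurable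

theorem norm_pderivSymbol_le (j : Fin d) (ξ : Space d) : ‖pderivSymbol j ξ‖ ≤ freq ξ := by
  rw [pderivSymbol, freq]
  simp only [norm_mul, Complex.norm_ofNat, Complex.norm_real, Complex.norm_I, mul_one,
    Real.norm_of_nonneg Real.pi_pos.le]
  gcongr
  exact PiLp.norm_apply_le ξ j

theorem sum_norm_pderivSymbol_sq (ξ : Space d) : ∑ j, ‖pderivSymbol j ξ‖ ^ 2 = freq ξ ^ 2 := by
  simp only [pderivSymbol, freq, norm_mul, Complex.norm_ofNat, Complex.norm_real, Complex.norm_I,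
    mul_one, Real.norm_of_nonneg Real.pi_pos.le, mul_pow _ ‖_‖, ← Finset.mul_sum]
  rw [EuclideanSpace.norm_sq_eq]

theorem fourier_pderiv (j : Fin d) (T : Distr d) :
    𝓕 (pderiv j T) = TemperedDistribution.smulLeftCLM ℂ (pderivSymbol j) (𝓕 T) := by
  rw [pderiv, TemperedDistribution.fourier_lineDerivOp_eq]
  have h1 : (fun ξ : Space d => ((inner ℝ ξ (EuclideanSpace.single j (1 : ℝ)) : ℝ) : ℂ)) =
      fun ξ => ((ξ j : ℝ) : ℂ) := by
    funext ξ
    simp [EuclideanSpace.inner_single_right]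
  have h2 : (pderivSymbol j : Space d → ℂ) =
      (2 * Real.pi * Complex.I : ℂ) • fun ξ : Space d => ((ξ j : ℝ) : ℂ) := by
    funext ξ
    simp [pderivSymbol]
  rw [h1, h2, TemperedDistribution.smulLeftCLM_smul (hasTemperateGrowth_coord j)]
  rfl

theorem memLp_bessel_mul_pderivSymbol (j : Fin d) :
    MemLp (bessel d * pderivSymbol j) ⊤ (volume : Measure (Space d)) := by
  refine memLp_top_of_measurable (C := 2 * Real.pi) ?_ fun ξ => ?_
  · exact hasTemperateGrowth_bessel.1.continuous.measurable.mul (measurable_pderivSymbol j)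
  · rw [Pi.mul_apply, norm_mul, bessel_eq, Complex.norm_real, Real.norm_of_nonneg (by positivity),
      inv_mul_le_iff₀ (by positivity)]
    refine (norm_pderivSymbol_le j ξ).trans ?_
    unfold freq
    nlinarith [Real.pi_pos, mul_nonneg Real.pi_pos.le (sq_nonneg (‖ξ‖ - 1)),
      mul_nonneg Real.pi_pos.le (sq_nonneg ‖ξ‖)]

theorem bessel_ne_zero (ξ : Space d) : bessel d ξ ≠ 0 := by
  rw [bessel_eq]
  exact Complex.ofReal_ne_zero.2 (by positivity)

/-- The derivative symbol is unbounded, so the identity is first multiplied by (1+|ξ|²)⁻¹. Both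
sides are then bounded multipliers on L², and the nonvanishing factor cancels pointwise. -/
theorem ae_eq_of_smulLeftCLM_eq {f g : L2 d} {j : Fin d}
    (h : TemperedDistribution.smulLeftCLM ℂ (pderivSymbol j) (toDistr f) = toDistr g) :
    g =ᵐ[volume] fun ξ => pderivSymbol j ξ * f ξ := by
  have hprod : (bessel d * pderivSymbol j).HasTemperateGrowth :=
    hasTemperateGrowth_bessel.mul (hasTemperateGrowth_pderivSymbol j)
  have h1 : mulOp (bessel d) g = mulOp (bessel d * pderivSymbol j) f := by
    apply toDistr_injective
    rw [toDistr_mulOp hasTemperateGrowth_bessel memLp_bessel,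
      toDistr_mulOp hprod (memLp_bessel_mul_pderivSymbol j), ← h,
      TemperedDistribution.smulLeftCLM_smulLeftCLM_apply (hasTemperateGrowth_pderivSymbol j)
        hasTemperateGrowth_bessel, mul_comm]
  have h2 := coeFn_mulOp memLp_bessel g
  rw [h1] at h2
  filter_upwards [h2, coeFn_mulOp (memLp_bessel_mul_pderivSymbol j) f] with ξ h3 h4
  rw [h4, Pi.mul_apply, mul_assoc] at h3
  exact (mul_left_cancel₀ (bessel_ne_zero ξ) h3).symm

theorem ae_eq_fourier_of_pderiv_eq {f g : L2 d} {j : Fin d}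
    (h : pderiv j (toDistr f) = toDistr g) :
    (𝓕 g : L2 d) =ᵐ[volume] fun ξ => pderivSymbol j ξ * (𝓕 f : L2 d) ξ := by
  apply ae_eq_of_smulLeftCLM_eq
  rw [toDistr, toDistr, ← Lp.fourier_toTemperedDistribution_eq,
    ← Lp.fourier_toTemperedDistribution_eq, ← fourier_pderiv]
  exact congrArg _ h

/-- Plancherel in each coordinate, together with the fact that the squared moduli of the symbols
2πiξ_j add up to (2π|ξ|)². -/
theorem exists_freq_mul_of_pderiv_eq {f : L2 d} {G : Fin d → L2 d}
    (h : ∀ j, pderiv j (toDistr f) = toDistr (G j)) :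
    ∃ g : L2 d, g =ᵐ[volume] (fun ξ => (freq ξ : ℂ) * (𝓕 f : L2 d) ξ) ∧
      ‖g‖ₑ ^ 2 = ∑ j, ‖G j‖ₑ ^ 2 := by
  have hae : ∀ᵐ ξ, ∀ j, (𝓕 (G j) : L2 d) ξ = pderivSymbol j ξ * (𝓕 f : L2 d) ξ :=
    ae_all_iff.2 fun j => ae_eq_fourier_of_pderiv_eq (h j)
  have hsum : ∫⁻ ξ, ‖(freq ξ : ℂ) * (𝓕 f : L2 d) ξ‖ₑ ^ 2 = ∑ j, ‖G j‖ₑ ^ 2 := by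
    have e : ∀ j, ‖G j‖ₑ ^ 2 = ∫⁻ ξ, ‖(𝓕 (G j) : L2 d) ξ‖ₑ ^ 2 := by
      intro j
      rw [← enorm_sq_eq_lintegral, ← ofReal_norm_sq, ← ofReal_norm_sq, Lp.norm_fourier_eq]
    simp only [e]
    rw [← lintegral_finsetSum _ fun j _ => measurable_enorm_sq _]
    apply lintegral_congr_ae
    filter_upwards [hae] with ξ hξ
    simp only [hξ, enorm_mul, mul_pow, ← Finset.sum_mul]
    congr 1
    simp only [← ofReal_norm_sq]
    rw [← ENNReal.ofReal_sum_of_nonneg fun j _ => by positivity, sum_norm_pderivSymbol_sq,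
      Complex.norm_real, Real.norm_of_nonneg (freq_nonneg ξ)]
  have hmeas : AEStronglyMeasurable (fun ξ : Space d => (freq ξ : ℂ) * (𝓕 f : L2 d) ξ) volume :=
    (Complex.measurable_ofReal.comp measurable_freq).aestronglyMeasurable.mul
      (Lp.aestronglyMeasurable _)
  have hmem : MemLp (fun ξ : Space d => (freq ξ : ℂ) * (𝓕 f : L2 d) ξ) 2 volume := by
    refine ⟨hmeas, ?_⟩
    rw [eLpNorm_lt_top_iff_lintegral_rpow_enorm_lt_top (by norm_num) (by norm_num)]
    simp only [ENNReal.toReal_ofNat, ENNReal.rpow_ofNat]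
    rw [hsum]
    exact ENNReal.sum_lt_top.2 fun j _ => ENNReal.pow_lt_top enorm_lt_top
  refine ⟨hmem.toLp _, hmem.coeFn_toLp, ?_⟩
  rw [enorm_sq_eq_lintegral, ← hsum]
  apply lintegral_congr_ae
  filter_upwards [hmem.coeFn_toLp] with ξ hξ
  rw [hξ]

theorem exists_freq_mul_of_hDotOneNorm {f : L2 d} (h : hDotOneNorm (toDistr f) < ⊤) :
    ∃ g : L2 d, g =ᵐ[volume] (fun ξ => (freq ξ : ℂ) * (𝓕 f : L2 d) ξ) ∧
      ‖g‖ₑ = hDotOneNorm (toDistr f) := by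
  have h1 : ∀ j, l2Norm (pderiv j (toDistr f)) < ⊤ := by
    intro j
    have h2 : ∑ j, l2Norm (pderiv j (toDistr f)) ^ 2 < ⊤ := by
      rw [← hDotOneNorm_sq]
      exact ENNReal.pow_lt_top h
    have h3 := ENNReal.sum_lt_top.1 h2 j (Finset.mem_univ j)
    by_contra h4
    rw [not_lt_top_iff.1 h4] at h3
    simp at h3
  choose G hG using fun j => exists_of_l2Norm_lt_top (h1 j)
  obtain ⟨g, hg, hgn⟩ := exists_freq_mul_of_pderiv_eq fun j => (hG j).symm
  refine ⟨g, hg, ?_⟩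
  refine (ENNReal.pow_right_strictMono two_ne_zero).injective ?_
  simp only [hgn, hDotOneNorm_sq, ← hG, l2Norm_toDistr]

theorem hDotOneNorm_le_hOneNorm (T : Distr d) : hDotOneNorm T ≤ hOneNorm T := by
  rw [hOneNorm]
  calc hDotOneNorm T = (hDotOneNorm T ^ 2) ^ (1 / 2 : ℝ) := by
        rw [← ENNReal.rpow_natCast, ← ENNReal.rpow_mul]; norm_num
    _ ≤ _ := by gcongr; exact le_add_self

theorem le_sigmaNorm (r : ℝ) (v₀ v₁ : L2 d) :
    hDotOneNorm (toDistr v₀) ≤ sigmaNorm r v₀ v₁ ∧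
      eLpNorm v₀ (ENNReal.ofReal r) volume ≤ sigmaNorm r v₀ v₁ ∧ ‖v₁‖ₑ ≤ sigmaNorm r v₀ v₁ ∧
      eLpNorm v₁ (ENNReal.ofReal r) volume ≤ sigmaNorm r v₀ v₁ := by
  unfold sigmaNorm
  refine ⟨(hDotOneNorm_le_hOneNorm _).trans (le_add_right le_self_add),
    le_add_right le_add_self, le_add_left le_self_add, le_add_left le_add_self⟩

/-- Growth of the `L²` norm of the solution. -/
theorem exists_growth (hd : 1 ≤ d) {r : ℝ} (hr₁ : 1 ≤ r) (hr₂ : r < 2) {μ : ℝ}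
    (hα : alpha d r μ < 1) : ∃ a κ C : ℝ, 0 ≤ a ∧ a < 1 ∧ 0 ≤ κ ∧ 0 < C ∧
      (∀ t, 0 ≤ t → rate d r μ t = (1 + t) ^ (a - 1) * (1 + Real.log (1 + t)) ^ κ) ∧
      ∀ v₀ v₁ : L2 d, sigmaNorm r v₀ v₁ < ⊤ → ∀ v vt : ℝ → L2 d, IsSolution μ v₀ v₁ v vt →
        ∀ t, 0 ≤ t → ‖v t‖ₑ ≤
          ENNReal.ofReal (C * ((1 + t) ^ a * (1 + Real.log (1 + t)) ^ κ)) * sigmaNorm r v₀ v₁ := by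
  obtain ⟨a, κ, C₁, ha, ha1, hκ, hC₁, hrate, hsum⟩ := exists_rate_exponents hd hr₁ hr₂ hα
  obtain ⟨C₂, hC₂, hmass⟩ := exists_mass_shell_le d μ
  -- Both data components contribute equally at low frequency and at high frequency, hence the two
  -- factors 2. The estimate is for ‖v‖², so the final constant is a square root.
  set C₃ := 2 * (C₂ * C₁) + 2 * Real.exp |μ| with hC₃
  have hC₃0 : 0 < C₃ := by positivity
  refine ⟨a, κ + delta μ, √C₃, ha, ha1, add_nonneg hκ (delta_nonneg μ), by positivity, hrate, ?_⟩
  intro v₀ v₁ hσ v vt h t ht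
  obtain ⟨hs1, hs2, hs3, hs4⟩ := le_sigmaNorm r v₀ v₁
  set s := sigmaNorm r v₀ v₁
  have hF := h.isFourierSolution
  obtain ⟨g, hg, hgn⟩ := exists_freq_mul_of_hDotOneNorm (hs1.trans_lt hσ)
  rw [← h.initial_fst] at hg hs2
  rw [← h.initial_snd] at hs3 hs4
  set l := 1 + Real.log (1 + t) with hl
  have hl1 : 1 ≤ l := by linarith [Real.log_nonneg (show 1 ≤ 1 + t by linarith)]
  have hl0 : 0 < l := by linarith
  set K := (1 + t) ^ a * l ^ κ with hK
  have hV1 : ‖(𝓕 (vt 0) : L2 d)‖ₑ ≤ s := by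
    rwa [← ofReal_norm, Lp.norm_fourier_eq, ofReal_norm]
  have hhigh : mass (𝓕 (v t)) (highFreq d) ≤ ENNReal.ofReal (2 * Real.exp |μ|) * s ^ 2 := by
    calc _ ≤ ENNReal.ofReal (Real.exp |μ|) * (s ^ 2 + s ^ 2) := by
          refine (mass_highFreq_le hF hg ht).trans ?_
          gcongr
          rw [hgn]
          exact hs1
      _ = _ := by
          rw [← two_mul, ← mul_assoc, mul_comm 2, ENNReal.ofReal_mul (by positivity),
            ENNReal.ofReal_ofNat]
  have hlow : ∑' j, mass (𝓕 (v t)) (shell d j) ≤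
      ENNReal.ofReal (C₂ * l ^ (2 * delta μ)) * (ENNReal.ofReal (C₁ * K ^ 2) * s ^ 2
        + ENNReal.ofReal (C₁ * K ^ 2) * s ^ 2) := by
    refine (ENNReal.tsum_le_tsum fun j => hmass _ _ hF j t ht).trans ?_
    simp only [mul_add]
    rw [ENNReal.tsum_add, ENNReal.tsum_mul_left, ENNReal.tsum_mul_left]
    gcongr
    · exact (hsum (v 0) t ht).trans (by gcongr)
    · exact (hsum (vt 0) t ht).trans (by gcongr)
  have hfin : ‖v t‖ₑ ^ 2 ≤ (ENNReal.ofReal (√C₃ * ((1 + t) ^ a * l ^ (κ + delta μ))) * s) ^ 2 := by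
    have hK1 : 1 ≤ K := by
      rw [hK]
      exact one_le_mul_of_one_le_of_one_le (Real.one_le_rpow (by linarith) ha)
        (Real.one_le_rpow hl1 hκ)
    have hld : 1 ≤ l ^ delta μ := Real.one_le_rpow hl1 (delta_nonneg μ)
    have hl2 : l ^ (2 * delta μ) = (l ^ delta μ) ^ 2 := by
      rw [← Real.rpow_natCast _ 2, ← Real.rpow_mul hl0.le, mul_comm]
      norm_num
    calc ‖v t‖ₑ ^ 2 = ‖(𝓕 (v t) : L2 d)‖ₑ ^ 2 := by
          rw [← ofReal_norm, ← ofReal_norm, Lp.norm_fourier_eq]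
      _ ≤ _ := (enorm_sq_le_tsum_mass hd _).trans (add_le_add hlow hhigh)
      _ = ENNReal.ofReal (2 * (C₂ * C₁) * (K * l ^ delta μ) ^ 2 + 2 * Real.exp |μ|) * s ^ 2 := by
          rw [← two_mul, ENNReal.ofReal_add (by positivity) (by positivity), add_mul]
          congr 1
          rw [hl2, mul_left_comm, ← mul_assoc, ← mul_assoc, ← ENNReal.ofReal_ofNat 2,
            ← ENNReal.ofReal_mul (by positivity), ← ENNReal.ofReal_mul (by positivity)]
          congr 2
          ring
      _ ≤ ENNReal.ofReal ((√C₃ * ((1 + t) ^ a * l ^ (κ + delta μ))) ^ 2) * s ^ 2 := by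
          gcongr
          have hsq : (√C₃ * ((1 + t) ^ a * l ^ (κ + delta μ))) ^ 2 = C₃ * (K * l ^ delta μ) ^ 2 := by
            rw [mul_pow, Real.sq_sqrt hC₃0.le, Real.rpow_add hl0, ← mul_assoc]
          rw [hsq, hC₃]
          have : 1 ≤ (K * l ^ delta μ) ^ 2 :=
            one_le_pow₀ (one_le_mul_of_one_le_of_one_le hK1 hld)
          nlinarith [Real.exp_pos |μ|]
      _ = _ := by rw [ENNReal.ofReal_pow (by positivity), ← mul_pow]
  exact (ENNReal.pow_le_pow_left_iff two_ne_zero).1 hfin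

end Norms

/-! Variation of constants -/

section Duhamel

open scoped InnerProductSpace
open Filter Topology

/-- Pairing Z with its own increment e makes ⟨Z, e⟩ + ‖e‖G nonincreasing, which gives ‖e‖² ≤
‖e‖(G(a) - G(b)). No integrability of Z' is needed. -/
theorem norm_sub_le_of_deriv_le {H : Type*} [NormedAddCommGroup H] [InnerProductSpace ℝ H]
    {Z Z' : ℝ → H} {G G' : ℝ → ℝ} {a b : ℝ} (hab : a ≤ b) (hZ : ContinuousOn Z (Set.Icc a b))
    (hG : ContinuousOn G (Set.Icc a b)) (hZ' : ∀ t ∈ Set.Ioo a b, HasDerivAt Z (Z' t) t)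
    (hG' : ∀ t ∈ Set.Ioo a b, HasDerivAt G (G' t) t)
    (h : ∀ t ∈ Set.Ioo a b, ‖Z' t‖ ≤ -G' t) : ‖Z b - Z a‖ ≤ G a - G b := by
  set e := Z b - Z a with he
  have hanti : AntitoneOn (fun t => ⟪Z t, e⟫_ℝ + ‖e‖ * G t) (Set.Icc a b) := by
    have hd : ∀ t ∈ Set.Ioo a b, HasDerivAt (fun t => ⟪Z t, e⟫_ℝ + ‖e‖ * G t)
        (⟪Z' t, e⟫_ℝ + ‖e‖ * G' t) t := by
      intro t ht
      have h1 := (hZ' t ht).inner ℝ (hasDerivAt_const t e)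
      simp only [inner_zero_right, zero_add] at h1
      exact h1.add ((hG' t ht).const_mul _)
    apply antitoneOn_of_deriv_nonpos (convex_Icc a b)
    · exact (hZ.inner (𝕜 := ℝ) continuousOn_const).add (continuousOn_const.mul hG)
    · rw [interior_Icc]
      exact fun t ht => (hd t ht).differentiableAt.differentiableWithinAt
    · rw [interior_Icc]
      intro t ht
      rw [(hd t ht).deriv]
      nlinarith [real_inner_le_norm (Z' t) e, h t ht, norm_nonneg e]
  have h1 := hanti (Set.left_mem_Icc.2 hab) (Set.right_mem_Icc.2 hab) hab
  simp only at h1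
  have h2 : ⟪Z b, e⟫_ℝ - ⟪Z a, e⟫_ℝ = ‖e‖ ^ 2 := by
    rw [← inner_sub_left, real_inner_self_eq_norm_sq]
  by_contra! hlt
  -- Division by ‖e‖ leaves only the case e = 0, where monotonicity of G is enough.
  have h0 : ‖e‖ ≤ 0 := by
    by_contra! hpos
    nlinarith
  have h3 : 0 ≤ G a - G b := by
    have hG2 : AntitoneOn G (Set.Icc a b) := by
      apply antitoneOn_of_deriv_nonpos (convex_Icc a b) hG
      · rw [interior_Icc]
        exact fun t ht => (hG' t ht).differentiableAt.differentiableWithinAt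
      · rw [interior_Icc]
        intro t ht
        rw [(hG' t ht).deriv]
        linarith [h t ht, norm_nonneg (Z' t)]
    linarith [hG2 (Set.left_mem_Icc.2 hab) (Set.right_mem_Icc.2 hab) hab]
  linarith

/-- The function G is nonincreasing and bounded below, so it converges along the integers; its
distance to the limit is a Cauchy modulus for Y. It need not tend to zero. -/
theorem exists_limit_of_norm_sub_le {E : Type*} [NormedAddCommGroup E] [CompleteSpace E]
    {Y : ℝ → E} {G : ℝ → ℝ} (hG : ∀ t, 0 ≤ t → 0 ≤ G t)
    (h : ∀ s t, 0 ≤ s → s ≤ t → ‖Y t - Y s‖ ≤ G s - G t) :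
    ∃ y : E, ∀ t, 0 ≤ t → ‖Y t - y‖ ≤ G t := by
  have hanti : ∀ s t, 0 ≤ s → s ≤ t → G t ≤ G s := fun s t hs hst => by
    linarith [h s t hs hst, norm_nonneg (Y t - Y s)]
  have hA : Antitone fun n : ℕ => G n := fun m n hmn =>
    hanti m n (Nat.cast_nonneg m) (by exact_mod_cast hmn)
  have hB : BddBelow (Set.range fun n : ℕ => G n) :=
    ⟨0, by rintro _ ⟨n, rfl⟩; exact hG n (Nat.cast_nonneg n)⟩
  have hlim := tendsto_atTop_ciInf hA hB
  set g := ⨅ n : ℕ, G n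
  have hgle : ∀ n : ℕ, g ≤ G n := fun n => ciInf_le hB n
  have hc : CauchySeq fun n : ℕ => Y n := by
    refine cauchySeq_of_le_tendsto_0' (fun n : ℕ => G n - g) (fun n m hnm => ?_) ?_
    · rw [dist_comm, dist_eq_norm]
      linarith [h n m (Nat.cast_nonneg n) (by exact_mod_cast hnm), hgle m]
    · simpa using hlim.sub_const g
  obtain ⟨y, hy⟩ := cauchySeq_tendsto_of_complete hc
  refine ⟨y, fun t ht => ?_⟩
  have h1 : Tendsto (fun n : ℕ => ‖Y t - Y n‖) atTop (𝓝 ‖Y t - y‖) :=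
    (tendsto_const_nhds.sub hy).norm
  refine le_of_tendsto h1 ?_
  obtain ⟨N, hN⟩ := exists_nat_ge t
  filter_upwards [eventually_ge_atTop N] with n hn
  have h2 : t ≤ n := hN.trans (by exact_mod_cast hn)
  rw [norm_sub_rev]
  linarith [h t n ht h2, hG n (Nat.cast_nonneg n)]

/-- A primitive controlling `(1+t)^{a-2} (1+log(1+t))^κ`. -/
def decay (a κ t : ℝ) : ℝ :=
  2 / (1 - a) * ((1 + t) ^ (a - 1) * (1 + 2 * κ / (1 - a) + Real.log (1 + t)) ^ κ)

theorem decay_nonneg {a κ : ℝ} (ha : a < 1) (hκ : 0 ≤ κ) {t : ℝ} (ht : 0 ≤ t) :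
    0 ≤ decay a κ t := by
  have h1 : 0 < 1 - a := by linarith
  have h2 : 0 ≤ Real.log (1 + t) := Real.log_nonneg (by linarith)
  unfold decay
  positivity

theorem decay_le {a κ : ℝ} (ha : a < 1) (hκ : 0 ≤ κ) {t : ℝ} (ht : 0 ≤ t) :
    decay a κ t ≤ 2 / (1 - a) * (1 + 2 * κ / (1 - a)) ^ κ *
      ((1 + t) ^ (a - 1) * (1 + Real.log (1 + t)) ^ κ) := by
  have h1 : 0 < 1 - a := by linarith
  have h2 : 0 ≤ Real.log (1 + t) := Real.log_nonneg (by linarith)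
  have h3 : 0 ≤ 2 * κ / (1 - a) := by positivity
  have h4 : (1 + 2 * κ / (1 - a) + Real.log (1 + t)) ^ κ ≤
      (1 + 2 * κ / (1 - a)) ^ κ * (1 + Real.log (1 + t)) ^ κ := by
    rw [← Real.mul_rpow (by positivity) (by positivity)]
    gcongr
    nlinarith
  calc decay a κ t ≤ 2 / (1 - a) * ((1 + t) ^ (a - 1) *
        ((1 + 2 * κ / (1 - a)) ^ κ * (1 + Real.log (1 + t)) ^ κ)) := by
        unfold decay
        gcongr
    _ = _ := by ring

/-- Differentiating the logarithmic factor works against the decay. The shift A = 2κ/(1-a) and the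
prefactor 2/(1-a) leave 2(1+A+log(1+t)) - A, which still exceeds 1+A+log(1+t). -/
theorem hasDerivAt_decay {a κ t : ℝ} (ha : a < 1) (hκ : 0 ≤ κ) (ht : 0 < t) : ∃ G' : ℝ,
    HasDerivAt (decay a κ) G' t ∧
      (1 + t) ^ (a - 2) * (1 + Real.log (1 + t)) ^ κ ≤ -G' := by
  have h1 : 0 < 1 - a := by linarith
  have hτ : 0 < 1 + t := by linarith
  have h2 : 0 ≤ Real.log (1 + t) := Real.log_nonneg (by linarith)
  set A := 2 * κ / (1 - a) with hA
  have hA0 : 0 ≤ A := by positivity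
  have hAL : 0 < 1 + A + Real.log (1 + t) := by positivity
  have hd1 : HasDerivAt (fun t : ℝ => 1 + t) 1 t := (hasDerivAt_id t).const_add 1
  have hd2 := hd1.rpow_const (p := a - 1) (Or.inl hτ.ne')
  have hd3 := ((hd1.log hτ.ne').const_add (1 + A)).rpow_const (p := κ) (Or.inl hAL.ne')
  refine ⟨_, (hd2.mul hd3).const_mul (2 / (1 - a)), ?_⟩
  have e1 : (1 + t) ^ (a - 1) = (1 + t) ^ (a - 2) * (1 + t) := by
    rw [← Real.rpow_add_one hτ.ne']; ring_nf
  have e2 : (1 + A + Real.log (1 + t)) ^ κ =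
      (1 + A + Real.log (1 + t)) ^ (κ - 1) * (1 + A + Real.log (1 + t)) := by
    rw [← Real.rpow_add_one hAL.ne']; ring_nf
  have e3 : a - 1 - 1 = a - 2 := by ring
  have hP : 0 < (1 + t) ^ (a - 2) := by positivity
  set P := (1 + t) ^ (a - 2)
  have hQ : 0 < (1 + A + Real.log (1 + t)) ^ (κ - 1) := by positivity
  have hle : (1 + Real.log (1 + t)) ^ κ ≤ (1 + A + Real.log (1 + t)) ^ κ := by
    gcongr
    linarith
  rw [e3, e1]
  refine (mul_le_mul_of_nonneg_left hle hP.le).trans ?_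
  rw [e2]
  set Q := (1 + A + Real.log (1 + t)) ^ (κ - 1)
  have hκA : κ = A * (1 - a) / 2 := by rw [hA]; field_simp
  have e4 : -(2 / (1 - a) * (1 * (a - 1) * P * (Q * (1 + A + Real.log (1 + t))) +
      P * (1 + t) * (1 / (1 + t) * κ * Q))) =
      P * Q * (2 * (1 + A + Real.log (1 + t)) - 2 * κ / (1 - a)) := by
    field_simp
    ring
  rw [e4, ← hA]
  have : 0 < P * Q := by positivity
  nlinarith

/-- The expression is the real part of e^{ix}(e^{ih} - 1 - ih). The remainder is uniform in x, so
differentiating the cosine multiplier yields a derivative in operator norm on bounded frequencies.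
-/
theorem abs_cos_add_sub_le (x h : ℝ) :
    |Real.cos (x + h) - Real.cos x + h * Real.sin x| ≤ 3 * h ^ 2 := by
  have h1 : ‖Complex.exp (h * Complex.I) - 1 - h * Complex.I‖ ≤ 3 * h ^ 2 := by
    rcases le_or_gt |h| 1 with hh | hh
    · have hn : ‖(h : ℂ) * Complex.I‖ = |h| := by simp
      have := Complex.norm_exp_sub_one_sub_id_le (x := h * Complex.I) (by rw [hn]; exact hh)
      rw [hn, sq_abs] at this
      nlinarith [sq_nonneg h]
    · calc _ ≤ ‖Complex.exp (h * Complex.I)‖ + ‖(1 : ℂ)‖ + ‖(h : ℂ) * Complex.I‖ :=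
            (norm_sub_le _ _).trans (add_le_add_left (norm_sub_le _ _) _)
        _ = 1 + 1 + |h| := by simp [Complex.norm_exp_ofReal_mul_I]
        _ ≤ 3 * |h| ^ 2 := by nlinarith
        _ = _ := by rw [sq_abs]
  have h2 : Real.cos (x + h) - Real.cos x + h * Real.sin x =
      (Complex.exp (x * Complex.I) * (Complex.exp (h * Complex.I) - 1 - h * Complex.I)).re := by
    rw [Complex.exp_mul_I, Complex.exp_mul_I, Real.cos_add]
    simp [Complex.cos_ofReal_re, Complex.sin_ofReal_re]
    ring
  rw [h2]
  refine (Complex.abs_re_le_norm _).trans ?_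
  rw [norm_mul, Complex.norm_exp_ofReal_mul_I, one_mul]
  exact h1

variable {d : ℕ}

theorem hasDerivAt_mulOp {m : ℝ → Space d → ℂ} {m' : Space d → ℂ} {t K : ℝ}
    (hm : ∀ s, MemLp (m s) ⊤ (volume : Measure (Space d)))
    (hm' : MemLp m' ⊤ (volume : Measure (Space d)))
    (h : ∀ s ξ, ‖m s ξ - m t ξ - (s - t : ℝ) * m' ξ‖ ≤ K * (s - t) ^ 2) :
    HasDerivAt (fun s => (mulOp (m s)).restrictScalars ℝ) ((mulOp m').restrictScalars ℝ) t := by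
  rw [hasDerivAt_iff_isLittleO]
  refine Asymptotics.IsBigO.trans_isLittleO (g := fun s => ‖s - t‖ ^ 2) ?_
    (Asymptotics.isLittleO_pow_sub_sub t one_lt_two)
  refine Asymptotics.IsBigO.of_bound K (Eventually.of_forall fun s => ?_)
  have hK : 0 ≤ K * (s - t) ^ 2 := (norm_nonneg _).trans (h s 0)
  rw [norm_pow, norm_norm, Real.norm_eq_abs, sq_abs]
  refine ContinuousLinearMap.opNorm_le_bound _ hK fun f => ?_
  refine Lp.norm_le_mul_norm_of_ae_le_mul ?_
  have h1 : ((mulOp (m s)).restrictScalars ℝ - (mulOp (m t)).restrictScalars ℝ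
      - (s - t) • (mulOp m').restrictScalars ℝ) f = mulOp (m s) f - mulOp (m t) f
        - ((s - t : ℝ) : ℂ) • mulOp m' f := by
    rw [Complex.coe_smul]
    rfl
  rw [h1]
  filter_upwards [coeFn_mulOp (hm s) f, coeFn_mulOp (hm t) f, coeFn_mulOp hm' f,
    Lp.coeFn_sub (mulOp (m s) f - mulOp (m t) f) (((s - t : ℝ) : ℂ) • mulOp m' f),
    Lp.coeFn_sub (mulOp (m s) f) (mulOp (m t) f),
    Lp.coeFn_smul ((s - t : ℝ) : ℂ) (mulOp m' f)] with ξ h2 h3 h4 h5 h6 h7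
  rw [h5, Pi.sub_apply, h6, Pi.sub_apply, h7, Pi.smul_apply, h2, h3, h4, smul_eq_mul]
  calc _ = ‖(m s ξ - m t ξ - (s - t : ℝ) * m' ξ) * f ξ‖ := by ring_nf
    _ ≤ _ := by rw [norm_mul]; gcongr; exact h s ξ

end Duhamel

/-! ### Convergence of the free profiles -/

section AsymptoticState

open scoped InnerProductSpace
open Filter Topology

variable {d : ℕ}

/-- The symbol `cos(2π|ξ| t + θ)`. -/
def phase (θ t : ℝ) (ξ : Space d) : ℂ := (Real.cos (t * freq ξ + θ) : ℝ)

theorem measurable_phase (θ t : ℝ) : Measurable (phase θ t : Space d → ℂ) :=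
  Complex.measurable_ofReal.comp
    (Real.measurable_cos.comp ((measurable_freq.const_mul t).add_const θ))

theorem norm_phase_le (θ t : ℝ) (ξ : Space d) : ‖phase θ t ξ‖ ≤ 1 := by
  rw [phase, Complex.norm_real]
  exact Real.abs_cos_le_one _

theorem memLp_phase (θ t : ℝ) : MemLp (phase θ t) ⊤ (volume : Measure (Space d)) :=
  memLp_top_of_measurable (measurable_phase θ t) (norm_phase_le θ t)

/-- The symbol `(2π|ξ|)^p cos(2π|ξ| t + θ)`, restricted to a set of frequencies. -/
def cutoffPhase (B : Set (Space d)) (p : ℕ) (θ t : ℝ) (ξ : Space d) : ℂ :=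
  cutoff B ξ * ((freq ξ : ℂ) ^ p * phase θ t ξ)

theorem norm_freq_pow_mul_phase_le {R : ℝ} (p : ℕ) (θ t : ℝ) {ξ : Space d} (h : freq ξ ≤ R) :
    ‖(freq ξ : ℂ) ^ p * phase θ t ξ‖ ≤ R ^ p := by
  rw [norm_mul, norm_pow, Complex.norm_real, Real.norm_of_nonneg (freq_nonneg ξ)]
  refine (mul_le_of_le_one_right (pow_nonneg (freq_nonneg ξ) p) (norm_phase_le θ t ξ)).trans ?_
  exact pow_le_pow_left₀ (freq_nonneg ξ) h p

theorem memLp_cutoffPhase {B : Set (Space d)} (hB : MeasurableSet B) {R : ℝ} (hR₀ : 0 ≤ R)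
    (hR : ∀ ξ ∈ B, freq ξ ≤ R) (p : ℕ) (θ t : ℝ) :
    MemLp (cutoffPhase B p θ t) ⊤ (volume : Measure (Space d)) :=
  memLp_cutoff_mul hB (((Complex.measurable_ofReal.comp measurable_freq).pow_const p).mul
    (measurable_phase θ t)) (pow_nonneg hR₀ p)
    fun ξ hξ => norm_freq_pow_mul_phase_le p θ t (hR ξ hξ)

/-- A time derivative multiplies by ω and advances the phase by π/2, so sine and cosine form one
family closed under differentiation. -/
theorem hasDerivAt_cutoffPhase {B : Set (Space d)} (hB : MeasurableSet B) {R : ℝ} (hR₀ : 0 ≤ R)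
    (hR : ∀ ξ ∈ B, freq ξ ≤ R) (p : ℕ) (θ t : ℝ) :
    HasDerivAt (fun s => (mulOp (cutoffPhase B p θ s)).restrictScalars ℝ)
      ((mulOp (cutoffPhase B (p + 1) (θ + Real.pi / 2) t)).restrictScalars ℝ) t := by
  refine hasDerivAt_mulOp (K := R ^ p * (3 * R ^ 2)) (memLp_cutoffPhase hB hR₀ hR p θ)
    (memLp_cutoffPhase hB hR₀ hR _ _ _) fun s ξ => ?_
  have h1 : cutoffPhase B p θ s ξ - cutoffPhase B p θ t ξ
      - (s - t : ℝ) * cutoffPhase B (p + 1) (θ + Real.pi / 2) t ξ =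
      cutoff B ξ * ((freq ξ ^ p * (Real.cos ((t * freq ξ + θ) + (s - t) * freq ξ)
        - Real.cos (t * freq ξ + θ) + (s - t) * freq ξ * Real.sin (t * freq ξ + θ)) : ℝ) : ℂ) := by
    simp only [cutoffPhase, phase]
    rw [← add_assoc, Real.cos_add_pi_div_two,
      show t * freq ξ + θ + (s - t) * freq ξ = s * freq ξ + θ by ring]
    push_cast
    ring
  rw [h1]
  refine norm_cutoff_mul_le (h := fun ξ : Space d => ((freq ξ ^ p *
    (Real.cos ((t * freq ξ + θ) + (s - t) * freq ξ) - Real.cos (t * freq ξ + θ) +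
      (s - t) * freq ξ * Real.sin (t * freq ξ + θ)) : ℝ) : ℂ)) (by positivity) (fun ξ hξ => ?_) ξ
  have h2 := freq_nonneg ξ
  have h3 := hR ξ hξ
  rw [Complex.norm_real, norm_mul, norm_pow, Real.norm_of_nonneg h2, Real.norm_eq_abs]
  calc _ ≤ R ^ p * (3 * ((s - t) * freq ξ) ^ 2) := by
        gcongr
        exact abs_cos_add_sub_le _ _
    _ = R ^ p * (3 * freq ξ ^ 2) * (s - t) ^ 2 := by ring
    _ ≤ _ := by gcongr

/-- Monotone convergence of the mass removes the frequency cutoff from bounds that are uniform in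
its size. -/
theorem norm_le_of_forall_cutoff {f : L2 d} {c : ℝ} (hc : 0 ≤ c)
    (h : ∀ n : ℕ, ‖mulOp (cutoff {ξ : Space d | freq ξ ≤ n}) f‖ ≤ c) : ‖f‖ ≤ c := by
  have hB : ∀ n : ℕ, MeasurableSet {ξ : Space d | freq ξ ≤ n} := fun n =>
    measurableSet_le measurable_freq measurable_const
  have hU : (⋃ n : ℕ, {ξ : Space d | freq ξ ≤ n}) = Set.univ :=
    Set.eq_univ_of_forall fun ξ => Set.mem_iUnion.2 (exists_nat_ge (freq ξ))
  have hmono : Monotone fun n : ℕ => {ξ : Space d | freq ξ ≤ n} := fun m n hmn ξ hξ =>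
    le_trans (Set.mem_ofPred.1 hξ) (Nat.cast_le.2 hmn)
  have h1 : ‖f‖ₑ ^ 2 ≤ ENNReal.ofReal (c ^ 2) := by
    rw [← mass_univ, ← hU, hmono.measure_iUnion]
    refine iSup_le fun n => ?_
    rw [← enorm_mulOp_cutoff_sq f (hB n), ← ofReal_norm_sq]
    exact ENNReal.ofReal_le_ofReal (pow_le_pow_left₀ (norm_nonneg _) (h n) 2)
  rw [← ofReal_norm_sq, ENNReal.ofReal_le_ofReal_iff (by positivity)] at h1
  exact (pow_le_pow_iff_left₀ (norm_nonneg f) hc two_ne_zero).1 h1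

variable {μ : ℝ} {V V₁ X : ℝ → L2 d}

/-- The free profile `cos(t|∇|+θ) |∇|v - sin(t|∇|+θ) ∂_t v` on the Fourier side, where `X = |∇|v`. -/
def profile (X V₁ : ℝ → L2 d) (θ t : ℝ) : L2 d :=
  mulOp (phase θ t) (X t) + mulOp (phase (θ + Real.pi / 2) t) (V₁ t)

/-- The second term keeps an extra cutoff on V₁ because the equation for the derivative of V₁ is
available only in localized form. -/
theorem cutoff_profile {B : Set (Space d)} (hB : MeasurableSet B) {R : ℝ} (hR₀ : 0 ≤ R)
    (hR : ∀ ξ ∈ B, freq ξ ≤ R) {t : ℝ}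
    (hX : X t =ᵐ[volume] fun ξ => (freq ξ : ℂ) * V t ξ) (θ : ℝ) :
    mulOp (cutoff B) (profile X V₁ θ t) = mulOp (cutoffPhase B 1 θ t) (V t) +
      mulOp (cutoffPhase B 0 (θ + Real.pi / 2) t) (mulOp (cutoff B) (V₁ t)) := by
  rw [profile]
  apply Lp.ext
  filter_upwards [coeFn_mulOp (memLp_cutoff hB) (mulOp (phase θ t) (X t) +
      mulOp (phase (θ + Real.pi / 2) t) (V₁ t)),
    Lp.coeFn_add (mulOp (phase θ t) (X t)) (mulOp (phase (θ + Real.pi / 2) t) (V₁ t)),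
    coeFn_mulOp (memLp_phase θ t) (X t), coeFn_mulOp (memLp_phase (θ + Real.pi / 2) t) (V₁ t), hX,
    Lp.coeFn_add (mulOp (cutoffPhase B 1 θ t) (V t))
      (mulOp (cutoffPhase B 0 (θ + Real.pi / 2) t) (mulOp (cutoff B) (V₁ t))),
    coeFn_mulOp (memLp_cutoffPhase hB hR₀ hR 1 θ t) (V t),
    coeFn_mulOp (memLp_cutoffPhase hB hR₀ hR 0 (θ + Real.pi / 2) t) (mulOp (cutoff B) (V₁ t)),
    coeFn_mulOp (memLp_cutoff hB) (V₁ t)] with ξ h1 h2 h3 h4 h5 h6 h7 h8 h9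
  rw [h1, h2, Pi.add_apply, h3, h4, h5, h6, Pi.add_apply, h7, h8, h9, cutoffPhase, cutoffPhase]
  linear_combination (-phase (θ + Real.pi / 2) t ξ * (V₁ t) ξ) * cutoff_mul_self B ξ

/-- When ω cos(tω+θ)V - sin(tω+θ)V₁ is differentiated, all terms of the free equation cancel and
μ(1+t)⁻² sin(tω+θ)V remains. The growth of ‖V‖ makes its norm at most minus the derivative of |μ|K
times `decay`, independently of the cutoff. -/
theorem IsFourierSolution.norm_cutoff_profile_sub_le (h : IsFourierSolution μ V V₁)
    (hX : ∀ t, 0 ≤ t → X t =ᵐ[volume] fun ξ => (freq ξ : ℂ) * V t ξ) {a κ K : ℝ} (ha : a < 1)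
    (hκ : 0 ≤ κ) (hK : 0 ≤ K)
    (hV : ∀ t, 0 ≤ t → ‖V t‖ ≤ K * ((1 + t) ^ a * (1 + Real.log (1 + t)) ^ κ))
    {B : Set (Space d)} (hB : MeasurableSet B) {R : ℝ} (hR₀ : 0 ≤ R)
    (hR : ∀ ξ ∈ B, freq ξ ≤ R) (θ : ℝ) {s t : ℝ} (hs : 0 ≤ s) (hst : s ≤ t) :
    ‖mulOp (cutoff B) (profile X V₁ θ t) - mulOp (cutoff B) (profile X V₁ θ s)‖ ≤
      |μ| * K * decay a κ s - |μ| * K * decay a κ t := by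
  rw [cutoff_profile hB hR₀ hR (hX s hs), cutoff_profile hB hR₀ hR (hX t (hs.trans hst))]
  choose! D hD hD' using fun t : ℝ => hasDerivAt_decay (t := t) ha hκ
  have hA := hasDerivAt_cutoffPhase hB hR₀ hR 1 θ
  have hS := hasDerivAt_cutoffPhase hB hR₀ hR 0 (θ + Real.pi / 2)
  refine norm_sub_le_of_deriv_le
    (Z := fun τ => (mulOp (cutoffPhase B 1 θ τ)).restrictScalars ℝ (V τ) +
      (mulOp (cutoffPhase B 0 (θ + Real.pi / 2) τ)).restrictScalars ℝ (mulOp (cutoff B) (V₁ τ)))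
    (G := fun τ => |μ| * K * decay a κ τ) (G' := fun τ => |μ| * K * D τ) hst ?_ ?_
    (fun τ hτ => ((hA τ).clm_apply (h.deriv τ (hs.trans_lt hτ.1))).add
      ((hS τ).clm_apply (h.deriv₁ B hB R hR τ (hs.trans_lt hτ.1))))
    (fun τ hτ => (hD τ (hs.trans_lt hτ.1)).const_mul _) fun τ hτ => ?_
  · have hsub : Set.Icc s t ⊆ Set.Ici 0 := fun x hx => hs.trans hx.1
    refine ContinuousOn.add ?_ ?_
    · exact ContinuousOn.clm_apply (fun x _ => (hA x).continuousAt.continuousWithinAt)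
        (h.cont.mono hsub)
    · exact ContinuousOn.clm_apply (fun x _ => (hS x).continuousAt.continuousWithinAt)
        ((mulOp (cutoff B)).continuous.comp_continuousOn (h.cont₁.mono hsub))
  · refine continuousOn_const.mul fun x hx => ContinuousAt.continuousWithinAt ?_
    have hx0 : 0 ≤ x := hs.trans hx.1
    unfold decay
    have h1 : (1 + x) ≠ 0 := by linarith
    have h2 : 0 ≤ Real.log (1 + x) := Real.log_nonneg (by linarith)
    have h3 : 0 ≤ 2 * κ / (1 - a) := div_nonneg (by linarith) (by linarith)
    have hc : ContinuousAt (fun t : ℝ => 1 + t) x := by fun_prop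
    refine continuousAt_const.mul (ContinuousAt.mul ?_ ?_)
    · exact hc.rpow_const (Or.inl h1)
    · exact (continuousAt_const.add (hc.log h1)).rpow_const
        (Or.inl (ne_of_gt (show 0 < 1 + 2 * κ / (1 - a) + Real.log (1 + x) by positivity)))
  · have hτ0 : 0 < τ := hs.trans_lt hτ.1
    have h1 : (0 : ℝ) < 1 + τ := by linarith
    have hle : ‖(mulOp (cutoffPhase B (1 + 1) (θ + Real.pi / 2) τ)).restrictScalars ℝ (V τ) +
        (mulOp (cutoffPhase B 1 θ τ)).restrictScalars ℝ (V₁ τ) +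
        ((mulOp (cutoffPhase B (0 + 1) (θ + Real.pi / 2 + Real.pi / 2) τ)).restrictScalars ℝ
          (mulOp (cutoff B) (V₁ τ)) +
        (mulOp (cutoffPhase B 0 (θ + Real.pi / 2) τ)).restrictScalars ℝ
          (-mulOp (fun ξ => cutoff B ξ * ((freq ξ ^ 2 : ℝ) : ℂ)) (V τ)
            - (μ / (1 + τ) ^ 2) • mulOp (cutoff B) (V τ)))‖ ≤ |μ| / (1 + τ) ^ 2 * ‖V τ‖ := by
      have hτμ : 0 ≤ |μ| / (1 + τ) ^ 2 := by positivity
      have hm := memLp_cutoffPhase hB hR₀ hR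
      set w := mulOp (cutoff B) (V₁ τ) with hw
      set q := mulOp (fun ξ => cutoff B ξ * ((freq ξ ^ 2 : ℝ) : ℂ)) (V τ) with hq
      set z := mulOp (cutoff B) (V τ) with hz
      simp only [ContinuousLinearMap.coe_restrictScalars', zero_add, one_add_one_eq_two]
      refine Lp.norm_le_mul_norm_of_ae_le_mul ?_
      filter_upwards [Lp.coeFn_add
          (mulOp (cutoffPhase B 2 (θ + Real.pi / 2) τ) (V τ) + mulOp (cutoffPhase B 1 θ τ) (V₁ τ))
          (mulOp (cutoffPhase B 1 (θ + Real.pi / 2 + Real.pi / 2) τ) w +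
            mulOp (cutoffPhase B 0 (θ + Real.pi / 2) τ) (-q - (μ / (1 + τ) ^ 2) • z)),
        Lp.coeFn_add (mulOp (cutoffPhase B 2 (θ + Real.pi / 2) τ) (V τ))
          (mulOp (cutoffPhase B 1 θ τ) (V₁ τ)),
        Lp.coeFn_add (mulOp (cutoffPhase B 1 (θ + Real.pi / 2 + Real.pi / 2) τ) w)
          (mulOp (cutoffPhase B 0 (θ + Real.pi / 2) τ) (-q - (μ / (1 + τ) ^ 2) • z)),
        coeFn_mulOp (hm 2 (θ + Real.pi / 2) τ) (V τ), coeFn_mulOp (hm 1 θ τ) (V₁ τ),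
        coeFn_mulOp (hm 1 (θ + Real.pi / 2 + Real.pi / 2) τ) w,
        coeFn_mulOp (hm 0 (θ + Real.pi / 2) τ) (-q - (μ / (1 + τ) ^ 2) • z),
        Lp.coeFn_sub (-q) ((μ / (1 + τ) ^ 2) • z), Lp.coeFn_neg q,
        Lp.coeFn_smul (μ / (1 + τ) ^ 2) z, coeFn_mulOp (memLp_cutoff hB) (V₁ τ),
        coeFn_mulOp (memLp_cutoff_freq_sq hB hR) (V τ), coeFn_mulOp (memLp_cutoff hB) (V τ)]
        with ξ h2 h3 h4 h5 h6 h7 h8 h9 h10 h11 h12 h13 h14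
      rw [h2, Pi.add_apply, h3, Pi.add_apply, h4, Pi.add_apply, h5, h6, h7, h8, h9, Pi.sub_apply,
        h10, Pi.neg_apply, h11, Pi.smul_apply, hw, h12, hq, h13, hz, h14]
      have hπ : phase (θ + Real.pi / 2 + Real.pi / 2) τ ξ = -phase θ τ ξ := by
        simp only [phase]
        rw [← add_assoc, ← add_assoc, add_assoc (τ * freq ξ + θ), add_halves, Real.cos_add_pi]
        push_cast
        rfl
      have h15 : cutoffPhase B 2 (θ + Real.pi / 2) τ ξ * (V τ) ξ +
          cutoffPhase B 1 θ τ ξ * (V₁ τ) ξ +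
          (cutoffPhase B 1 (θ + Real.pi / 2 + Real.pi / 2) τ ξ * (cutoff B ξ * (V₁ τ) ξ) +
          cutoffPhase B 0 (θ + Real.pi / 2) τ ξ *
            (-(cutoff B ξ * ((freq ξ ^ 2 : ℝ) : ℂ) * (V τ) ξ) -
              (μ / (1 + τ) ^ 2) • (cutoff B ξ * (V τ) ξ))) =
          -((μ / (1 + τ) ^ 2 : ℝ) : ℂ) * (cutoff B ξ * phase (θ + Real.pi / 2) τ ξ * (V τ) ξ) := by
        simp only [cutoffPhase, hπ, Complex.real_smul]
        push_cast
        -- The free terms cancel only after squares of the cutoff are replaced by the cutoff itself.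
        linear_combination (-(freq ξ : ℂ) * phase θ τ ξ * (V₁ τ) ξ
          - phase (θ + Real.pi / 2) τ ξ * (freq ξ : ℂ) ^ 2 * (V τ) ξ
          - phase (θ + Real.pi / 2) τ ξ * ((μ : ℂ) / (1 + τ) ^ 2) * (V τ) ξ) *
            cutoff_mul_self B ξ
      rw [h15, norm_mul, norm_neg, Complex.norm_real, Real.norm_eq_abs, abs_div,
        abs_of_pos (pow_pos h1 2), norm_mul]
      gcongr
      exact mul_le_of_le_one_left (norm_nonneg _)
        (norm_cutoff_mul_le zero_le_one (fun ξ _ => norm_phase_le _ _ ξ) ξ)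
    refine hle.trans ?_
    have h2 : (1 + τ) ^ (a - 2) = (1 + τ) ^ a / (1 + τ) ^ 2 := by
      rw [Real.rpow_sub h1, Real.rpow_two]
    calc _ ≤ |μ| / (1 + τ) ^ 2 * (K * ((1 + τ) ^ a * (1 + Real.log (1 + τ)) ^ κ)) := by
          gcongr
          exact hV τ hτ0.le
      _ = |μ| * K * ((1 + τ) ^ (a - 2) * (1 + Real.log (1 + τ)) ^ κ) := by
          rw [h2]; ring
      _ ≤ |μ| * K * (-D τ) := by
          gcongr
          exact hD' τ hτ0
      _ = _ := by ring

theorem IsFourierSolution.exists_profile_limit (h : IsFourierSolution μ V V₁)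
    (hX : ∀ t, 0 ≤ t → X t =ᵐ[volume] fun ξ => (freq ξ : ℂ) * V t ξ) {a κ K : ℝ} (ha : a < 1)
    (hκ : 0 ≤ κ) (hK : 0 ≤ K)
    (hV : ∀ t, 0 ≤ t → ‖V t‖ ≤ K * ((1 + t) ^ a * (1 + Real.log (1 + t)) ^ κ)) (θ : ℝ) :
    ∃ Y : L2 d, ∀ t, 0 ≤ t → ‖profile X V₁ θ t - Y‖ ≤ |μ| * K * decay a κ t := by
  refine exists_limit_of_norm_sub_le (fun t ht => ?_) fun s t hs hst => ?_
  · exact mul_nonneg (by positivity) (decay_nonneg ha hκ ht)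
  have key : ∀ n : ℕ, ‖mulOp (cutoff {ξ : Space d | freq ξ ≤ n})
      (profile X V₁ θ t - profile X V₁ θ s)‖ ≤ |μ| * K * decay a κ s - |μ| * K * decay a κ t := by
    intro n
    rw [map_sub]
    exact h.norm_cutoff_profile_sub_le hX ha hκ hK hV
      (measurableSet_le measurable_freq measurable_const) (Nat.cast_nonneg n) (fun ξ hξ => hξ) θ
      hs hst
  exact norm_le_of_forall_cutoff ((norm_nonneg _).trans (key 0)) key

/-- The profiles with θ = 0 and θ = -π/2 are the pair (X, V₁) rotated by the angle tω. Applying the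
inverse rotation to their limits gives a free solution, and the rotation's entries have modulus at
most 1, so the convergence rate is kept. -/
theorem exists_asymptotic_state {a κ : ℝ} (ha : a < 1) (hκ : 0 ≤ κ) : ∃ C : ℝ, 0 < C ∧
    ∀ (μ : ℝ) (V V₁ X : ℝ → L2 d), IsFourierSolution μ V V₁ →
    (∀ t, 0 ≤ t → X t =ᵐ[volume] fun ξ => (freq ξ : ℂ) * V t ξ) → ∀ K : ℝ, 0 ≤ K →
    (∀ t, 0 ≤ t → ‖V t‖ ≤ K * ((1 + t) ^ a * (1 + Real.log (1 + t)) ^ κ)) →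
    ∃ Y₀ Y₁ : L2 d, ∀ t, 0 ≤ t →
      ‖X t - (mulOp (phase 0 t) Y₀ + mulOp (phase (-(Real.pi / 2)) t) Y₁)‖ ≤
        C * |μ| * K * ((1 + t) ^ (a - 1) * (1 + Real.log (1 + t)) ^ κ) ∧
      ‖V₁ t - (mulOp (phase 0 t) Y₁ - mulOp (phase (-(Real.pi / 2)) t) Y₀)‖ ≤
        C * |μ| * K * ((1 + t) ^ (a - 1) * (1 + Real.log (1 + t)) ^ κ) := by
  have h1 : 0 < 1 - a := by linarith
  -- Each entry of the inverse rotation involves both profiles, hence the leading 2; the rest comes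
  -- from `decay_le`.
  refine ⟨2 * (2 / (1 - a) * (1 + 2 * κ / (1 - a)) ^ κ), by positivity,
    fun μ V V₁ X h hX K hK hV => ?_⟩
  obtain ⟨Y₀, hY₀⟩ := h.exists_profile_limit hX ha hκ hK hV 0
  obtain ⟨Y₁, hY₁⟩ := h.exists_profile_limit hX ha hκ hK hV (-(Real.pi / 2))
  refine ⟨Y₀, Y₁, fun t ht => ?_⟩
  have hphase : ∀ (θ : ℝ) (f : L2 d), ‖mulOp (phase θ t) f‖ ≤ ‖f‖ := fun θ f => by
    simpa using norm_mulOp_le (memLp_phase θ t) (norm_phase_le θ t) f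
  have hcs : ∀ ξ : Space d, phase 0 t ξ * phase 0 t ξ +
      phase (-(Real.pi / 2)) t ξ * phase (-(Real.pi / 2)) t ξ = 1 := by
    intro ξ
    simp only [phase, add_zero]
    rw [← sub_eq_add_neg, Real.cos_sub_pi_div_two]
    norm_cast
    nlinarith [Real.sin_sq_add_cos_sq (t * freq ξ)]
  have hneg : ∀ ξ : Space d, phase (0 + Real.pi / 2) t ξ = -phase (-(Real.pi / 2)) t ξ := by
    intro ξ
    simp only [phase, zero_add]
    rw [← sub_eq_add_neg, Real.cos_sub_pi_div_two, Real.cos_add_pi_div_two]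
    push_cast
    ring
  have hae : ∀ᵐ ξ : Space d, (profile X V₁ 0 t) ξ =
      phase 0 t ξ * (X t) ξ - phase (-(Real.pi / 2)) t ξ * (V₁ t) ξ ∧
      (profile X V₁ (-(Real.pi / 2)) t) ξ =
      phase (-(Real.pi / 2)) t ξ * (X t) ξ + phase 0 t ξ * (V₁ t) ξ := by
    simp only [profile, neg_add_cancel]
    filter_upwards [
      Lp.coeFn_add (mulOp (phase 0 t) (X t)) (mulOp (phase (0 + Real.pi / 2) t) (V₁ t)),
      Lp.coeFn_add (mulOp (phase (-(Real.pi / 2)) t) (X t)) (mulOp (phase 0 t) (V₁ t)),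
      coeFn_mulOp (memLp_phase 0 t) (X t), coeFn_mulOp (memLp_phase (0 + Real.pi / 2) t) (V₁ t),
      coeFn_mulOp (memLp_phase (-(Real.pi / 2)) t) (X t),
      coeFn_mulOp (memLp_phase 0 t) (V₁ t)] with ξ h1 h2 h3 h4 h5 h6
    rw [h1, h2, Pi.add_apply, Pi.add_apply, h3, h4, h5, h6, hneg]
    exact ⟨by ring, rfl⟩
  have e1 : X t = mulOp (phase 0 t) (profile X V₁ 0 t) +
      mulOp (phase (-(Real.pi / 2)) t) (profile X V₁ (-(Real.pi / 2)) t) := by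
    apply Lp.ext
    filter_upwards [hae, Lp.coeFn_add (mulOp (phase 0 t) (profile X V₁ 0 t))
      (mulOp (phase (-(Real.pi / 2)) t) (profile X V₁ (-(Real.pi / 2)) t)),
      coeFn_mulOp (memLp_phase 0 t) (profile X V₁ 0 t),
      coeFn_mulOp (memLp_phase (-(Real.pi / 2)) t) (profile X V₁ (-(Real.pi / 2)) t)]
      with ξ h1 h2 h3 h4
    rw [h2, Pi.add_apply, h3, h4, h1.1, h1.2]
    linear_combination (-(X t) ξ) * hcs ξ
  have e2 : V₁ t = mulOp (phase 0 t) (profile X V₁ (-(Real.pi / 2)) t) -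
      mulOp (phase (-(Real.pi / 2)) t) (profile X V₁ 0 t) := by
    apply Lp.ext
    filter_upwards [hae, Lp.coeFn_sub (mulOp (phase 0 t) (profile X V₁ (-(Real.pi / 2)) t))
      (mulOp (phase (-(Real.pi / 2)) t) (profile X V₁ 0 t)),
      coeFn_mulOp (memLp_phase 0 t) (profile X V₁ (-(Real.pi / 2)) t),
      coeFn_mulOp (memLp_phase (-(Real.pi / 2)) t) (profile X V₁ 0 t)]
      with ξ h1 h2 h3 h4
    rw [h2, Pi.sub_apply, h3, h4, h1.1, h1.2]
    linear_combination (-(V₁ t) ξ) * hcs ξ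
  have hsum : |μ| * K * decay a κ t + |μ| * K * decay a κ t ≤
      2 * (2 / (1 - a) * (1 + 2 * κ / (1 - a)) ^ κ) * |μ| * K *
        ((1 + t) ^ (a - 1) * (1 + Real.log (1 + t)) ^ κ) := by
    have := mul_le_mul_of_nonneg_left (decay_le ha hκ ht) (show 0 ≤ |μ| * K by positivity)
    linarith
  constructor
  · refine le_trans (le_of_eq ?_) ((norm_add_le (mulOp (phase 0 t) (profile X V₁ 0 t - Y₀))
      (mulOp (phase (-(Real.pi / 2)) t) (profile X V₁ (-(Real.pi / 2)) t - Y₁))).trans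
        ((add_le_add ((hphase _ _).trans (hY₀ t ht)) ((hphase _ _).trans (hY₁ t ht))).trans hsum))
    conv_lhs => rw [e1]
    rw [map_sub, map_sub]
    congr 1
    abel
  · refine le_trans (le_of_eq ?_) ((norm_sub_le
      (mulOp (phase 0 t) (profile X V₁ (-(Real.pi / 2)) t - Y₁))
      (mulOp (phase (-(Real.pi / 2)) t) (profile X V₁ 0 t - Y₀))).trans
        ((add_le_add ((hphase _ _).trans (hY₁ t ht)) ((hphase _ _).trans (hY₀ t ht))).trans hsum))
    conv_lhs => rw [e2]
    rw [map_sub, map_sub]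
    congr 1
    abel

end AsymptoticState

/-! Dividing by `|∇|` -/

section FreqDiv

open FourierTransform

variable {d : ℕ}

theorem norm_sub_zero_le_seminorm (u : 𝓢(Space d, ℂ)) (ξ : Space d) :
    ‖u ξ - u 0‖ ≤ SchwartzMap.seminorm ℂ 0 1 u * freq ξ := by
  have h1 : ∀ x ∈ (Set.univ : Set (Space d)), ‖fderiv ℝ u x‖ ≤ SchwartzMap.seminorm ℂ 0 1 u := by
    intro x _
    have := SchwartzMap.le_seminorm ℂ 0 1 u x
    rwa [pow_zero, one_mul, norm_iteratedFDeriv_one] at this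
  have h2 := convex_univ.norm_image_sub_le_of_norm_fderiv_le (𝕜 := ℝ)
    (fun x _ => u.differentiable x) h1 (Set.mem_univ 0) (Set.mem_univ ξ)
  rw [sub_zero] at h2
  refine h2.trans (mul_le_mul_of_nonneg_left ?_ (apply_nonneg _ _))
  rw [freq]
  nlinarith [Real.pi_gt_three, norm_nonneg ξ]

/-- The frequencies `2π|ξ| ≤ 1`. -/
def lowFreq (d : ℕ) : Set (Space d) := {ξ | freq ξ ≤ 1}

theorem measurableSet_lowFreq : MeasurableSet (lowFreq d) :=
  measurableSet_le measurable_freq measurable_const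

theorem integrableOn_lowFreq (Y : L2 d) : IntegrableOn Y (lowFreq d) := by
  have hsub : lowFreq d ⊆ Metric.closedBall 0 1 := by
    intro ξ hξ
    rw [mem_closedBall_zero_iff]
    have : 2 * Real.pi * ‖ξ‖ ≤ 1 := hξ
    nlinarith [Real.pi_gt_three, norm_nonneg ξ]
  have hfin : volume (lowFreq d) < ⊤ :=
    (measure_mono hsub).trans_lt measure_closedBall_lt_top
  have : IsFiniteMeasure (volume.restrict (lowFreq d)) := ⟨by simpa using hfin⟩
  exact ((Lp.memLp Y).restrict _).integrable (by norm_num)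

/-- In dimensions one and two, Y/|ξ| need not be integrable near 0. Subtracting u(0) gains a factor
|ξ| that cancels the singularity; formally it changes the distribution by a multiple of the delta at
0, that is, a constant in physical space, which has zero Ḣ¹ norm. -/
theorem norm_freqDiv_le (Y : L2 d) (u : 𝓢(Space d, ℂ)) (ξ : Space d) :
    ‖Y ξ / freq ξ * (u ξ - u 0)‖ ≤ SchwartzMap.seminorm ℂ 0 1 u * ‖Y ξ‖ := by
  rw [norm_mul, norm_div, Complex.norm_real, Real.norm_of_nonneg (freq_nonneg ξ)]
  rcases (freq_nonneg ξ).eq_or_lt with h | h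
  -- At the origin the convention of division by zero makes the integrand vanish.
  · rw [← h, div_zero, zero_mul]
    exact mul_nonneg (apply_nonneg _ _) (norm_nonneg _)
  · calc ‖Y ξ‖ / freq ξ * ‖u ξ - u 0‖ ≤
          ‖Y ξ‖ / freq ξ * (SchwartzMap.seminorm ℂ 0 1 u * freq ξ) := by
          gcongr
          exact norm_sub_zero_le_seminorm u ξ
      _ = _ := by field_simp

theorem integrableOn_freqDiv (Y : L2 d) (u : 𝓢(Space d, ℂ)) :
    IntegrableOn (fun ξ => Y ξ / freq ξ * (u ξ - u 0)) (lowFreq d) := by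
  refine Integrable.mono' ((integrableOn_lowFreq Y).norm.const_mul _) ?_
    (Filter.Eventually.of_forall (norm_freqDiv_le Y u))
  refine AEStronglyMeasurable.mul ?_ (u.continuous.sub continuous_const).aestronglyMeasurable
  exact ((Lp.stronglyMeasurable Y).measurable.div
    (Complex.measurable_ofReal.comp measurable_freq)).aestronglyMeasurable

/-- The low frequency part of `Y / (2π|ξ|)`, regularized at `ξ = 0`. -/
def freqDivLow (Y : L2 d) : 𝓢(Space d, ℂ) →L[ℂ] ℂ :=
  SchwartzMap.mkCLMtoNormedSpace (σ := RingHom.id ℂ)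
    (fun u => ∫ ξ in lowFreq d, Y ξ / freq ξ * (u ξ - u 0))
    (fun u w => by
      rw [← integral_add (integrableOn_freqDiv Y u) (integrableOn_freqDiv Y w)]
      congr 1
      funext ξ
      simp only [add_apply]
      ring)
    (fun c u => by
      simp only [RingHom.id_apply]
      rw [← integral_smul]
      congr 1
      funext ξ
      simp only [smul_apply, smul_eq_mul]
      ring)
    ⟨{(0, 1)}, ∫ ξ in lowFreq d, ‖Y ξ‖, by positivity, fun u => by
      refine (norm_integral_le_of_norm_le ((integrableOn_lowFreq Y).norm.const_mul _)
        (Filter.Eventually.of_forall (norm_freqDiv_le Y u))).trans (le_of_eq ?_)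
      rw [integral_const_mul, Finset.sup_singleton, mul_comm]
      rfl⟩

/-- The symbol `(2π|ξ|)⁻¹` on high frequencies. -/
def highFreqInv (ξ : Space d) : ℂ := cutoff (lowFreq d)ᶜ ξ * (freq ξ : ℂ)⁻¹

theorem memLp_highFreqInv : MemLp highFreqInv ⊤ (volume : Measure (Space d)) := by
  refine memLp_cutoff_mul measurableSet_lowFreq.compl
    (Complex.measurable_ofReal.comp measurable_freq).inv zero_le_one fun ξ hξ => ?_
  have h : 1 < freq ξ := not_le.1 hξ
  rw [norm_inv, Complex.norm_real, Real.norm_of_nonneg (freq_nonneg ξ)]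
  exact inv_le_one_of_one_le₀ h.le

/-- A tempered distribution `S` with `2π|ξ| S = Y`. -/
def freqDiv (Y : L2 d) : Distr d :=
  toDistr (mulOp highFreqInv Y) + ContinuousLinearMap.toPointwiseConvergenceCLM _ _ _ _ (freqDivLow Y)

theorem freqDiv_apply (Y : L2 d) (u : 𝓢(Space d, ℂ)) :
    freqDiv Y u = (∫ ξ, u ξ • mulOp highFreqInv Y ξ) +
      ∫ ξ in lowFreq d, Y ξ / freq ξ * (u ξ - u 0) := by
  rw [← Lp.toTemperedDistribution_apply]
  rfl

/-- A multiplier vanishing at the origin annihilates the correction u(0), so the low- and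
high-frequency pieces recombine into ordinary multiplication by m/(2π|ξ|) = n. -/
theorem smulLeftCLM_freqDiv {m n : Space d → ℂ} (hm : m.HasTemperateGrowth)
    (hn : MemLp n ⊤ (volume : Measure (Space d))) (hn₀ : n 0 = 0)
    (hmn : ∀ ξ, m ξ = n ξ * freq ξ) (Y : L2 d) :
    TemperedDistribution.smulLeftCLM ℂ m (freqDiv Y) = toDistr (mulOp n Y) := by
  ext u
  have hm₀ : m 0 = 0 := by rw [hmn, hn₀, zero_mul]
  have hcancel : ∀ ξ, (freq ξ : ℂ)⁻¹ * m ξ = n ξ := by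
    intro ξ
    rw [hmn]
    by_cases h : freq ξ = 0
    · have : ξ = 0 := by simpa [freq, Real.pi_ne_zero] using h
      rw [this, hn₀]
      simp
    · have : (freq ξ : ℂ) ≠ 0 := Complex.ofReal_ne_zero.2 h
      field_simp
  have hlow := (integrableOn_freqDiv Y (SchwartzMap.smulLeftCLM ℂ m u)).integrable_indicator
    measurableSet_lowFreq
  have hhigh : Integrable (fun ξ => (SchwartzMap.smulLeftCLM ℂ m u) ξ • mulOp highFreqInv Y ξ) :=
    ((SchwartzMap.smulLeftCLM ℂ m u).memLp 2 volume).integrable_mul (Lp.memLp _)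
  rw [TemperedDistribution.smulLeftCLM_apply_apply, freqDiv_apply,
    ← integral_indicator measurableSet_lowFreq, ← integral_add hhigh hlow, toDistr,
    Lp.toTemperedDistribution_apply]
  refine integral_congr_ae ?_
  filter_upwards [coeFn_mulOp memLp_highFreqInv Y, coeFn_mulOp hn Y] with ξ h1 h2
  simp only [h1, h2, SchwartzMap.smulLeftCLM_apply_apply hm, smul_eq_mul, hm₀, zero_mul, sub_zero,
    highFreqInv, cutoff, ← hcancel ξ]
  by_cases h : ξ ∈ lowFreq d
  · simp only [Set.indicator_of_mem h, Set.indicator_of_notMem (Set.notMem_compl_iff.2 h)]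
    ring
  · simp only [Set.indicator_of_notMem h, Set.indicator_of_mem (Set.mem_compl h), Pi.one_apply]
    ring

theorem l2Norm_of_fourier_eq {T : Distr d} {Q : L2 d} (h : 𝓕 T = toDistr Q) :
    l2Norm T = ‖Q‖ₑ := by
  have h1 : T = toDistr (𝓕⁻ Q : L2 d) := by
    refine Eq.trans ?_ (Lp.fourierInv_toTemperedDistribution_eq Q)
    exact (FourierTransform.fourierInv_fourier_eq T).symm.trans (congrArg _ h)
  rw [h1, l2Norm_toDistr]
  exact (Lp.fourierTransformₗᵢ (Space d) ℂ).symm.enorm_map Q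

theorem energyNorm_le {p : Distr d × Distr d} {N : ℝ≥0∞} (h₁ : ∀ j, l2Norm (pderiv j p.1) ≤ N)
    (h₂ : l2Norm p.2 ≤ N) : energyNorm p ≤ (d + 1) * N := by
  have h : hDotOneNorm p.1 ^ 2 + l2Norm p.2 ^ 2 ≤ ((d + 1) * N) ^ 2 := by
    rw [hDotOneNorm_sq]
    calc (∑ j, l2Norm (pderiv j p.1) ^ 2) + l2Norm p.2 ^ 2 ≤ (∑ _j : Fin d, N ^ 2) + N ^ 2 := by
          gcongr with j
          exact h₁ j
      _ = (d + 1) * N ^ 2 := by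
          rw [Finset.sum_const, Finset.card_univ, Fintype.card_fin, nsmul_eq_mul]
          ring
      _ ≤ (d + 1) ^ 2 * N ^ 2 := by
          gcongr
          exact le_self_pow₀ (by simp) two_ne_zero
      _ = _ := by ring
  calc energyNorm p ≤ (((d + 1) * N) ^ 2) ^ (1 / 2 : ℝ) := by
        rw [energyNorm]
        gcongr
    _ = _ := by
        rw [← ENNReal.rpow_natCast, ← ENNReal.rpow_mul]
        norm_num

/-- The symbol `i ξ_j / |ξ|` of the Riesz transform `∂_j |∇|⁻¹`. -/
def rieszSymbol (j : Fin d) (ξ : Space d) : ℂ := pderivSymbol j ξ / freq ξ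

theorem rieszSymbol_zero (j : Fin d) : rieszSymbol j 0 = 0 := by
  simp [rieszSymbol, freq]

theorem rieszSymbol_mul_freq (j : Fin d) (ξ : Space d) :
    rieszSymbol j ξ * freq ξ = pderivSymbol j ξ := by
  rw [rieszSymbol]
  by_cases h : freq ξ = 0
  · have := norm_pderivSymbol_le j ξ
    rw [h] at this
    rw [norm_le_zero_iff.1 this]
    simp
  · exact div_mul_cancel₀ _ (Complex.ofReal_ne_zero.2 h)

theorem measurable_rieszSymbol (j : Fin d) : Measurable (rieszSymbol j) :=
  (measurable_pderivSymbol j).div (Complex.measurable_ofReal.comp measurable_freq)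

theorem norm_rieszSymbol_le (j : Fin d) (ξ : Space d) : ‖rieszSymbol j ξ‖ ≤ 1 := by
  rw [rieszSymbol, norm_div, Complex.norm_real, Real.norm_of_nonneg (freq_nonneg ξ)]
  exact div_le_one_of_le₀ (norm_pderivSymbol_le j ξ) (freq_nonneg ξ)

theorem memLp_rieszSymbol (j : Fin d) : MemLp (rieszSymbol j) ⊤ (volume : Measure (Space d)) :=
  memLp_top_of_measurable (measurable_rieszSymbol j) (norm_rieszSymbol_le j)

theorem norm_rieszSymbol_mul_phase_le (j : Fin d) (θ t : ℝ) (ξ : Space d) :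
    ‖rieszSymbol j ξ * phase θ t ξ‖ ≤ 1 := by
  rw [norm_mul]
  exact mul_le_one₀ (norm_rieszSymbol_le j ξ) (norm_nonneg _) (norm_phase_le θ t ξ)

theorem memLp_rieszSymbol_mul_phase (j : Fin d) (θ t : ℝ) :
    MemLp (fun ξ => rieszSymbol j ξ * phase θ t ξ) ⊤ (volume : Measure (Space d)) :=
  memLp_top_of_measurable ((measurable_rieszSymbol j).mul (measurable_phase θ t))
    (norm_rieszSymbol_mul_phase_le j θ t)

theorem cosSymbol_eq (t : ℝ) : cosSymbol d t = phase 0 t := by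
  funext ξ
  rw [cosSymbol, phase, freq, add_zero]

theorem mulSinSymbol_eq (t : ℝ) (ξ : Space d) :
    mulSinSymbol d t ξ = phase (-(Real.pi / 2)) t ξ * freq ξ := by
  rw [mulSinSymbol, phase, ← sub_eq_add_neg, Real.cos_sub_pi_div_two, freq]
  push_cast
  ring

theorem freq_mul_sinDivSymbol (t : ℝ) (ξ : Space d) :
    freq ξ * sinDivSymbol d t ξ = phase (-(Real.pi / 2)) t ξ := by
  rw [sinDivSymbol, phase, ← sub_eq_add_neg, Real.cos_sub_pi_div_two]
  change (freq ξ : ℂ) * ((t * Real.sinc (t * freq ξ) : ℝ) : ℂ) = _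
  norm_cast
  by_cases h : t * freq ξ = 0
  · rw [h, Real.sin_zero]
    linear_combination Real.sinc 0 * h
  · rw [Real.sinc_of_ne_zero h]
    have : t ≠ 0 ∧ freq ξ ≠ 0 := mul_ne_zero_iff.1 h
    obtain ⟨h1, h2⟩ := this
    field_simp

/-- The data whose free evolution has the profiles `Y₀`, `Y₁`. -/
def waveState (Y₀ Y₁ : L2 d) : Distr d × Distr d := (𝓕⁻ (freqDiv Y₀), 𝓕⁻ (toDistr Y₁))

theorem energyNorm_waveState_lt_top (Y₀ Y₁ : L2 d) : energyNorm (waveState Y₀ Y₁) < ⊤ := by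
  have h1 : ∀ j, l2Norm (pderiv j (waveState Y₀ Y₁).1) ≤ ‖Y₀‖ₑ + ‖Y₁‖ₑ := by
    intro j
    have : 𝓕 (pderiv j (waveState Y₀ Y₁).1) = toDistr (mulOp (rieszSymbol j) Y₀) := by
      rw [fourier_pderiv, waveState, FourierTransform.fourier_fourierInv_eq]
      exact smulLeftCLM_freqDiv (hasTemperateGrowth_pderivSymbol j) (memLp_rieszSymbol j)
        (rieszSymbol_zero j) (fun ξ => (rieszSymbol_mul_freq j ξ).symm) Y₀
    rw [l2Norm_of_fourier_eq this]
    refine le_trans ?_ le_self_add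
    rw [enorm_le_iff_norm_le]
    simpa using norm_mulOp_le (memLp_rieszSymbol j) (norm_rieszSymbol_le j) Y₀
  have h2 : l2Norm (waveState Y₀ Y₁).2 ≤ ‖Y₀‖ₑ + ‖Y₁‖ₑ := by
    have : 𝓕 (waveState Y₀ Y₁).2 = toDistr Y₁ := by
      rw [waveState, FourierTransform.fourier_fourierInv_eq]
    rw [l2Norm_of_fourier_eq this]
    exact le_add_self
  refine (energyNorm_le h1 h2).trans_lt ?_
  exact ENNReal.mul_lt_top (by finiteness) (by finiteness)

/-- On the Fourier side, ∂_j is the Riesz symbol times 2π|ξ|. The factor 2π|ξ| cancels the inverse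
in the state, so only bounded multipliers of L² functions are left and Plancherel applies. -/
theorem energyNorm_sub_freeWave_le {f g X : L2 d}
    (hX : X =ᵐ[volume] fun ξ => (freq ξ : ℂ) * (𝓕 f : L2 d) ξ) (Y₀ Y₁ : L2 d) (t : ℝ) :
    energyNorm ((toDistr f, toDistr g) - freeWave t (waveState Y₀ Y₁)) ≤
      (d + 1) * max ‖X - (mulOp (phase 0 t) Y₀ + mulOp (phase (-(Real.pi / 2)) t) Y₁)‖ₑ
        ‖(𝓕 g : L2 d) - (mulOp (phase 0 t) Y₁ - mulOp (phase (-(Real.pi / 2)) t) Y₀)‖ₑ := by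
  refine energyNorm_le (fun j => le_max_of_le_left ?_) (le_max_of_le_right ?_)
  · have h : 𝓕 (pderiv j ((toDistr f, toDistr g) - freeWave t (waveState Y₀ Y₁)).1) =
        toDistr (mulOp (rieszSymbol j)
          (X - (mulOp (phase 0 t) Y₀ + mulOp (phase (-(Real.pi / 2)) t) Y₁))) := by
      have e1 : TemperedDistribution.smulLeftCLM ℂ (pderivSymbol j) (𝓕 (toDistr f)) =
          toDistr (mulOp (rieszSymbol j) X) := by
        rw [Lp.fourier_toTemperedDistribution_eq]
        ext u
        rw [TemperedDistribution.smulLeftCLM_apply_apply, toDistr, Lp.toTemperedDistribution_apply,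
          Lp.toTemperedDistribution_apply]
        apply integral_congr_ae
        filter_upwards [hX, coeFn_mulOp (memLp_rieszSymbol j) X] with ξ h1 h2
        rw [h2, h1, SchwartzMap.smulLeftCLM_apply_apply (hasTemperateGrowth_pderivSymbol j),
          ← rieszSymbol_mul_freq]
        simp only [smul_eq_mul]
        ring
      -- The cosine does not vanish at the origin, so it is first composed with the derivative
      -- symbol, which does; only the product may be applied to the regularized quotient by the
      -- cancellation above.
      have e2 : TemperedDistribution.smulLeftCLM ℂ (pderivSymbol j)
          (TemperedDistribution.smulLeftCLM ℂ (cosSymbol d t) (freqDiv Y₀)) =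
          toDistr (mulOp (rieszSymbol j) (mulOp (phase 0 t) Y₀)) := by
        rw [TemperedDistribution.smulLeftCLM_smulLeftCLM_apply (hasTemperateGrowth_cosSymbol d t)
          (hasTemperateGrowth_pderivSymbol j), mulOp_mulOp (memLp_rieszSymbol j) (memLp_phase 0 t)
          (memLp_rieszSymbol_mul_phase j 0 t)]
        refine smulLeftCLM_freqDiv ((hasTemperateGrowth_cosSymbol d t).mul
          (hasTemperateGrowth_pderivSymbol j)) (memLp_rieszSymbol_mul_phase j 0 t) ?_
          (fun ξ => ?_) Y₀
        · rw [rieszSymbol_zero, zero_mul]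
        · rw [Pi.mul_apply, cosSymbol_eq, ← rieszSymbol_mul_freq]
          ring
      have e3 : TemperedDistribution.smulLeftCLM ℂ (pderivSymbol j)
          (TemperedDistribution.smulLeftCLM ℂ (sinDivSymbol d t) (toDistr Y₁)) =
          toDistr (mulOp (rieszSymbol j) (mulOp (phase (-(Real.pi / 2)) t) Y₁)) := by
        have hs : sinDivSymbol d t * pderivSymbol j =
            fun ξ => rieszSymbol j ξ * phase (-(Real.pi / 2)) t ξ := by
          funext ξ
          rw [Pi.mul_apply, ← freq_mul_sinDivSymbol, ← rieszSymbol_mul_freq]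
          ring
        have hg := (hasTemperateGrowth_sinDivSymbol d t).mul (hasTemperateGrowth_pderivSymbol j)
        rw [TemperedDistribution.smulLeftCLM_smulLeftCLM_apply (hasTemperateGrowth_sinDivSymbol d t)
          (hasTemperateGrowth_pderivSymbol j), mulOp_mulOp (memLp_rieszSymbol j)
          (memLp_phase (-(Real.pi / 2)) t) (memLp_rieszSymbol_mul_phase j (-(Real.pi / 2)) t), hs,
          toDistr_mulOp (hs ▸ hg) (memLp_rieszSymbol_mul_phase j (-(Real.pi / 2)) t)]
      rw [fourier_pderiv]
      simp only [Prod.fst_add, Prod.fst_neg, freeWave, waveState, TemperedDistribution.fourierMultiplierCLM_apply,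
        sub_eq_add_neg, FourierTransform.fourier_add, FourierTransform.fourier_neg,
        FourierTransform.fourier_fourierInv_eq, map_neg, map_add]
      rw [e1, e2, e3]
      simp only [toDistr, ← Lp.toTemperedDistributionCLM_apply, map_neg, map_add]
    rw [l2Norm_of_fourier_eq h, enorm_le_iff_norm_le]
    simpa using norm_mulOp_le (memLp_rieszSymbol j) (norm_rieszSymbol_le j)
      (X - (mulOp (phase 0 t) Y₀ + mulOp (phase (-(Real.pi / 2)) t) Y₁))
  · have h : 𝓕 ((toDistr f, toDistr g) - freeWave t (waveState Y₀ Y₁)).2 =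
        toDistr ((𝓕 g : L2 d) -
          (mulOp (phase 0 t) Y₁ - mulOp (phase (-(Real.pi / 2)) t) Y₀)) := by
      have e1 : TemperedDistribution.smulLeftCLM ℂ (mulSinSymbol d t) (freqDiv Y₀) =
          toDistr (mulOp (phase (-(Real.pi / 2)) t) Y₀) :=
        smulLeftCLM_freqDiv (hasTemperateGrowth_mulSinSymbol d t) (memLp_phase _ t)
          (by simp [phase, freq]) (mulSinSymbol_eq t) Y₀
      have e2 : TemperedDistribution.smulLeftCLM ℂ (cosSymbol d t) (toDistr Y₁) =
          toDistr (mulOp (phase 0 t) Y₁) := by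
        rw [toDistr_mulOp (cosSymbol_eq (d := d) t ▸ hasTemperateGrowth_cosSymbol d t)
          (memLp_phase 0 t), cosSymbol_eq]
      simp only [Prod.snd_add, Prod.snd_neg, freeWave, waveState, TemperedDistribution.fourierMultiplierCLM_apply,
        sub_eq_add_neg, FourierTransform.fourier_add, FourierTransform.fourier_neg,
        FourierTransform.fourier_fourierInv_eq]
      rw [e1, e2, Lp.fourier_toTemperedDistribution_eq]
      simp only [toDistr, ← Lp.toTemperedDistributionCLM_apply, map_neg, map_add]
      abel
    rw [l2Norm_of_fourier_eq h]

end FreqDiv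

-- The growth bound supplies the profile convergence with K a multiple of the Σ^r norm, and the
-- limit profiles define the asymptotic state. The factor |μ| comes solely from the potential acting
-- as forcing.
open FourierTransform in
theorem exists_asymptotic_freeWave {d : ℕ} (hd : 1 ≤ d) {r : ℝ} (hr₁ : 1 ≤ r) (hr₂ : r < 2) {μ : ℝ}
    (hα : alpha d r μ < 1) :
    ∃ C : ℝ, 0 < C ∧ ∀ v₀ v₁ : L2 d, sigmaNorm r v₀ v₁ < ⊤ →
      ∀ v vt : ℝ → L2 d, IsSolution μ v₀ v₁ v vt →
        ∃ vp : Distr d × Distr d, energyNorm vp < ⊤ ∧ ∀ t : ℝ, 0 ≤ t →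
          energyNorm ((toDistr (v t), toDistr (vt t)) - freeWave t vp) ≤
            ENNReal.ofReal (C * |μ| * rate d r μ t) * sigmaNorm r v₀ v₁ := by
  obtain ⟨a, κ, C, -, ha₁, hκ, hC, hrate, hgrowth⟩ := exists_growth hd hr₁ hr₂ hα
  obtain ⟨C', hC', hstate⟩ := exists_asymptotic_state (d := d) ha₁ hκ
  refine ⟨(d + 1) * (C' * C), by positivity, fun v₀ v₁ hσ v vt hsol => ?_⟩
  have hX : ∀ t : ℝ, ∃ X : L2 d, 0 ≤ t →
      X =ᵐ[volume] fun ξ => (freq ξ : ℂ) * (𝓕 (v t) : L2 d) ξ := by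
    intro t
    by_cases ht : 0 ≤ t
    · choose G hG using hsol.continuous_grad
      obtain ⟨X, hX, -⟩ := exists_freq_mul_of_pderiv_eq fun j => (hG j).2 t ht
      exact ⟨X, fun _ => hX⟩
    · exact ⟨0, fun h => absurd h ht⟩
  choose X hX using hX
  set σ := sigmaNorm r v₀ v₁ with hσ'
  have hK : 0 ≤ C * σ.toReal := mul_nonneg hC.le ENNReal.toReal_nonneg
  obtain ⟨Y₀, Y₁, hY⟩ := hstate μ _ _ X hsol.isFourierSolution hX (C * σ.toReal) hK fun t ht => by
    have h1 : ‖v t‖ₑ.toReal ≤ _ :=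
      ENNReal.toReal_mono (by finiteness) (hgrowth v₀ v₁ hσ v vt hsol t ht)
    have h2 : 0 ≤ Real.log (1 + t) := Real.log_nonneg (by linarith)
    rw [toReal_enorm, ENNReal.toReal_mul, ENNReal.toReal_ofReal (by positivity)] at h1
    rw [show ‖(𝓕 (v t) : L2 d)‖ = ‖v t‖ from (Lp.fourierTransformₗᵢ (Space d) ℂ).norm_map (v t)]
    linarith
  refine ⟨waveState Y₀ Y₁, energyNorm_waveState_lt_top Y₀ Y₁, fun t ht => ?_⟩
  refine (energyNorm_sub_freeWave_le (hX t ht) Y₀ Y₁ t).trans ?_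
  have h2 : 0 ≤ Real.log (1 + t) := Real.log_nonneg (by linarith)
  set N := C' * |μ| * (C * σ.toReal) * ((1 + t) ^ (a - 1) * (1 + Real.log (1 + t)) ^ κ) with hN
  have h3 : ∀ f : L2 d, ‖f‖ ≤ N → ‖f‖ₑ ≤ ENNReal.ofReal N := fun f hf => by
    rw [← ofReal_norm]
    exact ENNReal.ofReal_le_ofReal hf
  refine (mul_le_mul_right (max_le (h3 _ (hY t ht).1) (h3 _ (hY t ht).2)) _).trans (le_of_eq ?_)
  rw [← ENNReal.ofReal_toReal hσ.ne, ← ENNReal.ofReal_mul' ENNReal.toReal_nonneg, hrate t ht, hN,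
    show ((d : ℝ≥0∞) + 1) = ENNReal.ofReal (d + 1) by
      rw [ENNReal.ofReal_add (by positivity) zero_le_one]; simp,
    ← ENNReal.ofReal_mul (by positivity)]
  congr 1
  ring

end

end ScaleInvariantKG

theorem theorem1p1 (d : ℕ) (hd : 1 ≤ d) (r : ℝ) (hr₁ : 1 ≤ r) (hr₂ : r < 2) (μ : ℝ)
    (hα : ScaleInvariantKG.alpha d r μ < 1) :
    ∃ C : ℝ, 0 < C ∧
      ∀ v₀ v₁ : ScaleInvariantKG.L2 d, ScaleInvariantKG.sigmaNorm r v₀ v₁ < ⊤ →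
        ∀ v vt : ℝ → ScaleInvariantKG.L2 d, ScaleInvariantKG.IsSolution μ v₀ v₁ v vt →
          ∃ vp : ScaleInvariantKG.Distr d × ScaleInvariantKG.Distr d,
            ScaleInvariantKG.energyNorm vp < ⊤ ∧
            ∀ t : ℝ, 0 ≤ t →
              ScaleInvariantKG.energyNorm
                  ((ScaleInvariantKG.toDistr (v t), ScaleInvariantKG.toDistr (vt t))
                    - ScaleInvariantKG.freeWave t vp)
                ≤ ENNReal.ofReal (C * |μ| * ScaleInvariantKG.rate d r μ t)
                  * ScaleInvariantKG.sigmaNorm r v₀ v₁ :=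
  ScaleInvariantKG.exists_asymptotic_freeWave hd hr₁ hr₂ hα
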